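/- Let $d\ge 1$, $k\in\{0,\dots,d-1\}$ and $m\ge 1$ be integers. Let $G(d,k)$ be the space of $k$-dimensional linear subspaces and $A(d,k)$ the space of $k$-dimensional affine subspaces ($k$-flats) of $\mathbb R^d$, and let $\mathcal C^d$ be the system of compact subsets of $\mathbb R^d$, all equipped with the Borel $\sigma$-fields of the Fell topology. Let $\mathbb Q$ be a probability measure on $G(d,k)$ and put $$\lambda(\cdot)=\int_{G(d,k)}\int_{L^\perp}\mathbf 1\{L+x\in\cdot\}\,\mathcal H^{d-k}(dx)\,\mathbb Q(dL).$$ For $t>0$ let $\eta_t$ be a Poisson process on $A(d,k)$ with intensity measure $t\lambda$ (that is, a stationary Poisson $k$-flat process in $\mathbb R^d$ with intensity $t$ and directional distribution $\mathbb Q$), all defined on one probability space. Let $\mathcal C^d_0\subset\mathcal C^d$ be a measurable family containing $\emptyset$ such that $rB\cap E\in\mathcal C_0^d$ for all $B\in\mathcal C_0^d$, $r>0$ and all affine subspaces $E\subset\mathbb R^d$. Let $\psi:\mathcal C_0^d\to\mathbb R$ be measurable with $\psi(\emptyset)=0$ and such that for every $B\in\mathcal C_0^d$ there is a finite constant $C_B$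 with $$\int|\psi(B\cap E_1\cap\dots\cap E_m)|^3\,\lambda^m(d(E_1,\dots,E_m))\le C_B .$$ For $B\in\mathcal C_0^d$ and $t>0$ let $$\zeta_t(B)=\frac1{m!}\int\psi(B\cap E_1\cap\dots\cap E_m)\,\eta_t^{(m)}(d(E_1,\dots,E_m)),\qquad \hat\zeta_t(B)=t^{-(m-1/2)}\big(\zeta_t(B)-\mathbb E\zeta_t(B)\big),$$ where integration with respect to $\eta_t^{(m)}$ means summation over all $m$-tuples of pairwise different flats of $\eta_t$. For $A,B\in\mathcal C_0^d$ let $$C(A,B)=\frac1{((m-1)!)^2}\int\Big(\int\psi(A\cap E_1\cap E_2\cap\dots\cap E_m)\,\lambda^{m-1}(d(E_2,\dots,E_m))\Big)\Big(\int\psi(B\cap E_1\cap E_2'\cap\dots\cap E_m')\,\lambda^{m-1}(d(E_2',\dots,E_m'))\Big)\lambda(dE_1)$$ (for $m=1$, $C(A,B)=\int\psi(A\cap E_1)\psi(B\cap E_1)\,\lambda(dE_1)$), and let $\xi=\{\xi(B):B\in\mathcal C_0^d\}$ be a centred Gaussian field with covariance function $C$. For $\ell$-dimensional random vectors $X,Y$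 with finite second moments let $d_3(X,Y)=\sup_h|\mathbb Eh(X)-\mathbb Eh(Y)|$, the supremum being over all $h\in C^3(\mathbb R^\ell)$ all of whose second- and third-order partial derivatives are bounded by $1$ in absolute value. Then the integrals defining $\zeta_t(B)$ (almost surely) and $C(A,B)$ exist, $\zeta_t(B)$ is square integrable, and for all $\ell\ge1$ and $B_1,\dots,B_\ell\in\mathcal C_0^d$ there is a constant $c(B_1,\dots,B_\ell)$, not depending on $t$, such that $$d_3\big((\hat\zeta_t(B_1),\dots,\hat\zeta_t(B_\ell)),(\xi(B_1),\dots,\xi(B_\ell))\big)\le c(B_1,\dots,B_\ell)\,t^{-1/2},\qquad t\ge1 .$$ In particular, as $t\to\infty$, $\{\hat\zeta_t(B):B\in\mathcal C_0^d\}$ converges to $\{\xi(B):B\in\mathcal C_0^d\}$ in the sense of convergence in distribution of all finite-dimensional distributions. -/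

import Mathlib

open MeasureTheory ProbabilityTheory Filter Topology TopologicalSpace
open scoped ENNReal NNReal

noncomputable section

namespace PoissonFlats

/-- The Fell topology: the hit-and-miss topology generated by the families of sets missing a given
compact set and the families of sets hitting a given open set. It is used below through the subspace
topologies that it induces on families of closed sets. -/
@[reducible] def fellTopology (X : Type*) [TopologicalSpace X] : TopologicalSpace (Set X) :=
  TopologicalSpace.generateFrom
    ({𝒰 | ∃ K : Set X, IsCompact K ∧ 𝒰 = {F | F ∩ K = ∅}} ∪
      {𝒰 | ∃ G : Set X, IsOpen G ∧ 𝒰 = {F | (F ∩ G).Nonempty}})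

/-- The Borel `σ`-field of the Fell topology on the space of compact subsets of `ℝ^d`. -/
instance instMeasurableSpaceCompacts (d : ℕ) :
    MeasurableSpace (Compacts (EuclideanSpace ℝ (Fin d))) :=
  @borel _ (TopologicalSpace.induced
    (fun C : Compacts (EuclideanSpace ℝ (Fin d)) => (C : Set (EuclideanSpace ℝ (Fin d))))
    (fellTopology (EuclideanSpace ℝ (Fin d))))

/-- `G(d,k)`: the space of `k`-dimensional linear subspaces of `ℝ^d`. -/
def LinearFlat (d k : ℕ) : Type :=
  {L : Submodule ℝ (EuclideanSpace ℝ (Fin d)) // Module.finrank ℝ L = k}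

/-- `A(d,k)`: the space of `k`-flats, i.e. of (non-empty) `k`-dimensional affine subspaces
of `ℝ^d`. -/
def Flat (d k : ℕ) : Type :=
  {E : AffineSubspace ℝ (EuclideanSpace ℝ (Fin d)) //
    (E : Set (EuclideanSpace ℝ (Fin d))).Nonempty ∧ Module.finrank ℝ E.direction = k}

/-- The Borel `σ`-field of the (Fell) topology on `G(d,k)`. -/
instance instMeasurableSpaceLinearFlat (d k : ℕ) : MeasurableSpace (LinearFlat d k) :=
  @borel _ (TopologicalSpace.induced
    (fun L : LinearFlat d k => (L.1 : Set (EuclideanSpace ℝ (Fin d))))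
    (fellTopology (EuclideanSpace ℝ (Fin d))))

/-- The Borel `σ`-field of the (Fell) topology on `A(d,k)`. -/
instance instMeasurableSpaceFlat (d k : ℕ) : MeasurableSpace (Flat d k) :=
  @borel _ (TopologicalSpace.induced
    (fun E : Flat d k => (E.1 : Set (EuclideanSpace ℝ (Fin d))))
    (fellTopology (EuclideanSpace ℝ (Fin d))))

/-- The translate `L + x ∈ A(d,k)` of `L ∈ G(d,k)` by a vector `x`. -/
def LinearFlat.translate {d k : ℕ} (L : LinearFlat d k) (x : EuclideanSpace ℝ (Fin d)) :
    Flat d k :=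
  ⟨AffineSubspace.mk' x L.1, AffineSubspace.mk'_nonempty x L.1, by
    rw [AffineSubspace.direction_mk']; exact L.2⟩

/-- The measure `λ = ∫_{G(d,k)} ∫_{L^⊥} 1{L + x ∈ ·} H^{d-k}(dx) Q(dL)` on `A(d,k)`. Here
`μHE[n]` is the `n`-dimensional Hausdorff measure in its standard normalization (for which it is
Lebesgue measure on `n`-dimensional subspaces). -/
def flatMeasure {d k : ℕ} (Q : Measure (LinearFlat d k)) : Measure (Flat d k) :=
  Q.bind fun L =>
    ((μHE[d - k] : Measure (EuclideanSpace ℝ (Fin d))).restrict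
      ((L.1)ᗮ : Submodule ℝ (EuclideanSpace ℝ (Fin d)))).map L.translate

/-- The Poisson distribution with parameter `a ∈ [0,∞]` on `{0,1,2,…} ∪ {∞}`. -/
def extPoisson (a : ℝ≥0∞) : Measure ℝ≥0∞ :=
  if a = ∞ then Measure.dirac ∞
  else (poissonMeasure a.toNNReal).map (fun n : ℕ => (n : ℝ≥0∞))

/-- `η` is a Poisson process on `X` with intensity measure `μ`: a random element of the space of
`σ`-finite measures with values in `{0,1,2,…} ∪ {∞}`, such that `η(A)` is Poisson distributed with
parameter `μ(A)` and `η(A₁), …, η(Aₙ)` are independent for pairwise disjoint `A₁, …, Aₙ`. -/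
structure IsPoissonProcess {Ω X : Type*} [MeasurableSpace Ω] [MeasurableSpace X]
    (P : Measure Ω) (η : Ω → Measure X) (μ : Measure X) : Prop where
  measurable : Measurable η
  sigmaFinite : ∀ ω, SigmaFinite (η ω)
  integerValued : ∀ ω, ∀ A, MeasurableSet A → ∃ n : ℕ∞, η ω A = (n : ℝ≥0∞)
  law : ∀ A, MeasurableSet A → P.map (fun ω => η ω A) = extPoisson (μ A)
  indep : ∀ (n : ℕ) (A : Fin n → Set X), (∀ i, MeasurableSet (A i)) →
    Pairwise (Function.onFun Disjoint A) → iIndepFun (fun i ω => η ω (A i)) P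

/-- For a simple counting measure `μ` (all atoms have mass one), the `m`-th factorial measure
`μ^{(m)}`: integration with respect to it is summation over all `m`-tuples of pairwise different
points of `μ`. -/
def factorialMeasure {X : Type*} [MeasurableSpace X] (m : ℕ) (μ : Measure X) :
    Measure (Fin m → X) :=
  (Measure.pi fun _ => μ).restrict {x | Function.Injective x}

/-- The compact set `B ∩ E`, for `B` compact and `E` an affine subspace (possibly empty). -/
def interAffine {d : ℕ} (B : Compacts (EuclideanSpace ℝ (Fin d)))
    (E : AffineSubspace ℝ (EuclideanSpace ℝ (Fin d))) : Compacts (EuclideanSpace ℝ (Fin d)) :=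
  ⟨(B : Set (EuclideanSpace ℝ (Fin d))) ∩ E,
    B.isCompact.inter_right (AffineSubspace.closed_of_finiteDimensional E)⟩

/-- The compact set `B ∩ E₁ ∩ ⋯ ∩ Eₘ`. -/
def interFlats {d k m : ℕ} (B : Compacts (EuclideanSpace ℝ (Fin d))) (E : Fin m → Flat d k) :
    Compacts (EuclideanSpace ℝ (Fin d)) :=
  interAffine B (⨅ i, (E i).1)

/-- The assumptions on the family `𝒞₀` of compact sets and on the functional `ψ`. Only the
restriction of `ψ` to `𝒞₀` matters. -/
structure IsGeometricFunctional {d k : ℕ} (Q : Measure (LinearFlat d k)) (m : ℕ)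
    (𝒞₀ : Set (Compacts (EuclideanSpace ℝ (Fin d))))
    (ψ : Compacts (EuclideanSpace ℝ (Fin d)) → ℝ) : Prop where
  measurableSet : MeasurableSet 𝒞₀
  empty_mem : ⊥ ∈ 𝒞₀
  smul_inter_mem : ∀ B ∈ 𝒞₀, ∀ r : ℝ, 0 < r →
    ∀ E : AffineSubspace ℝ (EuclideanSpace ℝ (Fin d)),
    interAffine (B.map (fun x => r • x) (continuous_const_smul r)) E ∈ 𝒞₀
  measurable : Measurable fun B : 𝒞₀ => ψ B
  map_empty : ψ ⊥ = 0
  /-- The third-moment bound. -/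
  thirdMoment : ∀ B ∈ 𝒞₀, ∃ c : ℝ≥0,
    ∫⁻ E : Fin m → Flat d k, ‖ψ (interFlats B E)‖ₑ ^ 3 ∂(Measure.pi fun _ => flatMeasure Q) ≤ c

/-- `ζ(B) = (1/m!) ∫ ψ(B ∩ E₁ ∩ ⋯ ∩ Eₘ) η^{(m)}(d(E₁,…,Eₘ))`. -/
def zeta {Ω : Type*} {d k : ℕ} (m : ℕ) (ψ : Compacts (EuclideanSpace ℝ (Fin d)) → ℝ)
    (η : Ω → Measure (Flat d k)) (B : Compacts (EuclideanSpace ℝ (Fin d))) (ω : Ω) : ℝ :=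
  (1 / (m.factorial : ℝ)) * ∫ E, ψ (interFlats B E) ∂(factorialMeasure m (η ω))

/-- `ζ̂_t(B) = t^{-(m-1/2)} (ζ_t(B) - 𝔼 ζ_t(B))`. -/
def zetaHat {Ω : Type*} [MeasurableSpace Ω] {d k : ℕ} (P : Measure Ω) (m : ℕ)
    (ψ : Compacts (EuclideanSpace ℝ (Fin d)) → ℝ) (η : ℝ → Ω → Measure (Flat d k)) (t : ℝ)
    (B : Compacts (EuclideanSpace ℝ (Fin d))) (ω : Ω) : ℝ :=
  t ^ (-((m : ℝ) - 1 / 2)) * (zeta m ψ (η t) B ω - ∫ ω', zeta m ψ (η t) B ω' ∂P)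

/-- `∫ ψ(B ∩ E₁ ∩ E₂ ∩ ⋯ ∩ Eₘ) λ^{m-1}(d(E₂,…,Eₘ))` as a function of `E₁`, for `m ≥ 1`
(for `m = 1` it is `ψ(B ∩ E₁)`). -/
def innerIntegral {d k : ℕ} (Q : Measure (LinearFlat d k)) (m : ℕ)
    (ψ : Compacts (EuclideanSpace ℝ (Fin d)) → ℝ) (B : Compacts (EuclideanSpace ℝ (Fin d)))
    (E₁ : Flat d k) : ℝ :=
  ∫ E : Fin (m - 1) → Flat d k, ψ (interFlats (interAffine B E₁.1) E)
    ∂(Measure.pi fun _ => flatMeasure Q)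

/-- The asymptotic covariance function `C(A,B)`. -/
def asympCov {d k : ℕ} (Q : Measure (LinearFlat d k)) (m : ℕ)
    (ψ : Compacts (EuclideanSpace ℝ (Fin d)) → ℝ)
    (A B : Compacts (EuclideanSpace ℝ (Fin d))) : ℝ :=
  (1 / ((m - 1).factorial : ℝ) ^ 2) *
    ∫ E₁, innerIntegral Q m ψ A E₁ * innerIntegral Q m ψ B E₁ ∂(flatMeasure Q)

/-- `ξ` is a centred Gaussian field indexed by `𝒞₀` with covariance function `C`. -/
structure IsCenteredGaussianField {Ω T : Type*} [MeasurableSpace Ω] (P : Measure Ω)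
    (ξ : T → Ω → ℝ) (C : T → T → ℝ) : Prop where
  gaussian : IsGaussianProcess ξ P
  centered : ∀ B, ∫ ω, ξ B ω ∂P = 0
  covariance : ∀ A B, covariance (ξ A) (ξ B) P = C A B

/-- The class of test functions: `C³` functions on `ℝ^ℓ` all of whose partial derivatives of
order two and of order three are bounded by one in absolute value (by symmetry of the derivatives it
does not matter whether the indices are taken in increasing order). -/
def testFunctions (ℓ : ℕ) : Set ((Fin ℓ → ℝ) → ℝ) :=
  {h | ContDiff ℝ 3 h ∧
    (∀ i j : Fin ℓ, ∀ x,
      |iteratedFDeriv ℝ 2 h x ![Pi.single i 1, Pi.single j 1]| ≤ 1) ∧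
    (∀ i j l : Fin ℓ, ∀ x,
      |iteratedFDeriv ℝ 3 h x ![Pi.single i 1, Pi.single j 1, Pi.single l 1]| ≤ 1)}

/-- `d₃(X,Y) = sup_h |𝔼 h(X) - 𝔼 h(Y)|`, for random vectors with finite second moments. -/
def d3 {Ω Ω' : Type*} [MeasurableSpace Ω] [MeasurableSpace Ω'] {ℓ : ℕ}
    (P : Measure Ω) (X : Ω → Fin ℓ → ℝ) (P' : Measure Ω') (Y : Ω' → Fin ℓ → ℝ) : ℝ≥0∞ :=
  ⨆ h ∈ testFunctions ℓ, ENNReal.ofReal |∫ ω, h (X ω) ∂P - ∫ ω, h (Y ω) ∂P'|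

end PoissonFlats

end

/-!
The functionals `ζ_t(B)` are `U`-statistics of order `m` of a Poisson process, with the kernel
`(E₁, …, Eₘ) ↦ ψ(B ∩ E₁ ∩ ⋯ ∩ Eₘ)`, and the theorem is a quantitative central limit theorem for
them.

*Reduction to finite intensity.* The sets `B₁, …, B_ℓ` lie in a ball, and as `ψ ∅ = 0` only flats
hitting this ball matter. Their intensity `t λ(·)` is finite (`flatMeasure_hitting_lt_top`) and has
no atoms since `k < d` (`nullSingletonClass_flatMeasure`). The defining properties of a Poisson
process determine the law of its restriction to a set of finite intensity
(`IsPoissonProcess.map_restrict`), so integrals with respect to its factorial measures have the law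
of sums over the tuples of a random finite configuration, whose distribution `poissonConf` is
explicit (`IsPoissonProcess.identDistrib_factorial`).

*Reduction to linear functionals.* Write `f` for the kernel and `proj f` for the integral of `f`
over all arguments but one. The centred `U`-statistic is `m` times the centred sum of `proj f` over
the points, plus a remainder. Mecke's formula bounds the second moment of a compensated sum by the
square norms of its summands and of its difference operator (`sqNorm_le_of_hasDiff`). Peeling off
the arguments of `f` one by one, this shows that the `U`-statistic has variance of order `t^{2m-1}`
(`exists_sqNorm_centU_le`), but the remainder only of order `t^{2m-2}` (`exists_sqNorm_remU_le`).
After normalization the remainder is centred with second moment `O(1/t)`; by Taylor expansion it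
changes the mean of a test function by `O(t^{-1/2})` (`abs_integral_testFunction_add_sub_le`).

*Normal approximation of linear functionals.* By the characteristic functional of the Poisson
process, the laws of the centred sums, as functions of the intensity, form a convolution semigroup,
as do the laws of the scaled Gaussian vector. Both have the same covariances, namely those given by
`C(A, B)`. Splitting the intensity `t` into `⌈t⌉` equal parts and exchanging the summands one by one
(Lindeberg's method, `CubicTaylor.abs_integral_iterate_sub_le`), every exchange costs a third
moment, of order `t^{-3/2}` after normalization, and the total cost is `O(t^{-1/2})`
(`exists_abs_sumVec_sub_le`).

The two reductions and the normal approximation are combined in `exists_abs_uStat_sub_le` and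
`exists_abs_zetaHat_sub_le`. Up to factors, sines and cosines of linear functionals are test
functions, so Lévy's continuity theorem gives the convergence of the finite-dimensional
distributions (`tendstoInDistribution_of_testFunctions`).
-/

noncomputable section

namespace PoissonFlats

/-! ### Finite configurations and the Poisson process on them -/

/-- Finite ordered configurations of points of `X`. -/
abbrev Conf (X : Type*) := Σ n : ℕ, (Fin n → X)

section Measurability

variable {X Z W : Type*} [MeasurableSpace X] [MeasurableSpace Z] [MeasurableSpace W]

lemma measurableSet_conf_iff {s : Set (Conf X)} :
    MeasurableSet s ↔ ∀ n, MeasurableSet (Sigma.mk n ⁻¹' s) := by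
  change MeasurableSet[⨅ a, _] s ↔ _
  rw [MeasurableSpace.measurableSet_iInf]
  rfl

lemma measurable_conf_iff {F : Conf X → W} :
    Measurable F ↔ ∀ n, Measurable fun x : Fin n → X => F ⟨n, x⟩ := by
  refine ⟨fun h n s hs => measurableSet_conf_iff.1 (h hs) n, fun h s hs => ?_⟩
  exact measurableSet_conf_iff.2 fun n => h n hs

lemma measurableEmbedding_confMk (n : ℕ) :
    MeasurableEmbedding (fun x : Fin n → X => (⟨n, x⟩ : Conf X)) := by
  refine ⟨fun _ _ h => sigma_mk_injective h, measurable_conf_iff.1 measurable_id n,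
    fun {s} hs => ?_⟩
  refine measurableSet_conf_iff.2 fun k => ?_
  by_cases hk : n = k
  · subst hk
    have := Set.preimage_image_eq s (sigma_mk_injective (i := n) (β := fun n => Fin n → X))
    exact this.symm ▸ hs
  · convert MeasurableSet.empty
    ext x
    simp only [Set.mem_preimage, Set.mem_image, Sigma.mk.injEq, Set.mem_empty_iff_false,
      iff_false, not_exists, not_and]
    intro y _ h
    exact absurd h hk

lemma measurable_prod_conf {F : Z × Conf X → W}
    (h : ∀ n, Measurable fun p : Z × (Fin n → X) => F (p.1, ⟨n, p.2⟩)) : Measurable F := by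
  intro s hs
  have : F ⁻¹' s = ⋃ n, Prod.map id (fun x : Fin n → X => (⟨n, x⟩ : Conf X)) ''
      ((fun p : Z × (Fin n → X) => F (p.1, ⟨n, p.2⟩)) ⁻¹' s) := by
    ext ⟨z, n, x⟩
    simp only [Set.mem_preimage, Set.mem_iUnion, Set.mem_image, Prod.exists, Prod.map_apply,
      id_eq, Prod.mk.injEq]
    constructor
    · intro hz
      exact ⟨n, z, x, hz, rfl, rfl⟩
    · rintro ⟨k, z', x', hz, rfl, h⟩
      rw [← h]
      exact hz
  rw [this]
  exact MeasurableSet.iUnion fun n =>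
    (MeasurableEmbedding.id.prodMap (measurableEmbedding_confMk n)).measurableSet_image.2 (h n hs)

end Measurability

section Sums

variable {X : Type*}

/-- The sum over all points `y` of a configuration of `Φ y`, evaluated at the configuration with
this point removed. -/
def sumPts {M : Type*} [AddCommMonoid M] (Φ : X → Conf X → M) : Conf X → M
  | ⟨0, _⟩ => 0
  | ⟨n + 1, x⟩ => ∑ i, Φ (x i) ⟨n, i.removeNth x⟩

lemma enorm_sumPts_le (Φ : X → Conf X → ℝ) (c : Conf X) :
    ‖sumPts Φ c‖ₑ ≤ sumPts (fun y c => ‖Φ y c‖ₑ) c := by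
  obtain ⟨n, x⟩ := c
  cases n with
  | zero => simp [sumPts]
  | succ n => exact enorm_sum_le _ _

/-- `D y` is the difference operator of `G`: the change of `G` when the point `y` is added to
a configuration, at any place of the ordering. -/
def HasDiff (G : Conf X → ℝ) (D : X → Conf X → ℝ) : Prop :=
  ∀ (n : ℕ) (i : Fin (n + 1)) (y : X) (x : Fin n → X),
    G ⟨n + 1, i.insertNth (α := fun _ => X) y x⟩ = G ⟨n, x⟩ + D y ⟨n, x⟩

lemma HasDiff.sumPts_mul {G : Conf X → ℝ} {D : X → Conf X → ℝ} (h : HasDiff G D)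
    (Φ : X → Conf X → ℝ) (c : Conf X) :
    sumPts Φ c * G c = sumPts (fun y c => Φ y c * G c + Φ y c * D y c) c := by
  obtain ⟨n, x⟩ := c
  cases n with
  | zero => simp [sumPts]
  | succ n =>
    simp only [sumPts, Finset.sum_mul]
    refine Finset.sum_congr rfl fun i _ => ?_
    have := h n i (x i) (i.removeNth x)
    rw [Fin.insertNth_self_removeNth] at this
    rw [this]
    ring

end Sums

section Poisson

variable {X : Type*} [MeasurableSpace X]

/-- The distribution, on configurations, of a Poisson process with finite intensity measure `μ`:
the restriction of the distribution to configurations of `n` points has density `e^{-μ(X)} / n!`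
with respect to `μ^n`. -/
def poissonConf (μ : Measure X) : Measure (Conf X) :=
  ENNReal.ofReal (Real.exp (-(μ Set.univ).toReal)) •
    Measure.sum fun n : ℕ => ((n.factorial : ℝ≥0∞)⁻¹) •
      (Measure.pi fun _ : Fin n => μ).map (Sigma.mk n)

lemma lintegral_poissonConf (μ : Measure X) (F : Conf X → ℝ≥0∞) :
    ∫⁻ c, F c ∂(poissonConf μ) = ENNReal.ofReal (Real.exp (-(μ Set.univ).toReal)) *
      ∑' n : ℕ, (n.factorial : ℝ≥0∞)⁻¹ * ∫⁻ x, F ⟨n, x⟩ ∂(Measure.pi fun _ : Fin n => μ) := by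
  rw [poissonConf, lintegral_smul_measure, lintegral_sum_measure, smul_eq_mul]
  congr 2
  ext n
  rw [lintegral_smul_measure, smul_eq_mul]
  congr 1
  exact (measurableEmbedding_confMk n).lintegral_map _

instance isProbabilityMeasure_poissonConf (μ : Measure X) [IsFiniteMeasure μ] :
    IsProbabilityMeasure (poissonConf μ) := by
  constructor
  rw [← lintegral_one, lintegral_poissonConf]
  have h : ∀ n : ℕ, (n.factorial : ℝ≥0∞)⁻¹ * ∫⁻ _, 1 ∂(Measure.pi fun _ : Fin n => μ)
      = ENNReal.ofReal ((μ Set.univ).toReal ^ n / n.factorial) := by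
    intro n
    rw [lintegral_one, Measure.pi_univ, Finset.prod_const, Finset.card_univ, Fintype.card_fin,
      ENNReal.ofReal_div_of_pos (by positivity), ENNReal.ofReal_pow (by positivity),
      ENNReal.ofReal_toReal (measure_ne_top _ _), ENNReal.ofReal_natCast, ENNReal.div_eq_inv_mul]
  simp_rw [h]
  have hs := NormedSpace.expSeries_div_hasSum_exp ((μ Set.univ).toReal)
  rw [← ENNReal.ofReal_tsum_of_nonneg (fun n => by positivity) hs.summable, hs.tsum_eq,
    ← Real.exp_eq_exp_ℝ, ← ENNReal.ofReal_mul (by positivity), ← Real.exp_add]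
  simp

lemma measurable_removeNth {n : ℕ} (i : Fin (n + 1)) :
    Measurable fun x : Fin (n + 1) → X => (x i, i.removeNth x) :=
  (MeasurableEquiv.piFinSuccAbove (fun _ => X) i).measurable

lemma measurable_sumPts {M : Type*} [AddCommMonoid M] [MeasurableSpace M] [MeasurableAdd₂ M]
    {Φ : X → Conf X → M} (hΦ : Measurable (Function.uncurry Φ)) : Measurable (sumPts Φ) := by
  refine measurable_conf_iff.2 fun n => ?_
  cases n with
  | zero => exact measurable_const
  | succ n =>
    refine Finset.measurable_sum _ fun i _ => ?_
    exact hΦ.comp (((measurable_pi_apply i)).prodMk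
      ((measurableEmbedding_confMk n).measurable.comp (measurable_removeNth i).snd))

lemma lintegral_pi_removeNth (μ : Measure X) [SigmaFinite μ] {n : ℕ} (i : Fin (n + 1))
    {F : X → (Fin n → X) → ℝ≥0∞} (hF : Measurable (Function.uncurry F)) :
    ∫⁻ x, F (x i) (i.removeNth x) ∂(Measure.pi fun _ : Fin (n + 1) => μ) =
      ∫⁻ x, ∫⁻ y, F y x ∂μ ∂(Measure.pi fun _ : Fin n => μ) := by
  have h := (measurePreserving_piFinSuccAbove (fun _ : Fin (n + 1) => μ) i).lintegral_comp hF
  rw [lintegral_prod_symm' _ hF] at h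
  exact h

/-- **Mecke's formula** for nonnegative functions. -/
lemma lintegral_sumPts (μ : Measure X) [IsFiniteMeasure μ] {Φ : X → Conf X → ℝ≥0∞}
    (hΦ : Measurable (Function.uncurry Φ)) :
    ∫⁻ c, sumPts Φ c ∂(poissonConf μ) = ∫⁻ c, ∫⁻ y, Φ y c ∂μ ∂(poissonConf μ) := by
  rw [lintegral_poissonConf, lintegral_poissonConf]
  congr 1
  rw [tsum_eq_zero_add' ENNReal.summable]
  simp only [sumPts, lintegral_zero, mul_zero, zero_add]
  congr 1
  ext n
  have hm : Measurable (Function.uncurry fun y (x : Fin n → X) => Φ y ⟨n, x⟩) :=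
    hΦ.comp (measurable_fst.prodMk ((measurableEmbedding_confMk n).measurable.comp measurable_snd))
  rw [lintegral_finsetSum]
  · simp_rw [lintegral_pi_removeNth μ _ hm]
    rw [Finset.sum_const, Finset.card_univ, Fintype.card_fin, nsmul_eq_mul, ← mul_assoc,
      Nat.factorial_succ, Nat.cast_mul, ENNReal.mul_inv (by simp) (by simp)]
    congr 1
    rw [mul_right_comm, ENNReal.inv_mul_cancel (by simp) (by simp), one_mul]
  · intro i _
    exact hm.comp (measurable_removeNth i)

lemma lintegral_uncurry_conf (μ : Measure X) [IsFiniteMeasure μ] {Φ : X → Conf X → ℝ≥0∞}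
    (hΦ : Measurable (Function.uncurry Φ)) :
    ∫⁻ p, Φ p.1 p.2 ∂(μ.prod (poissonConf μ)) = ∫⁻ c, ∫⁻ y, Φ y c ∂μ ∂(poissonConf μ) :=
  lintegral_prod_symm' _ hΦ

lemma integrable_sumPts (μ : Measure X) [IsFiniteMeasure μ] {Φ : X → Conf X → ℝ}
    (hΦ : Measurable (Function.uncurry Φ))
    (hi : Integrable (Function.uncurry Φ) (μ.prod (poissonConf μ))) :
    Integrable (sumPts Φ) (poissonConf μ) := by
  refine ⟨(measurable_sumPts hΦ).aestronglyMeasurable, ?_⟩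
  refine lt_of_le_of_lt (lintegral_mono (enorm_sumPts_le Φ)) ?_
  rw [lintegral_sumPts μ (Φ := fun y c => ‖Φ y c‖ₑ) hΦ.enorm,
    ← lintegral_uncurry_conf μ (Φ := fun y c => ‖Φ y c‖ₑ) hΦ.enorm]
  exact hi.2

/-- **Mecke's formula** for integrable functions. -/
lemma integral_sumPts (μ : Measure X) [IsFiniteMeasure μ] {Φ : X → Conf X → ℝ}
    (hΦ : Measurable (Function.uncurry Φ))
    (hi : Integrable (Function.uncurry Φ) (μ.prod (poissonConf μ))) :
    ∫ c, sumPts Φ c ∂(poissonConf μ) = ∫ p, Φ p.1 p.2 ∂(μ.prod (poissonConf μ)) := by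
  have key : ∀ Ψ : X → Conf X → ℝ, Measurable (Function.uncurry Ψ) → (∀ y c, 0 ≤ Ψ y c) →
      Integrable (Function.uncurry Ψ) (μ.prod (poissonConf μ)) →
      ∫ c, sumPts Ψ c ∂(poissonConf μ) = ∫ p, Ψ p.1 p.2 ∂(μ.prod (poissonConf μ)) := by
    intro Ψ hΨ h0 _
    have hnn : ∀ c, 0 ≤ sumPts Ψ c := by
      rintro ⟨n, x⟩
      cases n with
      | zero => exact le_rfl
      | succ n => exact Finset.sum_nonneg fun i _ => h0 _ _
    rw [integral_eq_lintegral_of_nonneg_ae (Eventually.of_forall hnn)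
        (measurable_sumPts hΨ).aestronglyMeasurable,
      integral_eq_lintegral_of_nonneg_ae (Eventually.of_forall fun p => h0 _ _)
        hΨ.aestronglyMeasurable,
      lintegral_uncurry_conf μ (Φ := fun y c => ENNReal.ofReal (Ψ y c)) hΨ.ennreal_ofReal,
      ← lintegral_sumPts μ (Φ := fun y c => ENNReal.ofReal (Ψ y c)) hΨ.ennreal_ofReal]
    congr 1
    refine lintegral_congr ?_
    rintro ⟨n, x⟩
    cases n with
    | zero => simp [sumPts]
    | succ n => exact ENNReal.ofReal_sum_of_nonneg fun i _ => h0 _ _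
  have h1 := key (fun y c => max (Φ y c) 0) (hΦ.max measurable_const) (fun _ _ => le_max_right _ _)
    hi.pos_part
  have h2 := key (fun y c => max (-Φ y c) 0) (hΦ.neg.max measurable_const)
    (fun _ _ => le_max_right _ _) hi.neg_part
  have e : ∀ r : ℝ, r = max r 0 - max (-r) 0 := fun r => by
    rcases le_total r 0 with h | h <;> simp [h]
  have e1 : ∀ c, sumPts Φ c = sumPts (fun y c => max (Φ y c) 0) c
      - sumPts (fun y c => max (-Φ y c) 0) c := by
    rintro ⟨n, x⟩
    cases n with
    | zero => simp [sumPts]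
    | succ n =>
      simp only [sumPts]
      rw [← Finset.sum_sub_distrib]
      exact Finset.sum_congr rfl fun i _ => e _
  simp_rw [e1]
  rw [integral_sub, h1, h2]
  · exact (integral_sub hi.pos_part hi.neg_part).symm.trans
      (integral_congr_ae (Eventually.of_forall fun p => (e _).symm))
  · exact integrable_sumPts μ (hΦ.max measurable_const) hi.pos_part
  · exact integrable_sumPts μ (hΦ.neg.max measurable_const) hi.neg_part

/-- Integration by parts: a compensated sum `W = ∑ Φ − ∫ Φ dμ` pairs with itself as `Φ` pairs with
the difference operator of `W`. -/
lemma integral_sq_eq_of_hasDiff (μ : Measure X) [IsFiniteMeasure μ] {Φ D : X → Conf X → ℝ}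
    {W : Conf X → ℝ} (hΦ : Measurable (Function.uncurry Φ)) (hW : MemLp W 2 (poissonConf μ))
    (hWm : Measurable W) (hDm : Measurable (Function.uncurry D))
    (hΦ2 : MemLp (Function.uncurry Φ) 2 (μ.prod (poissonConf μ)))
    (hD2 : MemLp (Function.uncurry D) 2 (μ.prod (poissonConf μ)))
    (hd : HasDiff W D)
    (hWe : ∀ᵐ c ∂(poissonConf μ), W c = sumPts Φ c - ∫ y, Φ y c ∂μ) :
    ∫ c, W c ^ 2 ∂(poissonConf μ) = ∫ p, Φ p.1 p.2 * D p.1 p.2 ∂(μ.prod (poissonConf μ)) := by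
  have hW2 : MemLp (fun p : X × Conf X => W p.2) 2 (μ.prod (poissonConf μ)) := hW.comp_snd μ
  have i1 : Integrable (fun p : X × Conf X => Φ p.1 p.2 * W p.2) (μ.prod (poissonConf μ)) :=
    hΦ2.integrable_mul hW2
  have i2 : Integrable (fun p : X × Conf X => Φ p.1 p.2 * D p.1 p.2) (μ.prod (poissonConf μ)) :=
    hΦ2.integrable_mul hD2
  have hm : Measurable (Function.uncurry fun y c => Φ y c * W c + Φ y c * D y c) :=
    (hΦ.mul (hWm.comp measurable_snd)).add (hΦ.mul hDm)
  have hs := integral_sumPts μ (Φ := fun y c => Φ y c * W c + Φ y c * D y c) hm (i1.add i2)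
  have hi := integrable_sumPts μ (Φ := fun y c => Φ y c * W c + Φ y c * D y c) hm (i1.add i2)
  have hint : Integrable (fun c => ∫ y, Φ y c * W c ∂μ) (poissonConf μ) :=
    i1.integral_prod_right
  calc ∫ c, W c ^ 2 ∂(poissonConf μ)
      = ∫ c, (sumPts (fun y c => Φ y c * W c + Φ y c * D y c) c - ∫ y, Φ y c * W c ∂μ)
          ∂(poissonConf μ) := by
        refine integral_congr_ae ?_
        filter_upwards [hWe] with c hc
        rw [← hd.sumPts_mul, integral_mul_const, ← sub_mul, ← hc, sq]
    _ = _ := by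
        rw [integral_sub hi hint, hs, integral_add i1 i2, integral_prod_symm _ i1]
        simp

end Poisson

/-! ### Factorial sums over configurations -/

section Combinatorics

variable {X M ι κ : Type*}

/-- The kernel `f` with its first argument frozen at `y`. -/
def slice {m : ℕ} (f : (Fin (m + 1) → X) → M) (y : X) : (Fin m → X) → M :=
  fun z => f (Fin.cons (α := fun _ => X) y z)

/-- The sum of `f (x i₁, …, x iₘ)` over all `m`-tuples of pairwise different indices from `s`. -/
def facSum [AddCommMonoid M] [DecidableEq ι] :
    (m : ℕ) → ((Fin m → X) → M) → (ι → X) → Finset ι → M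
  | 0, f, _, _ => f Fin.elim0
  | m + 1, f, x, s => ∑ i ∈ s, facSum m (slice f (x i)) x (s.erase i)

/-- The `U`-statistic with kernel `f`: the sum of `f` over all `m`-tuples of different points of a
configuration. -/
def uStat [AddCommMonoid M] (m : ℕ) (f : (Fin m → X) → M) (c : Conf X) : M :=
  facSum m f c.2 Finset.univ

/-- Symmetry of a kernel, in the recursive form: the first two arguments may be exchanged, and the
same holds after freezing the first argument. -/
def SymmKernel : {m : ℕ} → ((Fin m → X) → M) → Prop
  | 0, _ => True
  | 1, _ => True
  | _ + 2, f => (∀ x y, slice (slice f x) y = slice (slice f y) x) ∧ ∀ x, SymmKernel (slice f x)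

lemma SymmKernel.slice {m : ℕ} {f : (Fin (m + 1) → X) → M} (h : SymmKernel f) (y : X) :
    SymmKernel (slice f y) := by
  cases m with
  | zero => trivial
  | succ m => exact h.2 y

lemma facSum_map [AddCommMonoid M] [DecidableEq ι] [DecidableEq κ] {m : ℕ} (f : (Fin m → X) → M)
    (x : ι → X) (e : κ ↪ ι) (s : Finset κ) :
    facSum m f x (s.map e) = facSum m f (fun i => x (e i)) s := by
  induction m generalizing s with
  | zero => rfl
  | succ m ih =>
    simp only [facSum, Finset.sum_map]
    refine Finset.sum_congr rfl fun i _ => ?_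
    rw [← Finset.map_erase, ih]

/-- Adding an index `j` to `s` adds the `m`-tuples in which `j` takes one of `m + 1` places; by
symmetry of the kernel each place contributes the same sum. -/
lemma facSum_insert [DecidableEq ι] {m : ℕ} {f : (Fin (m + 1) → X) → ℝ} (hf : SymmKernel f)
    (x : ι → X) {j : ι} {s : Finset ι} (hj : j ∉ s) :
    facSum (m + 1) f x (insert j s) =
      facSum (m + 1) f x s + (m + 1 : ℝ) * facSum m (slice f (x j)) x s := by
  induction m generalizing s with
  | zero =>
    simp only [facSum, Finset.sum_insert hj]
    push_cast
    ring
  | succ m ih =>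
    have h1 : ∀ i ∈ s, facSum (m + 1) (slice f (x i)) x ((insert j s).erase i) =
        facSum (m + 1) (slice f (x i)) x (s.erase i) +
          (m + 1 : ℝ) * facSum m (slice (slice f (x j)) (x i)) x (s.erase i) := by
      intro i hi
      have hij : j ≠ i := fun h => hj (h ▸ hi)
      rw [Finset.erase_insert_of_ne hij, ih (hf.slice _) (fun h => hj (Finset.mem_of_mem_erase h)),
        hf.1]
    rw [facSum, Finset.sum_insert hj, Finset.erase_insert hj, Finset.sum_congr rfl h1,
      Finset.sum_add_distrib, ← Finset.mul_sum]
    have e1 : facSum (m + 1 + 1) f x s = ∑ i ∈ s, facSum (m + 1) (slice f (x i)) x (s.erase i) :=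
      rfl
    have e2 : facSum (m + 1) (slice f (x j)) x s =
        ∑ i ∈ s, facSum m (slice (slice f (x j)) (x i)) x (s.erase i) := rfl
    rw [e1, ← e2]
    push_cast
    ring

lemma uStat_zero [AddCommMonoid M] (f : (Fin 0 → X) → M) (c : Conf X) :
    uStat 0 f c = f Fin.elim0 := rfl

lemma uStat_succ [AddCommMonoid M] {m : ℕ} (f : (Fin (m + 1) → X) → M) :
    uStat (m + 1) f = sumPts fun y => uStat m (slice f y) := by
  funext c
  obtain ⟨n, x⟩ := c
  cases n with
  | zero => simp [uStat, sumPts, facSum]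
  | succ n =>
    change ∑ i : Fin (n + 1), facSum m (slice f (x i)) x (Finset.univ.erase i) =
      ∑ i : Fin (n + 1), facSum m (slice f (x i)) (i.removeNth x) Finset.univ
    refine Finset.sum_congr rfl fun i _ => ?_
    have h : (Finset.univ : Finset (Fin (n + 1))).erase i
        = Finset.univ.map i.succAboveEmb := by
      ext j
      simp [Fin.exists_succAbove_eq_iff]
    rw [h, facSum_map]
    rfl

lemma hasDiff_uStat {m : ℕ} {f : (Fin (m + 1) → X) → ℝ} (hf : SymmKernel f) :
    HasDiff (uStat (m + 1) f) fun y c => (m + 1 : ℝ) * uStat m (slice f y) c := by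
  intro n i y x
  have h : (Finset.univ : Finset (Fin (n + 1)))
      = insert i (Finset.univ.map i.succAboveEmb) := by
    ext j
    simp only [Finset.mem_univ, Finset.mem_insert, Finset.mem_map, true_and, true_iff,
      Fin.coe_succAboveEmb, Fin.exists_succAbove_eq_iff]
    exact em _
  change facSum (m + 1) f _ Finset.univ = facSum (m + 1) f _ Finset.univ
    + _ * facSum m _ _ Finset.univ
  rw [h, facSum_insert hf _ (by simp), facSum_map, facSum_map]
  simp

lemma enorm_pow_sum_le (q : ℕ) (s : Finset ι) (a : ι → ℝ≥0∞) :
    (∑ i ∈ s, a i) ^ (q + 1) ≤ (s.card : ℝ≥0∞) ^ q * ∑ i ∈ s, a i ^ (q + 1) := by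
  have h := ENNReal.rpow_sum_le_const_mul_sum_rpow s a (p := (q + 1 : ℕ)) (by simp)
  simp only [Nat.cast_add, Nat.cast_one, add_sub_cancel_right] at h
  exact_mod_cast h

/-- One power mean inequality per order of the kernel, each of which costs a factor `card s ^ q`. -/
lemma enorm_facSum_pow_le [DecidableEq ι] {m : ℕ} (q : ℕ) (f : (Fin m → X) → ℝ) (x : ι → X)
    (s : Finset ι) :
    ‖facSum m f x s‖ₑ ^ (q + 1) ≤
      (s.card : ℝ≥0∞) ^ (m * q) * facSum m (fun z => ‖f z‖ₑ ^ (q + 1)) x s := by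
  induction m generalizing s with
  | zero => simp [facSum]
  | succ m ih =>
    calc ‖facSum (m + 1) f x s‖ₑ ^ (q + 1)
        ≤ (∑ i ∈ s, ‖facSum m (slice f (x i)) x (s.erase i)‖ₑ) ^ (q + 1) := by
          gcongr
          exact enorm_sum_le _ _
      _ ≤ (s.card : ℝ≥0∞) ^ q * ∑ i ∈ s, ‖facSum m (slice f (x i)) x (s.erase i)‖ₑ ^ (q + 1) :=
          enorm_pow_sum_le _ _ _
      _ ≤ (s.card : ℝ≥0∞) ^ q * ∑ i ∈ s, (s.card : ℝ≥0∞) ^ (m * q) *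
            facSum m (slice (fun z => ‖f z‖ₑ ^ (q + 1)) (x i)) x (s.erase i) := by
          gcongr with i hi
          refine (ih _ _).trans ?_
          gcongr
          · exact Finset.erase_subset _ _
          · exact le_rfl
      _ = _ := by
          rw [← Finset.mul_sum, ← mul_assoc, ← pow_add, facSum]
          congr 2
          ring

lemma sumPts_card_mul (φ : ℕ → ℝ≥0∞) (Φ : X → Conf X → ℝ≥0∞) (c : Conf X) :
    φ c.1 * sumPts Φ c = sumPts (fun y c => φ (c.1 + 1) * Φ y c) c := by
  obtain ⟨n, x⟩ := c
  cases n with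
  | zero => simp [sumPts]
  | succ n => simp only [sumPts, Finset.mul_sum]

end Combinatorics

section Measure

variable {X Z M : Type*} [MeasurableSpace X] [MeasurableSpace Z]

lemma measurable_fin_cons {m : ℕ} :
    Measurable fun p : X × (Fin m → X) =>
      (Fin.cons (α := fun _ => X) p.1 p.2 : Fin (m + 1) → X) := by
  refine measurable_pi_lambda _ fun i => ?_
  refine Fin.cases ?_ (fun j => ?_) i
  · exact measurable_fst
  · simp only [Fin.cons_succ]
    exact (measurable_pi_apply j).comp measurable_snd

lemma measurable_slice' [MeasurableSpace M] {m : ℕ} {f : (Fin (m + 1) → X) → M}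
    (hf : Measurable f) : Measurable (Function.uncurry (slice f)) :=
  hf.comp measurable_fin_cons

lemma measurable_facSum [MeasurableSpace M] [AddCommMonoid M] [MeasurableAdd₂ M] {n m : ℕ}
    {f : Z → (Fin m → X) → M} (hf : Measurable (Function.uncurry f)) {x : Z → Fin n → X}
    (hx : Measurable x) (s : Finset (Fin n)) :
    Measurable fun z => facSum m (f z) (x z) s := by
  induction m generalizing s with
  | zero => exact hf.comp (measurable_id.prodMk measurable_const)
  | succ m ih =>
    refine Finset.measurable_sum _ fun i _ => ih ?_ _
    exact hf.comp (measurable_fst.prodMk (measurable_fin_cons.comp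
      (((measurable_pi_apply i).comp (hx.comp measurable_fst)).prodMk measurable_snd)))

lemma measurable_uStat [MeasurableSpace M] [AddCommMonoid M] [MeasurableAdd₂ M] {m : ℕ}
    {f : Z → (Fin m → X) → M} (hf : Measurable (Function.uncurry f)) :
    Measurable (Function.uncurry fun z => uStat m (f z)) := by
  refine measurable_prod_conf fun n => ?_
  exact measurable_facSum (f := fun p : Z × (Fin n → X) => f p.1)
    (hf.comp (measurable_fst.fst.prodMk measurable_snd)) measurable_snd Finset.univ

lemma measurable_uStat' [MeasurableSpace M] [AddCommMonoid M] [MeasurableAdd₂ M] {m : ℕ}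
    {f : (Fin m → X) → M} (hf : Measurable f) : Measurable (uStat m f) :=
  (measurable_uStat (Z := Unit) (f := fun _ => f) (hf.comp measurable_snd)).comp
    (measurable_const (a := ()).prodMk measurable_id)

lemma measurable_conf_card : Measurable fun c : Conf X => c.1 :=
  measurable_conf_iff.2 fun _ => measurable_const

lemma lintegral_pi_zero (μ : Measure X) [SigmaFinite μ] (f : (Fin 0 → X) → ℝ≥0∞) :
    ∫⁻ z, f z ∂(Measure.pi fun _ : Fin 0 => μ) = f Fin.elim0 := by
  rw [lintegral_unique, Measure.pi_univ, Finset.univ_eq_empty, Finset.prod_empty, mul_one]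
  congr 1

lemma lintegral_slice (μ : Measure X) [SigmaFinite μ] {m : ℕ} {f : (Fin (m + 1) → X) → ℝ≥0∞}
    (hf : Measurable f) :
    ∫⁻ y, ∫⁻ z, slice f y z ∂(Measure.pi fun _ : Fin m => μ) ∂μ =
      ∫⁻ z, f z ∂(Measure.pi fun _ : Fin (m + 1) => μ) := by
  rw [lintegral_lintegral_swap (measurable_slice' hf).aemeasurable,
    ← lintegral_pi_removeNth μ 0 (measurable_slice' hf)]
  refine lintegral_congr fun x => ?_
  rw [slice]
  congr 1
  exact Fin.cons_self_tail x

/-- The mean of a `U`-statistic, weighted by a function of the number of points. -/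
lemma lintegral_card_mul_uStat (μ : Measure X) [IsFiniteMeasure μ] {m : ℕ}
    {f : (Fin m → X) → ℝ≥0∞} (hf : Measurable f) (φ : ℕ → ℝ≥0∞) :
    ∫⁻ c, φ c.1 * uStat m f c ∂(poissonConf μ) =
      (∫⁻ z, f z ∂(Measure.pi fun _ : Fin m => μ)) * ∫⁻ c, φ (c.1 + m) ∂(poissonConf μ) := by
  have hφ : ∀ ψ : ℕ → ℝ≥0∞, Measurable fun c : Conf X => ψ c.1 := fun ψ =>
    (measurable_of_countable ψ).comp measurable_conf_card
  induction m generalizing φ with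
  | zero =>
    simp only [uStat_zero, lintegral_pi_zero, add_zero]
    rw [lintegral_mul_const _ (hφ φ), mul_comm]
  | succ m ih =>
    have hsl := measurable_slice' hf
    have hu : Measurable (Function.uncurry fun y => uStat m (slice f y)) := measurable_uStat hsl
    have hm : Measurable (Function.uncurry fun (y : X) (c : Conf X) =>
        φ (c.1 + 1) * uStat m (slice f y) c) :=
      ((hφ fun n => φ (n + 1)).comp measurable_snd).mul hu
    simp_rw [uStat_succ, sumPts_card_mul]
    rw [lintegral_sumPts μ hm, ← lintegral_lintegral_swap hm.aemeasurable]
    have h : ∀ y, ∫⁻ c, φ (c.1 + 1) * uStat m (slice f y) c ∂(poissonConf μ) =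
        (∫⁻ z, slice f y z ∂(Measure.pi fun _ : Fin m => μ)) *
          ∫⁻ c, φ (c.1 + (m + 1)) ∂(poissonConf μ) := by
      intro y
      rw [ih (f := slice f y) (hsl.comp measurable_prodMk_left) (fun n => φ (n + 1))]
      simp only [add_assoc, add_comm m 1]
    simp_rw [h]
    rw [lintegral_mul_const, lintegral_slice μ hf]
    exact hsl.lintegral_prod_right'

lemma lintegral_card_mul (μ : Measure X) [IsFiniteMeasure μ] (φ : ℕ → ℝ≥0∞) :
    ∫⁻ c, φ c.1 * (c.1 : ℝ≥0∞) ∂(poissonConf μ) =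
      μ Set.univ * ∫⁻ c, φ (c.1 + 1) ∂(poissonConf μ) := by
  have h := lintegral_card_mul_uStat μ (m := 1) (f := fun _ => 1) measurable_const φ
  have e : ∀ c : Conf X, uStat 1 (fun _ => (1 : ℝ≥0∞)) c = c.1 := fun c => by
    simp [uStat, facSum, slice]
  simp_rw [e] at h
  rw [h, lintegral_one, Measure.pi_univ]
  simp

/-- Moments of the number of points. -/
lemma lintegral_card_pow_le (μ : Measure X) [IsFiniteMeasure μ] (j q : ℕ) :
    ∫⁻ c, ((c.1 + j : ℕ) : ℝ≥0∞) ^ q ∂(poissonConf μ) ≤ (μ Set.univ + j + q) ^ q := by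
  induction q generalizing j with
  | zero => simp
  | succ q ih =>
    have hφ : ∀ ψ : ℕ → ℝ≥0∞, Measurable fun c : Conf X => ψ c.1 := fun ψ =>
      (measurable_of_countable ψ).comp measurable_conf_card
    have e : ∀ c : Conf X, ((c.1 + j : ℕ) : ℝ≥0∞) ^ (q + 1) =
        ((c.1 + j : ℕ) : ℝ≥0∞) ^ q * (c.1 : ℝ≥0∞) + j * ((c.1 + j : ℕ) : ℝ≥0∞) ^ q := fun c => by
      rw [pow_succ]
      push_cast
      ring
    simp_rw [e]
    rw [lintegral_add_left (hφ fun n => ((n + j : ℕ) : ℝ≥0∞) ^ q * (n : ℝ≥0∞)),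
      lintegral_card_mul μ (fun n => ((n + j : ℕ) : ℝ≥0∞) ^ q),
      lintegral_const_mul _ (hφ fun n => ((n + j : ℕ) : ℝ≥0∞) ^ q)]
    calc _ ≤ μ Set.univ * (μ Set.univ + j + (q + 1 : ℕ)) ^ q
          + j * (μ Set.univ + j + (q + 1 : ℕ)) ^ q := by
          gcongr
          · have h := ih (j + 1)
            simp only [← add_assoc, add_right_comm _ j 1] at h ⊢
            refine h.trans (le_of_eq ?_)
            push_cast
            ring
          · refine (ih j).trans ?_
            gcongr
            omega
      _ ≤ _ := by
          rw [← add_mul, pow_succ']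
          exact mul_le_mul_left le_self_add _

/-- A bound for the moments of a `U`-statistic by those of its kernel. -/
lemma lintegral_uStat_pow_le (μ : Measure X) [IsFiniteMeasure μ] {m : ℕ}
    {f : (Fin m → X) → ℝ} (hf : Measurable f) (q : ℕ) :
    ∫⁻ c, ‖uStat m f c‖ₑ ^ (q + 1) ∂(poissonConf μ) ≤
      (μ Set.univ + m + (m * q : ℕ)) ^ (m * q) *
        ∫⁻ z, ‖f z‖ₑ ^ (q + 1) ∂(Measure.pi fun _ : Fin m => μ) := by
  calc _ ≤ ∫⁻ c, (c.1 : ℝ≥0∞) ^ (m * q) * uStat m (fun z => ‖f z‖ₑ ^ (q + 1)) c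
        ∂(poissonConf μ) := by
        refine lintegral_mono fun c => ?_
        have := enorm_facSum_pow_le q f c.2 Finset.univ
        rwa [Finset.card_univ, Fintype.card_fin] at this
    _ = (∫⁻ z, ‖f z‖ₑ ^ (q + 1) ∂(Measure.pi fun _ : Fin m => μ)) *
          ∫⁻ c, ((c.1 + m : ℕ) : ℝ≥0∞) ^ (m * q) ∂(poissonConf μ) :=
        lintegral_card_mul_uStat μ (hf.enorm.pow_const _) fun n => (n : ℝ≥0∞) ^ (m * q)
    _ ≤ _ := by
        rw [mul_comm]
        gcongr
        exact lintegral_card_pow_le μ m (m * q)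

end Measure

/-! ### Square norms -/

section SqNorm

variable {α : Type*} [MeasurableSpace α]

/-- The squared `L²`-norm. -/
def sqNorm (F : α → ℝ) (ρ : Measure α) : ℝ≥0∞ := ∫⁻ x, ‖F x‖ₑ ^ 2 ∂ρ

lemma memLp_two_of_sqNorm {F : α → ℝ} {ρ : Measure α} (hF : AEStronglyMeasurable F ρ)
    (h : sqNorm F ρ ≠ ∞) : MemLp F 2 ρ := by
  refine ⟨hF, ?_⟩
  rw [eLpNorm_lt_top_iff_lintegral_rpow_enorm_lt_top (by simp) (by simp)]
  simpa [sqNorm] using h.lt_top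

lemma sqNorm_eq_ofReal {F : α → ℝ} {ρ : Measure α} (hF : MemLp F 2 ρ) :
    sqNorm F ρ = ENNReal.ofReal (∫ x, F x ^ 2 ∂ρ) := by
  rw [ofReal_integral_eq_lintegral_ofReal hF.integrable_sq
    (Eventually.of_forall fun x => sq_nonneg _)]
  refine lintegral_congr fun x => ?_
  rw [← ofReal_norm, ← ENNReal.ofReal_pow (norm_nonneg _), Real.norm_eq_abs, sq_abs]

lemma sqNorm_ne_top {F : α → ℝ} {ρ : Measure α} (hF : MemLp F 2 ρ) : sqNorm F ρ ≠ ∞ := by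
  rw [sqNorm_eq_ofReal hF]
  exact ENNReal.ofReal_ne_top

lemma enorm_add_sq_le (a b : ℝ) : ‖a + b‖ₑ ^ 2 ≤ 2 * (‖a‖ₑ ^ 2 + ‖b‖ₑ ^ 2) := by
  calc ‖a + b‖ₑ ^ 2 ≤ (‖a‖ₑ + ‖b‖ₑ) ^ 2 := by gcongr; exact enorm_add_le _ _
    _ ≤ _ := by
      have := enorm_pow_sum_le 1 Finset.univ ![‖a‖ₑ, ‖b‖ₑ]
      simpa using this

lemma sqNorm_add_le {F G : α → ℝ} {ρ : Measure α} (hF : Measurable F) :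
    sqNorm (fun x => F x + G x) ρ ≤ 2 * (sqNorm F ρ + sqNorm G ρ) := by
  unfold sqNorm
  rw [← lintegral_add_left (hF.enorm.pow_const _), ← lintegral_const_mul' _ _ (by simp)]
  exact lintegral_mono fun x => enorm_add_sq_le _ _

lemma sqNorm_const_mul (r : ℝ) (F : α → ℝ) (ρ : Measure α) :
    sqNorm (fun x => r * F x) ρ = ‖r‖ₑ ^ 2 * sqNorm F ρ := by
  unfold sqNorm
  rw [← lintegral_const_mul' _ _ (by simp)]
  simp_rw [enorm_mul, mul_pow]

/-- Jensen's inequality for powers, on a finite measure space. -/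
lemma lintegral_pow_le (q : ℕ) {F : α → ℝ≥0∞} {ρ : Measure α} (hF : AEMeasurable F ρ) :
    (∫⁻ x, F x ∂ρ) ^ (q + 1) ≤ ρ Set.univ ^ q * ∫⁻ x, F x ^ (q + 1) ∂ρ := by
  rcases Nat.eq_zero_or_pos q with rfl | hq
  · simp
  have hq' : (0 : ℝ) < q := by exact_mod_cast hq
  have hpq : (q + 1 : ℝ).HolderConjugate ((q + 1 : ℝ) / q) := by
    rw [Real.holderConjugate_iff]
    refine ⟨by linarith, ?_⟩
    field_simp
    ring
  have h := ENNReal.lintegral_mul_le_Lp_mul_Lq ρ hpq hF (aemeasurable_const (b := (1 : ℝ≥0∞)))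
  simp only [Pi.mul_apply, mul_one, ENNReal.one_rpow, lintegral_one] at h
  calc (∫⁻ x, F x ∂ρ) ^ (q + 1)
      ≤ ((∫⁻ x, F x ^ (q + 1 : ℝ) ∂ρ) ^ (1 / (q + 1 : ℝ)) *
          ρ Set.univ ^ (1 / ((q + 1 : ℝ) / q))) ^ (q + 1) := by gcongr
    _ = _ := by
      rw [mul_pow, ← ENNReal.rpow_natCast, ← ENNReal.rpow_natCast, ← ENNReal.rpow_mul,
        ← ENNReal.rpow_mul, mul_comm]
      congr 1
      · rw [← ENNReal.rpow_natCast]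
        congr 1
        push_cast
        field_simp
      · push_cast
        rw [one_div_mul_cancel (by positivity), ENNReal.rpow_one]
        refine lintegral_congr fun x => ?_
        exact_mod_cast ENNReal.rpow_natCast (F x) (q + 1)

lemma enorm_integral_pow_le (q : ℕ) {F : α → ℝ} {ρ : Measure α} (hF : AEStronglyMeasurable F ρ) :
    ‖∫ x, F x ∂ρ‖ₑ ^ (q + 1) ≤ ρ Set.univ ^ q * ∫⁻ x, ‖F x‖ₑ ^ (q + 1) ∂ρ := by
  refine le_trans ?_ (lintegral_pow_le q hF.enorm)
  gcongr
  exact enorm_integral_le_lintegral_enorm _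

end SqNorm

section Compensated

variable {X : Type*} [MeasurableSpace X]

/-- The `L²`-bound for compensated sums `W = ∑ Φ − ∫ Φ dμ`. -/
lemma sqNorm_le_of_hasDiff (μ : Measure X) [IsFiniteMeasure μ] {Φ D : X → Conf X → ℝ}
    {W : Conf X → ℝ} (hΦ : Measurable (Function.uncurry Φ)) (hW : MemLp W 2 (poissonConf μ))
    (hWm : Measurable W) (hDm : Measurable (Function.uncurry D)) (hd : HasDiff W D)
    (hWe : ∀ᵐ c ∂(poissonConf μ), W c = sumPts Φ c - ∫ y, Φ y c ∂μ) :
    sqNorm W (poissonConf μ) ≤ sqNorm (Function.uncurry Φ) (μ.prod (poissonConf μ)) +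
      sqNorm (Function.uncurry D) (μ.prod (poissonConf μ)) := by
  by_cases h1 : sqNorm (Function.uncurry Φ) (μ.prod (poissonConf μ)) = ∞
  · simp [h1]
  by_cases h2 : sqNorm (Function.uncurry D) (μ.prod (poissonConf μ)) = ∞
  · simp [h2]
  have m1 := memLp_two_of_sqNorm hΦ.aestronglyMeasurable h1
  have m2 := memLp_two_of_sqNorm hDm.aestronglyMeasurable h2
  rw [sqNorm_eq_ofReal hW, integral_sq_eq_of_hasDiff μ hΦ hW hWm hDm m1 m2 hd hWe,
    sqNorm_eq_ofReal m1, sqNorm_eq_ofReal m2,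
    ← ENNReal.ofReal_add (integral_nonneg fun _ => sq_nonneg _)
      (integral_nonneg fun _ => sq_nonneg _),
    ← integral_add m1.integrable_sq m2.integrable_sq]
  refine ENNReal.ofReal_le_ofReal (integral_mono (m1.integrable_mul m2)
    (m1.integrable_sq.add m2.integrable_sq) fun p => ?_)
  simp only [Function.uncurry]
  nlinarith [sq_nonneg (Φ p.1 p.2 - D p.1 p.2), sq_nonneg (Φ p.1 p.2 + D p.1 p.2)]

end Compensated

/-! ### Margins and means of kernels -/

/-- If the sum of the weights `p` over the tuples vanishes, then all tuples are zeros of `p`, where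
`y ↦ f y z` is integrable, so that integration commutes with the sum. -/
lemma integral_facSum {X ι Y : Type*} [DecidableEq ι] [MeasurableSpace Y] {μ : Measure Y}
    {m : ℕ} {f : Y → (Fin m → X) → ℝ} {p : (Fin m → X) → ℝ≥0∞}
    (hp : ∀ z, p z = 0 → Integrable (fun y => f y z) μ) {x : ι → X} {s : Finset ι}
    (h : facSum m p x s = 0) :
    Integrable (fun y => facSum m (f y) x s) μ ∧
      ∫ y, facSum m (f y) x s ∂μ = facSum m (fun z => ∫ y, f y z ∂μ) x s := by
  induction m generalizing s with
  | zero => exact ⟨hp _ h, rfl⟩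
  | succ m ih =>
    have h' : ∀ i ∈ s, facSum m (slice p (x i)) x (s.erase i) = 0 := Finset.sum_eq_zero_iff.1 h
    have key := fun i hi => ih (f := fun y => slice (f y) (x i)) (fun z hz => hp _ hz) (h' i hi)
    refine ⟨integrable_finsetSum _ fun i hi => (key i hi).1, ?_⟩
    simp only [facSum]
    rw [integral_finsetSum _ fun i hi => (key i hi).1]
    exact Finset.sum_congr rfl fun i hi => (key i hi).2

section Margin

variable {X Z : Type*} [MeasurableSpace X] [MeasurableSpace Z]

/-- The kernel `f` with its first argument integrated out. -/
def margin (μ : Measure X) {m : ℕ} (f : (Fin (m + 1) → X) → ℝ) : (Fin m → X) → ℝ :=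
  fun z => ∫ y, slice f y z ∂μ

/-- The iterated integral of the kernel `f` over all its arguments. -/
def iterMean (μ : Measure X) : (m : ℕ) → ((Fin m → X) → ℝ) → ℝ
  | 0, f => f Fin.elim0
  | m + 1, f => iterMean μ m (margin μ f)

/-- The iterated integral of the kernel `f` over all its arguments but the first. -/
def proj (μ : Measure X) {m : ℕ} (f : (Fin (m + 1) → X) → ℝ) (y : X) : ℝ :=
  iterMean μ m (slice f y)

lemma slice_margin (μ : Measure X) {m : ℕ} {f : (Fin (m + 2) → X) → ℝ} (hf : SymmKernel f)
    (x : X) : slice (margin μ f) x = margin μ (slice f x) := by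
  funext z
  refine integral_congr_ae (Eventually.of_forall fun y => ?_)
  exact congrFun (hf.1 y x) z

lemma SymmKernel.margin (μ : Measure X) {m : ℕ} {f : (Fin (m + 1) → X) → ℝ} (hf : SymmKernel f) :
    SymmKernel (margin μ f) := by
  induction m with
  | zero => trivial
  | succ m ih =>
    cases m with
    | zero => trivial
    | succ m =>
      refine ⟨fun x y => ?_, fun x => ?_⟩
      · rw [slice_margin μ hf, slice_margin μ hf, slice_margin μ (hf.slice x),
          slice_margin μ (hf.slice y), hf.1]
      · rw [slice_margin μ hf]
        exact ih (hf.slice x)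

lemma measurable_margin (μ : Measure X) [SFinite μ] {m : ℕ} {f : Z → (Fin (m + 1) → X) → ℝ}
    (hf : Measurable (Function.uncurry f)) :
    Measurable (Function.uncurry fun z => margin μ (f z)) := by
  have h : Measurable (Function.uncurry fun (p : Z × (Fin m → X)) (y : X) =>
      f p.1 (Fin.cons (α := fun _ => X) y p.2)) :=
    hf.comp (measurable_fst.fst.prodMk
      (measurable_fin_cons.comp (measurable_snd.prodMk measurable_fst.snd)))
  exact h.stronglyMeasurable.integral_prod_right.measurable

lemma measurable_margin' (μ : Measure X) [SFinite μ] {m : ℕ} {f : (Fin (m + 1) → X) → ℝ}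
    (hf : Measurable f) : Measurable (margin μ f) :=
  (measurable_margin μ (Z := Unit) (f := fun _ => f) (hf.comp measurable_snd)).comp
    (measurable_const (a := ()).prodMk measurable_id)

lemma measurable_iterMean (μ : Measure X) [SFinite μ] {m : ℕ} {f : Z → (Fin m → X) → ℝ}
    (hf : Measurable (Function.uncurry f)) : Measurable fun z => iterMean μ m (f z) := by
  induction m with
  | zero => exact hf.comp (measurable_id.prodMk measurable_const)
  | succ m ih => exact ih (measurable_margin μ hf)

lemma measurable_proj (μ : Measure X) [SFinite μ] {m : ℕ} {f : (Fin (m + 1) → X) → ℝ}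
    (hf : Measurable f) : Measurable (proj μ f) :=
  measurable_iterMean μ (measurable_slice' hf)

lemma proj_margin (μ : Measure X) {m : ℕ} {f : (Fin (m + 2) → X) → ℝ} (hf : SymmKernel f) :
    proj μ (margin μ f) = proj μ f := by
  funext x
  rw [proj, slice_margin μ hf]
  rfl

lemma measurePreserving_fin_cons (μ : Measure X) [SigmaFinite μ] (m : ℕ) :
    MeasurePreserving (fun p : X × (Fin m → X) => (Fin.cons (α := fun _ => X) p.1 p.2))
      (μ.prod (Measure.pi fun _ : Fin m => μ)) (Measure.pi fun _ : Fin (m + 1) => μ) := by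
  have h := (measurePreserving_piFinSuccAbove (fun _ : Fin (m + 1) => μ) 0).symm
  convert h using 1
  funext p
  exact (Fin.insertNth_zero' (β := X) p.1 p.2).symm

lemma integrable_slice (μ : Measure X) [SigmaFinite μ] {m : ℕ} {f : (Fin (m + 1) → X) → ℝ}
    (hf : Integrable f (Measure.pi fun _ : Fin (m + 1) => μ)) :
    Integrable (Function.uncurry (slice f)) (μ.prod (Measure.pi fun _ : Fin m => μ)) :=
  (measurePreserving_fin_cons μ m).integrable_comp_of_integrable hf

lemma integral_slice (μ : Measure X) [SigmaFinite μ] {m : ℕ} {f : (Fin (m + 1) → X) → ℝ}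
    (hf : Integrable f (Measure.pi fun _ : Fin (m + 1) => μ)) :
    ∫ p, slice f p.1 p.2 ∂(μ.prod (Measure.pi fun _ : Fin m => μ)) =
      ∫ z, f z ∂(Measure.pi fun _ : Fin (m + 1) => μ) := by
  have h := measurePreserving_fin_cons μ m
  rw [← h.map_eq, integral_map h.measurable.aemeasurable]
  · rfl
  · rw [h.map_eq]
    exact hf.1

lemma iterMean_eq_integral (μ : Measure X) [SigmaFinite μ] {m : ℕ} {f : (Fin m → X) → ℝ}
    (hf : Integrable f (Measure.pi fun _ : Fin m => μ)) :
    iterMean μ m f = ∫ z, f z ∂(Measure.pi fun _ : Fin m => μ) := by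
  induction m with
  | zero =>
    rw [integral_unique, measureReal_def, Measure.pi_univ]
    simp only [iterMean, Finset.univ_eq_empty, Finset.prod_empty, ENNReal.toReal_one, one_smul]
    congr 1
  | succ m ih =>
    have h := integrable_slice μ hf
    rw [iterMean, ih (f := margin μ f) h.integral_prod_right, ← integral_slice μ hf]
    exact (integral_prod_symm _ h).symm

lemma ae_proj_eq_integral (μ : Measure X) [SigmaFinite μ] {m : ℕ} {f : (Fin (m + 1) → X) → ℝ}
    (hf : Integrable f (Measure.pi fun _ : Fin (m + 1) => μ)) :
    ∀ᵐ y ∂μ, proj μ f y = ∫ z, slice f y z ∂(Measure.pi fun _ : Fin m => μ) := by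
  filter_upwards [(integrable_slice μ hf).prod_right_ae] with y hy
  exact iterMean_eq_integral μ hy

lemma integral_proj (μ : Measure X) [SigmaFinite μ] {m : ℕ} {f : (Fin (m + 1) → X) → ℝ}
    (hf : Integrable f (Measure.pi fun _ : Fin (m + 1) => μ)) :
    ∫ y, proj μ f y ∂μ = iterMean μ (m + 1) f := by
  rw [integral_congr_ae (ae_proj_eq_integral μ hf), iterMean_eq_integral μ hf,
    ← integral_slice μ hf]
  exact (integral_prod _ (integrable_slice μ hf)).symm

lemma lintegral_sqNorm_slice (μ : Measure X) [SigmaFinite μ] {m : ℕ} {f : (Fin (m + 1) → X) → ℝ}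
    (hf : Measurable f) :
    ∫⁻ y, sqNorm (slice f y) (Measure.pi fun _ : Fin m => μ) ∂μ =
      sqNorm f (Measure.pi fun _ : Fin (m + 1) => μ) :=
  lintegral_slice μ (f := fun z => ‖f z‖ₑ ^ 2) (hf.enorm.pow_const _)

lemma sqNorm_margin_le (μ : Measure X) [SigmaFinite μ] {m : ℕ} {f : (Fin (m + 1) → X) → ℝ}
    (hf : Measurable f) :
    sqNorm (margin μ f) (Measure.pi fun _ : Fin m => μ) ≤
      μ Set.univ * sqNorm f (Measure.pi fun _ : Fin (m + 1) => μ) := by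
  have h2 : Measurable (Function.uncurry fun (y : X) (z : Fin m → X) => ‖slice f y z‖ₑ ^ 2) :=
    (measurable_slice' hf).enorm.pow_const _
  rw [← lintegral_sqNorm_slice μ hf]
  unfold sqNorm
  rw [lintegral_lintegral_swap h2.aemeasurable,
    ← lintegral_const_mul (μ Set.univ) (f := fun z => ∫⁻ y, ‖slice f y z‖ₑ ^ 2 ∂μ)
      h2.lintegral_prod_left']
  refine lintegral_mono fun z => ?_
  have h := enorm_integral_pow_le 1 (F := fun y => slice f y z) (ρ := μ)
    ((measurable_slice' hf).comp measurable_prodMk_right).aestronglyMeasurable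
  rw [pow_one] at h
  exact h

lemma enorm_iterMean_sq_le (μ : Measure X) [SigmaFinite μ] {m : ℕ} {f : (Fin m → X) → ℝ}
    (hf : Measurable f) :
    ‖iterMean μ m f‖ₑ ^ 2 ≤ μ Set.univ ^ m * sqNorm f (Measure.pi fun _ : Fin m => μ) := by
  induction m with
  | zero => simp [iterMean, sqNorm, lintegral_pi_zero]
  | succ m ih =>
    refine (ih (measurable_margin' μ hf)).trans ?_
    rw [pow_succ, mul_assoc]
    gcongr
    exact sqNorm_margin_le μ hf

lemma sqNorm_proj_le (μ : Measure X) [SigmaFinite μ] {m : ℕ} {f : (Fin (m + 1) → X) → ℝ}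
    (hf : Measurable f) :
    sqNorm (proj μ f) μ ≤ μ Set.univ ^ m * sqNorm f (Measure.pi fun _ : Fin (m + 1) => μ) := by
  have h2 : Measurable (Function.uncurry fun (y : X) (z : Fin m → X) => ‖slice f y z‖ₑ ^ 2) :=
    (measurable_slice' hf).enorm.pow_const _
  rw [← lintegral_sqNorm_slice μ hf]
  unfold sqNorm
  rw [← lintegral_const_mul (μ Set.univ ^ m)
    (f := fun y => ∫⁻ z, ‖slice f y z‖ₑ ^ 2 ∂(Measure.pi fun _ : Fin m => μ))
    h2.lintegral_prod_right']
  exact lintegral_mono fun y =>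
    enorm_iterMean_sq_le μ ((measurable_slice' hf).comp measurable_prodMk_left)

/-- Integration of a frozen argument commutes with forming the `U`-statistic. -/
lemma ae_integral_uStat_slice (μ : Measure X) [IsFiniteMeasure μ] {m : ℕ}
    {f : (Fin (m + 1) → X) → ℝ} (hf : Integrable f (Measure.pi fun _ : Fin (m + 1) => μ)) :
    ∀ᵐ c ∂(poissonConf μ), Integrable (fun y => uStat m (slice f y) c) μ ∧
      ∫ y, uStat m (slice f y) c ∂μ = uStat m (margin μ f) c := by
  have hae := (integrable_slice μ hf).prod_left_ae
  rw [ae_iff] at hae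
  set N := {z : Fin m → X | ¬Integrable (fun y => Function.uncurry (slice f) (y, z)) μ} with hN
  set T := toMeasurable (Measure.pi fun _ : Fin m => μ) N with hT
  have hTm : MeasurableSet T := measurableSet_toMeasurable _ _
  have hpm : Measurable (T.indicator fun _ => (1 : ℝ≥0∞)) := measurable_const.indicator hTm
  have h0 := lintegral_card_mul_uStat μ hpm fun _ => 1
  simp only [one_mul] at h0
  rw [lintegral_indicator_const hTm, measure_toMeasurable, hae] at h0
  simp only [mul_zero, zero_mul] at h0
  rw [lintegral_eq_zero_iff (measurable_uStat' hpm)] at h0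
  filter_upwards [h0] with c hc
  refine integral_facSum (fun z hz => ?_) hc
  by_contra hcon
  have hz' : z ∈ T := subset_toMeasurable _ _ hcon
  simp [hz'] at hz

end Margin

/-! ### Variance of `U`-statistics and of their second-order part -/

section Linear

variable {X : Type*}

/-- The sum of the values of `g` at the points of a configuration. -/
def sumVal (g : X → ℝ) : Conf X → ℝ := sumPts fun y _ => g y

lemma sumVal_eq_uStat (g : X → ℝ) : sumVal g = uStat 1 fun z => g (z 0) := by
  rw [uStat_succ]
  rfl

lemma hasDiff_sumVal (g : X → ℝ) : HasDiff (sumVal g) fun y _ => g y := by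
  rw [sumVal_eq_uStat]
  have h := hasDiff_uStat (m := 0) (f := fun z : Fin 1 → X => g (z 0)) trivial
  intro n i y x
  rw [h n i y x]
  simp [uStat_zero, slice]

lemma HasDiff.sub {G G' : Conf X → ℝ} {D D' : X → Conf X → ℝ} (h : HasDiff G D)
    (h' : HasDiff G' D') : HasDiff (fun c => G c - G' c) fun y c => D y c - D' y c := by
  intro n i y x
  simp only [h n i y x, h' n i y x]
  ring

lemma HasDiff.const_mul {G : Conf X → ℝ} {D : X → Conf X → ℝ} (h : HasDiff G D) (r : ℝ) :
    HasDiff (fun c => r * G c) fun y c => r * D y c := by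
  intro n i y x
  simp only [h n i y x]
  ring

lemma HasDiff.sub_const {G : Conf X → ℝ} {D : X → Conf X → ℝ} (h : HasDiff G D) (r : ℝ) :
    HasDiff (fun c => G c - r) D := by
  intro n i y x
  simp only [h n i y x]
  ring

/-- The difference operator of a `U`-statistic of any order; it vanishes for order zero. -/
def uDiff : {m : ℕ} → ((Fin m → X) → ℝ) → X → Conf X → ℝ
  | 0, _, _, _ => 0
  | m + 1, f, y, c => (m + 1 : ℝ) * uStat m (slice f y) c

lemma hasDiff_uStat' {m : ℕ} {f : (Fin m → X) → ℝ} (hf : SymmKernel f) :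
    HasDiff (uStat m f) (uDiff f) := by
  cases m with
  | zero =>
    intro n i y x
    simp [uStat_zero, uDiff]
  | succ m => exact hasDiff_uStat hf

end Linear

lemma mul_le_of_le_two_mul_add {p N w x y z x' y' z' : ℝ≥0∞} (hN : N ≤ 2 * (w + z))
    (hw : w ≤ x + y) (hx : p * x ≤ x') (hy : p * y ≤ y') (hz : p * z ≤ z') :
    p * N ≤ 2 * (x' + y' + z') :=
  calc p * N ≤ p * (2 * ((x + y) + z)) := by gcongr; exact hN.trans (by gcongr)
    _ = 2 * (p * x + p * y + p * z) := by ring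
    _ ≤ _ := by gcongr

section Variance

variable {X : Type*} [MeasurableSpace X]

lemma measurable_sumVal {g : X → ℝ} (hg : Measurable g) : Measurable (sumVal g) :=
  measurable_sumPts (hg.comp measurable_fst)

lemma uStat_one {f : (Fin 1 → X) → ℝ} (μ : Measure X) : uStat 1 f = sumVal (proj μ f) := by
  rw [uStat_succ]
  rfl

lemma measurable_uDiff {m : ℕ} {f : (Fin m → X) → ℝ} (hf : Measurable f) :
    Measurable (Function.uncurry (uDiff f)) := by
  cases m with
  | zero => exact measurable_const
  | succ m => exact (measurable_uStat (measurable_slice' hf)).const_mul _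

lemma integrable_of_sqNorm (μ : Measure X) [IsFiniteMeasure μ] {m : ℕ} {f : (Fin m → X) → ℝ}
    (hf : Measurable f) (h : sqNorm f (Measure.pi fun _ : Fin m => μ) ≠ ∞) :
    Integrable f (Measure.pi fun _ : Fin m => μ) :=
  (memLp_two_of_sqNorm hf.aestronglyMeasurable h).integrable (by norm_num)

lemma sqNorm_uStat_le (μ : Measure X) [IsFiniteMeasure μ] {m : ℕ} {f : (Fin m → X) → ℝ}
    (hf : Measurable f) {b : ℝ≥0∞} (hb : 1 ≤ b) (hμ : μ Set.univ ≤ b) :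
    sqNorm (uStat m f) (poissonConf μ) ≤
      ((2 * m + 1 : ℕ) * b) ^ m * sqNorm f (Measure.pi fun _ : Fin m => μ) := by
  have h := lintegral_uStat_pow_le μ hf 1
  simp only [mul_one] at h
  refine h.trans ?_
  unfold sqNorm
  gcongr
  calc μ Set.univ + m + m ≤ b + m * b + m * b := by
        gcongr
        · exact le_mul_of_one_le_right' hb
        · exact le_mul_of_one_le_right' hb
    _ = _ := by push_cast; ring

lemma memLp_uStat (μ : Measure X) [IsFiniteMeasure μ] {m : ℕ} {f : (Fin m → X) → ℝ}
    (hf : Measurable f) (h : sqNorm f (Measure.pi fun _ : Fin m => μ) ≠ ∞) :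
    MemLp (uStat m f) 2 (poissonConf μ) := by
  refine memLp_two_of_sqNorm (measurable_uStat' hf).aestronglyMeasurable ?_
  refine ne_top_of_le_ne_top ?_ (sqNorm_uStat_le μ hf (b := 1 + μ Set.univ) le_self_add
    le_add_self)
  refine ENNReal.mul_ne_top
    (ENNReal.pow_ne_top (ENNReal.mul_ne_top (ENNReal.natCast_ne_top _) ?_)) h
  exact ENNReal.add_ne_top.2 ⟨by simp, measure_ne_top _ _⟩

lemma sqNorm_uncurry (μ : Measure X) [IsFiniteMeasure μ] {Φ : X → Conf X → ℝ}
    (hΦ : Measurable (Function.uncurry Φ)) :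
    sqNorm (Function.uncurry Φ) (μ.prod (poissonConf μ)) =
      ∫⁻ y, sqNorm (Φ y) (poissonConf μ) ∂μ :=
  lintegral_prod _ (hΦ.enorm.pow_const _).aemeasurable

/-- Integration of a bound for the `U`-statistics of the slices of `f`. -/
lemma sqNorm_slice_le (μ : Measure X) [IsFiniteMeasure μ] {m : ℕ} {f : (Fin (m + 1) → X) → ℝ}
    (hf : Measurable f) {Φ : X → Conf X → ℝ} (hΦ : Measurable (Function.uncurry Φ)) {C C' : ℝ≥0∞}
    (h : ∀ y, C' * sqNorm (Φ y) (poissonConf μ) ≤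
      C * sqNorm (slice f y) (Measure.pi fun _ : Fin m => μ)) :
    C' * sqNorm (Function.uncurry Φ) (μ.prod (poissonConf μ)) ≤
      C * sqNorm f (Measure.pi fun _ : Fin (m + 1) => μ) := by
  have m1 : Measurable fun y => sqNorm (Φ y) (poissonConf μ) :=
    (hΦ.enorm.pow_const 2).lintegral_prod_right'
  have m2 : Measurable fun y => sqNorm (slice f y) (Measure.pi fun _ : Fin m => μ) :=
    ((measurable_slice' hf).enorm.pow_const 2).lintegral_prod_right'
  rw [sqNorm_uncurry μ hΦ, ← lintegral_sqNorm_slice μ hf, ← lintegral_const_mul _ m1,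
    ← lintegral_const_mul _ m2]
  exact lintegral_mono h

/-- The difference operator of a `U`-statistic of order `m` is `m` times a `U`-statistic of order
`m - 1`. -/
lemma sqNorm_uncurry_uDiff_le (μ : Measure X) [IsFiniteMeasure μ] {m : ℕ} {f : (Fin m → X) → ℝ}
    (hf : Measurable f) {b : ℝ≥0∞} (hb : 1 ≤ b) (hμ : μ Set.univ ≤ b) :
    b * sqNorm (Function.uncurry (uDiff f)) (μ.prod (poissonConf μ)) ≤
      (m ^ 2 * (2 * m + 1 : ℕ) ^ m : ℕ) * b ^ m * sqNorm f (Measure.pi fun _ : Fin m => μ) := by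
  cases m with
  | zero => simp [uDiff, sqNorm, Function.uncurry_def]
  | succ m =>
    refine sqNorm_slice_le μ hf (measurable_uDiff hf) fun y => ?_
    have e : sqNorm (uDiff f y) (poissonConf μ) =
        ‖(m + 1 : ℝ)‖ₑ ^ 2 * sqNorm (uStat m (slice f y)) (poissonConf μ) := sqNorm_const_mul _ _ _
    have e' : ‖(m + 1 : ℝ)‖ₑ = ((m + 1 : ℕ) : ℝ≥0∞) := by
      rw [← Nat.cast_succ, Real.enorm_natCast]
    rw [e, e']
    calc b * (((m + 1 : ℕ) : ℝ≥0∞) ^ 2 * sqNorm (uStat m (slice f y)) (poissonConf μ))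
        ≤ b * (((m + 1 : ℕ) : ℝ≥0∞) ^ 2 * (((2 * m + 1 : ℕ) * b) ^ m *
            sqNorm (slice f y) (Measure.pi fun _ : Fin m => μ))) := by
          gcongr
          exact sqNorm_uStat_le μ ((measurable_slice' hf).comp measurable_prodMk_left) hb hμ
      _ = ((m + 1) ^ 2 * (2 * m + 1 : ℕ) ^ m : ℕ) * b ^ (m + 1) *
            sqNorm (slice f y) (Measure.pi fun _ : Fin m => μ) := by
          push_cast
          rw [mul_pow]
          ring
      _ ≤ _ := by
          have h : (2 * m + 1) ^ m ≤ (2 * (m + 1) + 1) ^ (m + 1) :=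
            calc (2 * m + 1) ^ m ≤ (2 * (m + 1) + 1) ^ m := Nat.pow_le_pow_left (by omega) _
              _ ≤ _ := Nat.pow_le_pow_right (by omega) (by omega)
          have h' : (m + 1) ^ 2 * (2 * m + 1) ^ m ≤ (m + 1) ^ 2 * (2 * (m + 1) + 1) ^ (m + 1) :=
            Nat.mul_le_mul_left _ h
          gcongr

/-- The centred `U`-statistic minus the one of the margin: for `θ = 0` the innermost summand of the
martingale-type decomposition of a `U`-statistic, for `θ = 1` the same without its linear part. -/
def compPart (μ : Measure X) {m : ℕ} (θ : ℝ) (f : (Fin (m + 1) → X) → ℝ) (c : Conf X) : ℝ :=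
  (uStat (m + 1) f c - uStat m (margin μ f) c) - θ * (sumVal (proj μ f) c - iterMean μ (m + 1) f)

/-- `compPart` is a compensated sum whose difference operator is explicit, so that its variance is
controlled by `sqNorm_le_of_hasDiff`. -/
lemma sqNorm_compPart_le (μ : Measure X) [IsFiniteMeasure μ] {m : ℕ} (θ : ℝ)
    {f : (Fin (m + 1) → X) → ℝ} (hf : Measurable f) (hs : SymmKernel f)
    (h2 : sqNorm f (Measure.pi fun _ : Fin (m + 1) => μ) ≠ ∞) :
    sqNorm (compPart μ θ f) (poissonConf μ) ≤
      sqNorm (Function.uncurry fun y c => uStat m (slice f y) c - θ * proj μ f y)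
        (μ.prod (poissonConf μ)) +
      sqNorm (Function.uncurry fun y c => (uDiff f y c - uDiff (margin μ f) y c) - θ * proj μ f y)
        (μ.prod (poissonConf μ)) := by
  have hi := integrable_of_sqNorm μ hf h2
  have hmm := measurable_margin' μ hf
  have hpm := measurable_proj μ hf
  have hp2 : sqNorm (proj μ f) μ ≠ ∞ :=
    ne_top_of_le_ne_top (ENNReal.mul_ne_top (ENNReal.pow_ne_top (measure_ne_top _ _)) h2)
      (sqNorm_proj_le μ hf)
  have hpi : Integrable (proj μ f) μ :=
    (memLp_two_of_sqNorm hpm.aestronglyMeasurable hp2).integrable (by norm_num)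
  have hmg2 : sqNorm (margin μ f) (Measure.pi fun _ : Fin m => μ) ≠ ∞ :=
    ne_top_of_le_ne_top (ENNReal.mul_ne_top (measure_ne_top _ _) h2) (sqNorm_margin_le μ hf)
  have hsum2 : MemLp (sumVal (proj μ f)) 2 (poissonConf μ) := by
    rw [sumVal_eq_uStat]
    refine memLp_uStat μ (hpm.comp (measurable_pi_apply 0)) ?_
    have := lintegral_sqNorm_slice μ (m := 0) (f := fun z : Fin 1 → X => proj μ f (z 0))
      (hpm.comp (measurable_pi_apply 0))
    rw [← this]
    simp only [sqNorm, lintegral_pi_zero, slice, Fin.cons_zero]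
    exact hp2
  have hm1 := (measurable_uStat' hf).sub (measurable_uStat' hmm)
  refine sqNorm_le_of_hasDiff μ ?_ ?_ ?_ ?_ ?_ ?_
  · exact (measurable_uStat (measurable_slice' hf)).sub ((hpm.comp measurable_fst).const_mul θ)
  · exact ((memLp_uStat μ hf h2).sub (memLp_uStat μ hmm hmg2)).sub
      ((hsum2.sub (memLp_const _)).const_mul θ)
  · exact hm1.sub (((measurable_sumVal hpm).sub_const _).const_mul θ)
  · exact ((measurable_uDiff hf).sub (measurable_uDiff hmm)).sub
      ((hpm.comp measurable_fst).const_mul θ)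
  · exact ((hasDiff_uStat' hs).sub (hasDiff_uStat' (hs.margin μ))).sub
      (((hasDiff_sumVal _).sub_const _).const_mul θ)
  · filter_upwards [ae_integral_uStat_slice μ hi] with c hc
    have e : sumPts (fun y c => uStat m (slice f y) c - θ * proj μ f y) c =
        uStat (m + 1) f c - θ * sumVal (proj μ f) c := by
      rw [uStat_succ, sumVal]
      obtain ⟨n, x⟩ := c
      cases n with
      | zero => simp [sumPts]
      | succ n => simp only [sumPts, Finset.sum_sub_distrib, Finset.mul_sum]
    rw [e, integral_sub hc.1 (hpi.const_mul θ), hc.2, integral_const_mul, integral_proj μ hi,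
      compPart]
    ring

/-- The centred `U`-statistic. -/
def centU (μ : Measure X) {m : ℕ} (f : (Fin m → X) → ℝ) (c : Conf X) : ℝ :=
  uStat m f c - iterMean μ m f

lemma measurable_centU (μ : Measure X) {m : ℕ} {f : (Fin m → X) → ℝ} (hf : Measurable f) :
    Measurable (centU μ f) := (measurable_uStat' hf).sub_const _

lemma centU_succ (μ : Measure X) {m : ℕ} (f : (Fin (m + 1) → X) → ℝ) (c : Conf X) :
    centU μ f c = compPart μ 0 f c + centU μ (margin μ f) c := by
  simp only [centU, compPart, iterMean]
  ring

/-- Variances of `U`-statistics of order `m` are of order `b^{m-1}` when the total intensity is at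
most `b` and the square norm of the kernel, of order `b^m`, is factored out. The proof peels off one
argument at a time: `centU f` is `compPart 0 f`, a compensated sum, plus `centU` of the margin. -/
lemma exists_sqNorm_centU_le (m : ℕ) : ∃ K : ℕ, ∀ (μ : Measure X) [IsFiniteMeasure μ]
    (f : (Fin m → X) → ℝ) (b : ℝ≥0∞), Measurable f → SymmKernel f → 1 ≤ b → b ≠ ∞ →
    μ Set.univ ≤ b → b * sqNorm (centU μ f) (poissonConf μ) ≤
      (K + 1) * b ^ m * sqNorm f (Measure.pi fun _ : Fin m => μ) := by
  induction m with
  | zero =>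
    refine ⟨0, fun μ _ f b _ _ _ _ _ => ?_⟩
    simp [centU, iterMean, uStat_zero, sqNorm]
  | succ m ih =>
    obtain ⟨K, hK⟩ := ih
    obtain ⟨c₁, hc₁⟩ : ∃ c : ℕ, c = (2 * m + 1) ^ m := ⟨_, rfl⟩
    obtain ⟨c₂, hc₂⟩ : ∃ c : ℕ, c = (m + 1) ^ 2 * (2 * (m + 1) + 1) ^ (m + 1) := ⟨_, rfl⟩
    obtain ⟨c₃, hc₃⟩ : ∃ c : ℕ, c = m ^ 2 * (2 * m + 1) ^ m := ⟨_, rfl⟩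
    refine ⟨2 * (c₁ + 2 * (c₂ + c₃) + (K + 1)), fun μ _ f b hf hs hb hbt hμ => ?_⟩
    set s := sqNorm f (Measure.pi fun _ : Fin (m + 1) => μ) with hs_def
    by_cases hst : s = ∞
    · have hb0 : b ≠ 0 := (zero_lt_one.trans_le hb).ne'
      rw [hst, ENNReal.mul_top]
      · exact le_top
      · exact mul_ne_zero (by simp) (pow_ne_zero _ hb0)
    have hmm := measurable_margin' μ hf
    have hmargin : sqNorm (margin μ f) (Measure.pi fun _ : Fin m => μ) ≤ b * s :=
      (sqNorm_margin_le μ hf).trans (by gcongr)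
    have b1 : b * sqNorm (Function.uncurry fun y c => uStat m (slice f y) c - 0 * proj μ f y)
        (μ.prod (poissonConf μ)) ≤ (c₁ * b ^ (m + 1)) * s := by
      simp only [zero_mul, sub_zero]
      refine sqNorm_slice_le μ hf (measurable_uStat (measurable_slice' hf)) fun y => ?_
      have := sqNorm_uStat_le μ (f := slice f y)
        ((measurable_slice' hf).comp measurable_prodMk_left) hb hμ
      calc _ ≤ b * (((2 * m + 1 : ℕ) * b) ^ m *
            sqNorm (slice f y) (Measure.pi fun _ : Fin m => μ)) := by gcongr
        _ = _ := by
          rw [hc₁]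
          push_cast
          rw [mul_pow]
          ring
    have b2 : b * sqNorm (Function.uncurry fun y c =>
        (uDiff f y c - uDiff (margin μ f) y c) - 0 * proj μ f y)
        (μ.prod (poissonConf μ)) ≤ (2 * (c₂ + c₃) * b ^ (m + 1)) * s := by
      have d1 := sqNorm_uncurry_uDiff_le μ hf hb hμ
      have d2 := sqNorm_uncurry_uDiff_le μ hmm hb hμ
      rw [← hc₂] at d1
      rw [← hc₃] at d2
      have hneg : sqNorm (fun p : X × Conf X => -Function.uncurry (uDiff (margin μ f)) p)
          (μ.prod (poissonConf μ)) =
          sqNorm (Function.uncurry (uDiff (margin μ f))) (μ.prod (poissonConf μ)) := by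
        simp [sqNorm]
      have hadd := sqNorm_add_le (ρ := μ.prod (poissonConf μ)) (measurable_uDiff hf)
        (G := fun p : X × Conf X => -Function.uncurry (uDiff (margin μ f)) p)
      rw [hneg] at hadd
      simp only [zero_mul, sub_zero]
      calc _ ≤ b * (2 * (sqNorm (Function.uncurry (uDiff f)) (μ.prod (poissonConf μ)) +
              sqNorm (Function.uncurry (uDiff (margin μ f))) (μ.prod (poissonConf μ)))) :=
            mul_le_mul_right hadd b
        _ = 2 * (b * sqNorm (Function.uncurry (uDiff f)) (μ.prod (poissonConf μ)) +
              b * sqNorm (Function.uncurry (uDiff (margin μ f))) (μ.prod (poissonConf μ))) := by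
            ring
        _ ≤ 2 * (c₂ * b ^ (m + 1) * s + c₃ * b ^ m * (b * s)) := by
            exact mul_le_mul_right (add_le_add d1 (d2.trans (by gcongr))) _
        _ = _ := by ring
    have b3 := sqNorm_compPart_le μ 0 hf hs hst
    have b4 := hK μ (margin μ f) b hmm (hs.margin μ) hb hbt hμ
    have hcm : Measurable (compPart μ 0 f) := by
      have : compPart μ 0 f = fun c => centU μ f c - centU μ (margin μ f) c := by
        funext c
        rw [centU_succ]
        ring
      rw [this]
      exact (measurable_centU μ hf).sub (measurable_centU μ hmm)
    have hadd := sqNorm_add_le (ρ := poissonConf μ) hcm (G := centU μ (margin μ f))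
    have e : (fun c => compPart μ 0 f c + centU μ (margin μ f) c) = centU μ f :=
      funext fun c => (centU_succ μ f c).symm
    rw [e] at hadd
    calc b * sqNorm (centU μ f) (poissonConf μ)
        ≤ 2 * ((c₁ * b ^ (m + 1)) * s + (2 * (c₂ + c₃) * b ^ (m + 1)) * s +
            (K + 1) * b ^ m * (b * s)) :=
          mul_le_of_le_two_mul_add hadd b3 b1 b2 (b4.trans (by gcongr))
      _ = (2 * (c₁ + 2 * (c₂ + c₃) + (K + 1)) : ℝ≥0∞) * b ^ (m + 1) * s := by ring
      _ ≤ _ := by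
          gcongr
          push_cast
          exact le_self_add

/-- The centred `U`-statistic minus its linear part. -/
def remU (μ : Measure X) {m : ℕ} (f : (Fin (m + 1) → X) → ℝ) (c : Conf X) : ℝ :=
  centU μ f c - (m + 1 : ℝ) * (sumVal (proj μ f) c - iterMean μ (m + 1) f)

lemma measurable_remU (μ : Measure X) [SFinite μ] {m : ℕ} {f : (Fin (m + 1) → X) → ℝ}
    (hf : Measurable f) : Measurable (remU μ f) :=
  (measurable_centU μ hf).sub (((measurable_sumVal (measurable_proj μ hf)).sub_const _).const_mul _)

lemma remU_one (μ : Measure X) (f : (Fin 1 → X) → ℝ) (c : Conf X) : remU μ f c = 0 := by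
  simp [remU, centU, uStat_one μ]

/-- The remainder of `f` is a compensated sum without linear part, plus the remainder of the margin.
-/
lemma remU_succ (μ : Measure X) {m : ℕ} {f : (Fin (m + 2) → X) → ℝ} (hf : SymmKernel f)
    (c : Conf X) : remU μ f c = compPart μ 1 f c + remU μ (margin μ f) c := by
  simp only [remU, centU, compPart, proj_margin μ hf]
  have e : iterMean μ (m + 1) (margin μ f) = iterMean μ (m + 1 + 1) f := rfl
  rw [e]
  push_cast
  ring

/-- Subtracting the linear part of a `U`-statistic of order `m + 1` lowers its variance by one more
factor `b`, in comparison with `exists_sqNorm_centU_le`: the summands of the compensated sum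
`compPart 1 f`, and those of its difference operator, are now centred `U`-statistics of lower
order. -/
lemma exists_sqNorm_remU_le (m : ℕ) : ∃ K : ℕ, ∀ (μ : Measure X) [IsFiniteMeasure μ]
    (f : (Fin (m + 1) → X) → ℝ) (b : ℝ≥0∞), Measurable f → SymmKernel f → 1 ≤ b → b ≠ ∞ →
    μ Set.univ ≤ b → b ^ 2 * sqNorm (remU μ f) (poissonConf μ) ≤
      (K + 1) * b ^ (m + 1) * sqNorm f (Measure.pi fun _ : Fin (m + 1) => μ) := by
  induction m with
  | zero =>
    refine ⟨0, fun μ _ f b _ _ _ _ _ => ?_⟩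
    simp [remU_one, sqNorm]
  | succ m ih =>
    obtain ⟨K, hK⟩ := ih
    obtain ⟨K₁, hK₁⟩ := exists_sqNorm_centU_le (X := X) (m + 1)
    obtain ⟨K₀, hK₀⟩ := exists_sqNorm_centU_le (X := X) m
    obtain ⟨c₁, hc₁⟩ : ∃ c : ℕ, c = K₁ + 1 := ⟨_, rfl⟩
    obtain ⟨c₂, hc₂⟩ : ∃ c : ℕ, c = (m + 2) ^ 2 * (K₁ + 1) := ⟨_, rfl⟩
    obtain ⟨c₃, hc₃⟩ : ∃ c : ℕ, c = (m + 1) ^ 2 * (K₀ + 1) := ⟨_, rfl⟩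
    refine ⟨2 * (c₁ + 2 * (c₂ + c₃) + (K + 1)), fun μ _ f b hf hs hb hbt hμ => ?_⟩
    set s := sqNorm f (Measure.pi fun _ : Fin (m + 1 + 1) => μ) with hs_def
    by_cases hst : s = ∞
    · have hb0 : b ≠ 0 := (zero_lt_one.trans_le hb).ne'
      rw [hst, ENNReal.mul_top]
      · exact le_top
      · exact mul_ne_zero (by simp) (pow_ne_zero _ hb0)
    have hmm := measurable_margin' μ hf
    have hmargin : sqNorm (margin μ f) (Measure.pi fun _ : Fin (m + 1) => μ) ≤ b * s :=
      (sqNorm_margin_le μ hf).trans (by gcongr)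
    have hΦm : Measurable (Function.uncurry fun y c => centU μ (slice f y) c) :=
      (measurable_uStat (measurable_slice' hf)).sub ((measurable_proj μ hf).comp measurable_fst)
    have hΨm : Measurable (Function.uncurry fun y c => centU μ (slice (margin μ f) y) c) :=
      (measurable_uStat (measurable_slice' hmm)).sub ((measurable_proj μ hmm).comp measurable_fst)
    have b1 : b * sqNorm (Function.uncurry fun y c => centU μ (slice f y) c)
        (μ.prod (poissonConf μ)) ≤ (c₁ * b ^ (m + 1)) * s := by
      refine sqNorm_slice_le μ hf hΦm fun y => ?_
      have := hK₁ μ (slice f y) b ((measurable_slice' hf).comp measurable_prodMk_left)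
        (hs.slice y) hb hbt hμ
      rw [hc₁]
      push_cast
      exact this
    have b1' : b * sqNorm (Function.uncurry fun y c => centU μ (slice (margin μ f) y) c)
        (μ.prod (poissonConf μ)) ≤ ((K₀ + 1) * b ^ m) * (b * s) := by
      refine (sqNorm_slice_le μ hmm hΨm fun y => ?_).trans (mul_le_mul_right hmargin _)
      exact hK₀ μ (slice (margin μ f) y) b ((measurable_slice' hmm).comp measurable_prodMk_left)
        ((hs.margin μ).slice y) hb hbt hμ
    have eD : (Function.uncurry fun y c =>
        (uDiff f y c - uDiff (margin μ f) y c) - 1 * proj μ f y) =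
        fun p : X × Conf X => (m + 2 : ℝ) * (Function.uncurry fun y c => centU μ (slice f y) c) p +
          (-(m + 1 : ℝ)) * (Function.uncurry fun y c => centU μ (slice (margin μ f) y) c) p := by
      funext ⟨y, c⟩
      simp only [Function.uncurry_apply_pair, uDiff, centU]
      have e1 : iterMean μ (m + 1) (slice f y) = proj μ f y := rfl
      have e2 : iterMean μ m (slice (margin μ f) y) = proj μ (margin μ f) y := rfl
      rw [e1, e2, proj_margin μ hs]
      push_cast
      ring
    have n1 : ‖(m + 2 : ℝ)‖ₑ = ((m + 2 : ℕ) : ℝ≥0∞) := by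
      rw [← Real.enorm_natCast]
      push_cast
      rfl
    have n2 : ‖-(m + 1 : ℝ)‖ₑ = ((m + 1 : ℕ) : ℝ≥0∞) := by
      rw [enorm_neg, ← Real.enorm_natCast]
      push_cast
      rfl
    have b2 : b * sqNorm (Function.uncurry fun y c =>
        (uDiff f y c - uDiff (margin μ f) y c) - 1 * proj μ f y)
        (μ.prod (poissonConf μ)) ≤ (2 * (c₂ + c₃) * b ^ (m + 1)) * s := by
      rw [eD]
      have hadd := sqNorm_add_le (ρ := μ.prod (poissonConf μ)) (hΦm.const_mul (m + 2 : ℝ))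
        (G := fun p => (-(m + 1 : ℝ)) *
          (Function.uncurry fun y c => centU μ (slice (margin μ f) y) c) p)
      rw [sqNorm_const_mul, sqNorm_const_mul, n1, n2] at hadd
      calc _ ≤ b * _ := mul_le_mul_right hadd b
        _ = 2 * (((m + 2 : ℕ) : ℝ≥0∞) ^ 2 * (b *
              sqNorm (Function.uncurry fun y c => centU μ (slice f y) c) (μ.prod (poissonConf μ))) +
            ((m + 1 : ℕ) : ℝ≥0∞) ^ 2 * (b *
              sqNorm (Function.uncurry fun y c => centU μ (slice (margin μ f) y) c)
                (μ.prod (poissonConf μ)))) := by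
            ring
        _ ≤ 2 * (((m + 2 : ℕ) : ℝ≥0∞) ^ 2 * ((c₁ * b ^ (m + 1)) * s) +
            ((m + 1 : ℕ) : ℝ≥0∞) ^ 2 * (((K₀ + 1) * b ^ m) * (b * s))) := by
            gcongr
        _ = _ := by
            rw [hc₂, hc₃, hc₁]
            push_cast
            ring
    have b3 := sqNorm_compPart_le μ 1 hf hs hst
    have e3 : (fun y c => uStat (m + 1) (slice f y) c - 1 * proj μ f y) =
        fun y c => centU μ (slice f y) c := by
      funext y c
      rw [one_mul]
      rfl
    rw [e3] at b3
    have b4 := hK μ (margin μ f) b hmm (hs.margin μ) hb hbt hμ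
    have hcm : Measurable (compPart μ 1 f) := by
      have : compPart μ 1 f = fun c => remU μ f c - remU μ (margin μ f) c := by
        funext c
        rw [remU_succ μ hs]
        ring
      rw [this]
      exact (measurable_remU μ hf).sub (measurable_remU μ hmm)
    have hadd := sqNorm_add_le (ρ := poissonConf μ) hcm (G := remU μ (margin μ f))
    have e : (fun c => compPart μ 1 f c + remU μ (margin μ f) c) = remU μ f :=
      funext fun c => (remU_succ μ hs c).symm
    rw [e] at hadd
    have hb1 : ∀ {u v : ℝ≥0∞}, b * u ≤ v → b ^ 2 * u ≤ b * v := fun {u v} h => by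
      rw [sq, mul_assoc]
      gcongr
    calc b ^ 2 * sqNorm (remU μ f) (poissonConf μ)
        ≤ 2 * (b * ((c₁ * b ^ (m + 1)) * s) + b * ((2 * (c₂ + c₃) * b ^ (m + 1)) * s) +
            (K + 1) * b ^ (m + 1) * (b * s)) :=
          mul_le_of_le_two_mul_add hadd b3 (hb1 b1) (hb1 b2) (b4.trans (by gcongr))
      _ = (2 * (c₁ + 2 * (c₂ + c₃) + (K + 1)) : ℝ≥0∞) * b ^ (m + 1 + 1) * s := by ring
      _ ≤ _ := by
          gcongr
          push_cast
          exact le_self_add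

end Variance

/-! ### The characteristic functional of a Poisson process -/

section CharFun

variable {X : Type*}

lemma sumVal_apply (g : X → ℝ) (c : Conf X) : sumVal g c = ∑ i, g (c.2 i) := by
  obtain ⟨n, x⟩ := c
  cases n with
  | zero => simp [sumVal, sumPts]
  | succ n => rfl

variable [MeasurableSpace X]

/-- The probability generating functional of a Poisson process, summed over the number of points. -/
lemma integral_prod_poissonConf (μ : Measure X) [IsFiniteMeasure μ] {g : X → ℂ}
    (hg : Measurable g) (hg1 : ∀ x, ‖g x‖ ≤ 1) :
    ∫ c : Conf X, ∏ i : Fin c.1, g (c.2 i) ∂(poissonConf μ) =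
      Complex.exp (∫ x, g x ∂μ - ((μ Set.univ).toReal : ℂ)) := by
  set F : Conf X → ℂ := fun c => ∏ i : Fin c.1, g (c.2 i) with hF
  have hm : Measurable F := by
    refine measurable_conf_iff.2 fun n => ?_
    change Measurable fun x : Fin n → X => ∏ i : Fin n, g (x i)
    exact Finset.measurable_prod _ fun i _ => hg.comp (measurable_pi_apply i)
  have hb : ∀ c : Conf X, ‖F c‖ ≤ 1 := fun c => by
    rw [hF, norm_prod]
    exact Finset.prod_le_one (fun _ _ => norm_nonneg _) fun i _ => hg1 _
  have hi : Integrable F (poissonConf μ) :=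
    Integrable.of_bound hm.aestronglyMeasurable 1 (Eventually.of_forall hb)
  have hne : ENNReal.ofReal (Real.exp (-(μ Set.univ).toReal)) ≠ 0 := by
    simp [Real.exp_pos]
  have hi' := (integrable_smul_measure hne ENNReal.ofReal_ne_top).1 hi
  have h : ∀ n : ℕ, ∫ c, F c ∂(((n.factorial : ℝ≥0∞)⁻¹) •
      (Measure.pi fun _ : Fin n => μ).map (Sigma.mk n)) = (∫ x, g x ∂μ) ^ n / n.factorial := by
    intro n
    have e : ∫ c, F c ∂(Measure.pi fun _ : Fin n => μ).map (Sigma.mk n) =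
        ∫ x : Fin n → X, ∏ i, g (x i) ∂(Measure.pi fun _ : Fin n => μ) :=
      (measurableEmbedding_confMk n).integral_map F
    rw [integral_smul_measure, e, integral_fintype_prod_eq_pow, Fintype.card_fin,
      ENNReal.toReal_inv, ENNReal.toReal_natCast, Complex.real_smul, div_eq_inv_mul]
    push_cast
    rfl
  rw [poissonConf, integral_smul_measure, integral_sum_measure hi',
    ENNReal.toReal_ofReal (Real.exp_nonneg _)]
  simp_rw [h]
  rw [(NormedSpace.expSeries_div_hasSum_exp (∫ x, g x ∂μ)).tsum_eq, ← Complex.exp_eq_exp_ℂ,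
    Complex.real_smul, Complex.ofReal_exp, ← Complex.exp_add]
  congr 1
  push_cast
  ring

/-- The characteristic functional of a Poisson process. -/
lemma integral_cexp_sumVal (μ : Measure X) [IsFiniteMeasure μ] {φ : X → ℝ} (hφ : Measurable φ) :
    ∫ c, Complex.exp ((sumVal φ c : ℂ) * Complex.I) ∂(poissonConf μ) =
      Complex.exp (∫ x, (Complex.exp ((φ x : ℂ) * Complex.I) - 1) ∂μ) := by
  have hm : Measurable fun x => Complex.exp ((φ x : ℂ) * Complex.I) := by fun_prop
  have h := integral_prod_poissonConf μ hm fun x => (Complex.norm_exp_ofReal_mul_I _).le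
  have hi : Integrable (fun x => Complex.exp ((φ x : ℂ) * Complex.I)) μ :=
    Integrable.of_bound hm.aestronglyMeasurable 1
      (Eventually.of_forall fun x => (Complex.norm_exp_ofReal_mul_I _).le)
  rw [integral_sub hi (integrable_const _), integral_const, measureReal_def, Complex.real_smul,
    mul_one, ← h]
  refine integral_congr_ae (Eventually.of_forall fun c => ?_)
  simp only [sumVal_apply]
  push_cast
  rw [Finset.sum_mul, Complex.exp_sum]

end CharFun

/-! ### Random measures and their finite-dimensional distributions -/

section RandomMeasure

variable {X : Type*} [MeasurableSpace X]

/-- The counting measure of a configuration. -/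
def confMeasure (c : Conf X) : Measure X := ∑ i, Measure.dirac (c.2 i)

lemma confMeasure_apply (c : Conf X) {A : Set X} (hA : MeasurableSet A) :
    confMeasure c A = ENNReal.ofReal (sumVal (A.indicator 1) c) := by
  rw [sumVal_apply, ENNReal.ofReal_sum_of_nonneg fun i _ => Set.indicator_nonneg (by simp) _,
    confMeasure, Measure.finsetSum_apply]
  refine Finset.sum_congr rfl fun i _ => ?_
  rw [Measure.dirac_apply' _ hA]
  by_cases h : c.2 i ∈ A <;> simp [h]

lemma measurable_confMeasure : Measurable (confMeasure (X := X)) := by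
  refine Measure.measurable_of_measurable_coe _ fun A hA => ?_
  simp_rw [confMeasure_apply _ hA]
  exact (measurable_sumVal (measurable_one.indicator hA)).ennreal_ofReal

/-- The law of the numbers of points of a Poisson process in disjoint sets. -/
lemma map_confMeasure_disjoint (μ : Measure X) [IsFiniteMeasure μ] {n : ℕ} {A : Fin n → Set X}
    (hA : ∀ i, MeasurableSet (A i)) (hd : Pairwise (Function.onFun Disjoint A)) :
    (poissonConf μ).map (fun c i => confMeasure c (A i)) =
      Measure.pi fun i => extPoisson (μ (A i)) := by
  set N : Conf X → Fin n → ℝ := fun c i => sumVal ((A i).indicator 1) c with hN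
  have hNm : Measurable N := measurable_pi_lambda _ fun i =>
    measurable_sumVal (measurable_one.indicator (hA i))
  have key : (poissonConf μ).map N =
      Measure.pi fun i => (poissonMeasure (μ (A i)).toNNReal).map (Nat.cast : ℕ → ℝ) := by
    have : IsProbabilityMeasure ((poissonConf μ).map N) :=
      Measure.isProbabilityMeasure_map hNm.aemeasurable
    rw [← charFunDual_eq_pi_iff]
    intro L
    -- `L` of the vector of counts is the sum of the values of `φ` at the points
    set u : Fin n → ℝ := fun i => L (Pi.single i 1) with hu
    have hL : ∀ v : Fin n → ℝ, L v = ∑ i, v i * u i := by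
      intro v
      conv_lhs => rw [← Finset.univ_sum_single v, map_sum]
      refine Finset.sum_congr rfl fun i _ => ?_
      have : (Pi.single i (v i) : Fin n → ℝ) = v i • Pi.single i 1 := by
        rw [← Pi.single_smul, smul_eq_mul, mul_one]
      rw [this, map_smul, smul_eq_mul]
    set φ : X → ℝ := fun x => ∑ i, (A i).indicator 1 x * u i with hφ
    have hφm : Measurable φ := Finset.measurable_sum _ fun i _ =>
      (measurable_one.indicator (hA i)).mul_const _
    have hφs : ∀ c, L (N c) = sumVal φ c := by
      intro c
      rw [hL, sumVal_apply, Finset.sum_comm]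
      refine Finset.sum_congr rfl fun i _ => ?_
      rw [hN]
      simp only [sumVal_apply, Finset.sum_mul]
    -- by disjointness at most one indicator is nonzero, so the exponential becomes additive
    have hexp : ∀ x, Complex.exp ((φ x : ℂ) * Complex.I) - 1 =
        ∑ i, (A i).indicator (fun _ => Complex.exp ((u i : ℂ) * Complex.I) - 1) x := by
      intro x
      by_cases hx : ∃ i, x ∈ A i
      · obtain ⟨i, hi⟩ := hx
        have hne : ∀ j, j ≠ i → x ∉ A j := fun j hj hxj =>
          Set.disjoint_left.1 (hd hj) hxj hi
        rw [hφ]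
        dsimp only
        rw [Finset.sum_eq_single i (fun j _ hj => by simp [hne j hj]) (by simp),
          Finset.sum_eq_single i (fun j _ hj => by simp [hne j hj]) (by simp)]
        simp [hi]
      · have hx' : ∀ i, x ∉ A i := fun i hi => hx ⟨i, hi⟩
        simp [hφ, hx']
    rw [charFunDual_apply, integral_map hNm.aemeasurable (by fun_prop)]
    simp_rw [hφs]
    rw [integral_cexp_sumVal μ hφm]
    simp_rw [hexp]
    rw [integral_finsetSum _ fun i _ => (integrable_const _).indicator (hA i), Complex.exp_sum]
    refine Finset.prod_congr rfl fun i _ => ?_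
    rw [integral_indicator_const _ (hA i)]
    have h := charFun_map_cast_poissonMeasure (μ (A i)).toNNReal (u i)
    rw [charFun_apply] at h
    rw [charFunDual_apply]
    have e : ∀ r : ℝ, (L.comp (ContinuousLinearMap.single ℝ (fun _ : Fin n => ℝ) i)) r
        = inner ℝ r (u i) := by
      intro r
      rw [ContinuousLinearMap.comp_apply, ContinuousLinearMap.single_apply, hL,
        Finset.sum_eq_single i (fun j _ hj => by simp [hj]) (by simp), Real.inner_apply]
      simp
    simp_rw [e, h]
    rw [Complex.real_smul]
    rfl
  have e1 : (fun c i => confMeasure c (A i)) =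
      (fun (v : Fin n → ℝ) i => ENNReal.ofReal (v i)) ∘ N := by
    funext c i
    exact confMeasure_apply c (hA i)
  rw [e1, ← Measure.map_map (by fun_prop) hNm, key]
  have hprob : ∀ i, IsProbabilityMeasure
      (((poissonMeasure (μ (A i)).toNNReal).map (Nat.cast : ℕ → ℝ)).map ENNReal.ofReal) :=
    fun i => Measure.isProbabilityMeasure_map (by fun_prop)
  rw [Measure.pi_map_pi (f := fun _ => ENNReal.ofReal) fun i => by fun_prop]
  congr 1
  funext i
  rw [extPoisson, if_neg (measure_ne_top _ _), Measure.map_map (by fun_prop) .of_discrete]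
  congr 1
  funext k
  simp

/-- Equality in law of random measures follows from equality of the laws of the values on disjoint
sets. -/
lemma map_eq_of_disjoint {Ω Ω' : Type*} [MeasurableSpace Ω] [MeasurableSpace Ω'] {P : Measure Ω}
    {P' : Measure Ω'} [IsProbabilityMeasure P] [IsProbabilityMeasure P'] {ρ : Ω → Measure X}
    {ρ' : Ω' → Measure X} (hρ : Measurable ρ) (hρ' : Measurable ρ')
    (h : ∀ (n : ℕ) (A : Fin n → Set X), (∀ i, MeasurableSet (A i)) →
      Pairwise (Function.onFun Disjoint A) →
      P.map (fun ω i => ρ ω (A i)) = P'.map (fun ω i => ρ' ω (A i))) :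
    P.map ρ = P'.map ρ' := by
  set S := {s : Set X // MeasurableSet s}
  set ev : Measure X → S → ℝ≥0∞ := fun m s => m s.1 with hev
  have hevm : Measurable ev := measurable_pi_lambda _ fun s => Measure.measurable_coe s.2
  have hle : (inferInstance : MeasurableSpace (Measure X)) ≤
      MeasurableSpace.comap ev inferInstance := by
    refine iSup₂_le fun s hs => ?_
    rintro _ ⟨B, hB, rfl⟩
    exact ⟨(fun v => v ⟨s, hs⟩) ⁻¹' B, measurable_pi_apply (X := fun _ : S => ℝ≥0∞) _ hB, rfl⟩
  -- the values on finitely many sets are sums of the values on the atoms of the generated algebra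
  have hfin : ∀ I : Finset S, P.map (fun ω => I.restrict (ev (ρ ω))) =
      P'.map (fun ω => I.restrict (ev (ρ' ω))) := by
    classical
    intro I
    set e := (Fintype.equivFin (I → Bool)).symm
    set at' : (I → Bool) → Set X := fun b => ⋂ s : I, if b s then s.1.1 else s.1.1ᶜ with hat
    have hatm : ∀ b, MeasurableSet (at' b) := fun b => MeasurableSet.iInter fun s => by
      split_ifs
      · exact s.1.2
      · exact s.1.2.compl
    have hatd : Pairwise (Function.onFun Disjoint at') := by
      intro b b' hbb
      obtain ⟨s, hs⟩ := Function.ne_iff.1 hbb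
      refine Set.disjoint_left.2 fun x hx hx' => ?_
      have h1 := Set.mem_iInter.1 hx s
      have h2 := Set.mem_iInter.1 hx' s
      cases hb : b s <;> cases hb' : b' s <;> simp_all
    set A : Fin (Fintype.card (I → Bool)) → Set X := fun k => at' (e k)
    have hAd : Pairwise (Function.onFun Disjoint A) := fun k l hkl =>
      hatd (fun h' => hkl (e.injective h'))
    set T : (Fin (Fintype.card (I → Bool)) → ℝ≥0∞) → I → ℝ≥0∞ :=
      fun v s => ∑ k, if e k s then v k else 0 with hT
    have hTm : Measurable T := measurable_pi_lambda _ fun s => Finset.measurable_sum _ fun k _ => by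
      split_ifs
      · exact measurable_pi_apply k
      · exact measurable_const
    have hval : ∀ m : Measure X, I.restrict (ev m) = T fun k => m (A k) := by
      intro m
      funext s
      rw [hT]
      dsimp only
      rw [← Finset.sum_filter, ← measure_biUnion_finset]
      · change m s.1.1 = m _
        congr 1
        ext x
        simp only [Finset.mem_filter, Finset.mem_univ, true_and, Set.mem_iUnion, exists_prop]
        constructor
        · intro hx
          set b : I → Bool := fun s => decide (x ∈ s.1.1)
          refine ⟨e.symm b, by simpa [b] using hx, ?_⟩
          simp only [A, Equiv.apply_symm_apply, hat, Set.mem_iInter]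
          intro s'
          by_cases hs' : x ∈ s'.1.1
          · rw [if_pos (show b s' = true from decide_eq_true hs')]
            exact hs'
          · rw [if_neg (show ¬b s' = true from fun h' => hs' (of_decide_eq_true h'))]
            exact hs'
        · rintro ⟨k, hk, hx⟩
          have := Set.mem_iInter.1 hx s
          simpa [hk] using this
      · intro k _ l _ hkl
        exact hAd hkl
      · intro k _
        exact hatm _
    have hm1 : Measurable fun ω k => ρ ω (A k) := measurable_pi_lambda _ fun k =>
      (Measure.measurable_coe (hatm _)).comp hρ
    have hm2 : Measurable fun ω k => ρ' ω (A k) := measurable_pi_lambda _ fun k =>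
      (Measure.measurable_coe (hatm _)).comp hρ'
    simp_rw [hval]
    have h1 := Measure.map_map (μ := P) hTm hm1
    have h2 := Measure.map_map (μ := P') hTm hm2
    rw [h _ A (fun k => hatm _) hAd] at h1
    exact h1.symm.trans h2
  have hpr : P.map (ev ∘ ρ) = P'.map (ev ∘ ρ') := by
    have l1 := isProjectiveLimit_map (P := P) (X := fun s ω => ev (ρ ω) s)
      (hevm.comp hρ).aemeasurable
    have l2 := isProjectiveLimit_map (P := P') (X := fun s ω => ev (ρ' ω) s)
      (hevm.comp hρ').aemeasurable
    have : (fun I : Finset S => P.map (fun ω => I.restrict (ev (ρ ω)))) =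
        fun I : Finset S => P'.map (fun ω => I.restrict (ev (ρ' ω))) := funext hfin
    have l1' : IsProjectiveLimit _
      (fun I : Finset S => P.map (fun ω => I.restrict (ev (ρ ω)))) := l1
    rw [this] at l1'
    have : ∀ I : Finset S, IsFiniteMeasure (P'.map (fun ω => I.restrict (ev (ρ' ω)))) :=
      fun I => inferInstance
    exact IsProjectiveLimit.unique (P := fun I : Finset S =>
      P'.map (fun ω => I.restrict (ev (ρ' ω)))) l1' l2
  ext B hB
  obtain ⟨C, hC, rfl⟩ := hle B hB
  rw [Measure.map_apply hρ hB, Measure.map_apply hρ' hB]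
  have : P.map (ev ∘ ρ) C = P'.map (ev ∘ ρ') C := by rw [hpr]
  rwa [Measure.map_apply (hevm.comp hρ) hC, Measure.map_apply (hevm.comp hρ') hC] at this

/-- A Poisson process, restricted to a set of finite intensity, has the law of the counting measure
of a Poisson configuration. -/
lemma IsPoissonProcess.map_restrict {Ω : Type*} [MeasurableSpace Ω] {P : Measure Ω}
    [IsProbabilityMeasure P] {η : Ω → Measure X} {μ : Measure X} (h : IsPoissonProcess P η μ)
    {A : Set X} (hA : MeasurableSet A) (hμ : μ A ≠ ∞) :
    Measurable (fun ω => (η ω).restrict A) ∧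
    P.map (fun ω => (η ω).restrict A) = (poissonConf (μ.restrict A)).map confMeasure := by
  have hfin : IsFiniteMeasure (μ.restrict A) := ⟨by simpa using hμ.lt_top⟩
  have hm : Measurable fun ω => (η ω).restrict A := by
    refine Measure.measurable_of_measurable_coe _ fun B hB => ?_
    simp_rw [Measure.restrict_apply hB]
    exact (Measure.measurable_coe (hB.inter hA)).comp h.measurable
  refine ⟨hm, map_eq_of_disjoint hm measurable_confMeasure fun n B hB hd => ?_⟩
  rw [map_confMeasure_disjoint _ hB hd]
  have hBA : ∀ i, MeasurableSet (B i ∩ A) := fun i => (hB i).inter hA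
  have hi := h.indep n (fun i => B i ∩ A) hBA fun i j hij =>
    (hd hij).mono Set.inter_subset_left Set.inter_subset_left
  have hmB : ∀ i, Measurable fun ω => η ω (B i ∩ A) := fun i =>
    (Measure.measurable_coe (hBA i)).comp h.measurable
  rw [iIndepFun_iff_map_fun_eq_pi_map fun i => (hmB i).aemeasurable] at hi
  have e : (fun ω i => (η ω).restrict A (B i)) = fun ω i => η ω (B i ∩ A) := by
    funext ω i
    exact Measure.restrict_apply (hB i)
  rw [e, hi]
  congr 1
  funext i
  rw [h.law _ (hBA i), Measure.restrict_apply (hB i)]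

end RandomMeasure

/-! ### Factorial measures of finite point configurations -/

section FactorialSum

variable {X M ι : Type*}

lemma facSum_eq_sum [AddCommMonoid M] [DecidableEq ι] [Fintype ι] {m : ℕ}
    (f : (Fin m → X) → M) (x : ι → X) (s : Finset ι) :
    facSum m f x s = ∑ σ : Fin m → ι,
      open Classical in if Function.Injective σ ∧ ∀ j, σ j ∈ s then f (x ∘ σ) else 0 := by
  classical
  induction m generalizing s with
  | zero =>
    rw [Fintype.sum_unique]
    rw [if_pos ⟨Function.injective_of_subsingleton _, fun j => j.elim0⟩, facSum]
    congr 1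
    exact Subsingleton.elim _ _
  | succ m ih =>
    rw [← (Fin.consEquiv fun _ => ι).sum_comp, Fintype.sum_prod_type]
    simp only [facSum]
    rw [← Finset.sum_filter_add_sum_filter_not Finset.univ (· ∈ s),
      Finset.sum_eq_zero (s := Finset.univ.filter fun i => ¬ i ∈ s), add_zero]
    · rw [Finset.filter_mem_eq_inter, Finset.univ_inter]
      refine Finset.sum_congr rfl fun i hi => ?_
      rw [ih]
      refine Finset.sum_congr rfl fun σ _ => ?_
      have e : (Function.Injective σ ∧ ∀ j, σ j ∈ s.erase i) ↔
          (Function.Injective (Fin.cons (α := fun _ => ι) i σ) ∧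
            ∀ j, Fin.cons (α := fun _ => ι) i σ j ∈ s) := by
        rw [Fin.cons_injective_iff, Fin.forall_fin_succ]
        simp only [Fin.cons_zero, Fin.cons_succ, Finset.mem_erase, Set.mem_range, not_exists]
        constructor
        · rintro ⟨h1, h2⟩
          exact ⟨⟨fun j => (h2 j).1, h1⟩, hi, fun j => (h2 j).2⟩
        · rintro ⟨⟨h1, h2⟩, _, h3⟩
          exact ⟨h2, fun j => ⟨h1 j, h3 j⟩⟩
      refine if_congr e ?_ rfl
      rw [slice]
      congr 1
      funext j
      refine Fin.cases ?_ (fun j => ?_) j <;> rfl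
    · intro i hi
      refine Finset.sum_eq_zero fun σ _ => if_neg fun h => ?_
      exact (Finset.mem_filter.1 hi).2 (h.2 0)

lemma uStat_eq_sum [AddCommMonoid M] {m : ℕ} (f : (Fin m → X) → M) (c : Conf X) :
    uStat m f c = ∑ σ : Fin m → Fin c.1,
      open Classical in if Function.Injective σ then f (c.2 ∘ σ) else 0 := by
  rw [uStat, facSum_eq_sum]
  simp

lemma uStat_eq_toReal_sub {m : ℕ} (f : (Fin m → X) → ℝ) (c : Conf X) :
    uStat m f c = (uStat m (fun z => ENNReal.ofReal (f z)) c).toReal -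
      (uStat m (fun z => ENNReal.ofReal (-f z)) c).toReal := by
  classical
  simp only [uStat_eq_sum]
  rw [ENNReal.toReal_sum, ENNReal.toReal_sum, ← Finset.sum_sub_distrib]
  · refine Finset.sum_congr rfl fun σ _ => ?_
    split_ifs
    · rw [ENNReal.toReal_ofReal', ENNReal.toReal_ofReal']
      rcases le_total (f (c.2 ∘ σ)) 0 with h | h <;> simp [h]
    · simp
  · intro σ _
    split_ifs <;> simp
  · intro σ _
    split_ifs <;> simp

end FactorialSum

section FactorialMeasure

variable {X : Type*} [MeasurableSpace X]

lemma measurableSet_injective [MeasurableEq X] (m : ℕ) :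
    MeasurableSet {x : Fin m → X | Function.Injective x} := by
  have : {x : Fin m → X | Function.Injective x} =
      ⋂ i, ⋂ j, {x : Fin m → X | x i = x j → i = j} := by
    ext x
    simp [Function.Injective]
  rw [this]
  refine MeasurableSet.iInter fun i => MeasurableSet.iInter fun j => ?_
  by_cases hij : i = j
  · simp [hij]
  · simp only [hij, imp_false]
    exact (measurableSet_eq_fun (measurable_pi_apply i) (measurable_pi_apply j)).compl

instance isFiniteMeasure_confMeasure (c : Conf X) : IsFiniteMeasure (confMeasure c) := by
  unfold confMeasure
  infer_instance

lemma pi_confMeasure (m : ℕ) (c : Conf X) :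
    Measure.pi (fun _ : Fin m => confMeasure c) =
      ∑ σ : Fin m → Fin c.1, Measure.dirac (c.2 ∘ σ) := by
  refine Measure.pi_eq fun s hs => ?_
  rw [Measure.finsetSum_apply]
  simp only [confMeasure, Measure.finsetSum_apply]
  rw [Finset.prod_univ_sum, Fintype.piFinset_univ]
  refine Finset.sum_congr rfl fun σ _ => ?_
  rw [Measure.dirac_apply' _ (MeasurableSet.univ_pi hs)]
  classical
  simp only [Measure.dirac_apply' _ (hs _), Set.indicator_apply, Set.mem_univ_pi,
    Function.comp_apply, Pi.one_apply]
  rw [Finset.prod_ite_zero]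
  simp

lemma lintegral_factorialMeasure_confMeasure [MeasurableEq X] {m : ℕ} {F : (Fin m → X) → ℝ≥0∞}
    (hF : Measurable F) {c : Conf X} (hc : Function.Injective c.2) :
    ∫⁻ z, F z ∂(factorialMeasure m (confMeasure c)) = uStat m F c := by
  classical
  rw [factorialMeasure, ← lintegral_indicator (measurableSet_injective m), pi_confMeasure,
    lintegral_finsetSum_measure, uStat_eq_sum]
  refine Finset.sum_congr rfl fun σ _ => ?_
  rw [lintegral_dirac' _ (hF.indicator (measurableSet_injective m)), Set.indicator_apply]
  simp only [Set.mem_ofPred_eq, hc.of_comp_iff]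

/-- Without atoms of the intensity measure, the points of a Poisson process are distinct. -/
lemma ae_injective_poissonConf [MeasurableEq X] (μ : Measure X) [IsFiniteMeasure μ]
    [NullSingletonClass μ] : ∀ᵐ c ∂(poissonConf μ), Function.Injective c.2 := by
  set D : Set (Fin 2 → X) := {z | z 0 = z 1} with hD
  have hDm : MeasurableSet D :=
    measurableSet_eq_fun (measurable_pi_apply 0) (measurable_pi_apply 1)
  have hm : Measurable (D.indicator fun _ => (1 : ℝ≥0∞)) := measurable_const.indicator hDm
  have h0 := lintegral_card_mul_uStat μ hm fun _ => 1
  -- the mean number of pairs of coinciding points is `μ²` of the diagonal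
  have hz : ∫⁻ z, D.indicator (fun _ => (1 : ℝ≥0∞)) z ∂(Measure.pi fun _ : Fin 2 => μ) = 0 := by
    rw [← lintegral_slice μ hm]
    refine (lintegral_congr fun y => ?_).trans lintegral_zero
    rw [← lintegral_slice μ (f := slice (D.indicator fun _ => (1 : ℝ≥0∞)) y)
      ((measurable_slice' hm).comp measurable_prodMk_left)]
    simp only [lintegral_pi_zero]
    have : ∀ w, slice (slice (D.indicator fun _ => (1 : ℝ≥0∞)) y) w Fin.elim0 =
        ({y} : Set X).indicator (fun _ => 1) w := by
      intro w
      have e : (Fin.cons y (Fin.cons w Fin.elim0) : Fin 2 → X) ∈ D ↔ w ∈ ({y} : Set X) := eq_comm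
      classical
      simp only [slice, Set.indicator_apply, e]
    simp_rw [this]
    rw [lintegral_indicator_const (measurableSet_singleton y)]
    simp
  rw [hz] at h0
  simp only [one_mul, zero_mul] at h0
  rw [lintegral_eq_zero_iff (measurable_uStat' hm)] at h0
  filter_upwards [h0] with c hc i j hij
  by_contra hne
  rw [uStat_eq_sum] at hc
  have h1 := Finset.sum_eq_zero_iff.1 hc ![i, j] (Finset.mem_univ _)
  have hinj : Function.Injective ![i, j] := by
    rw [Matrix.vecCons, Fin.cons_injective_iff]
    exact ⟨by simpa using hne, Function.injective_of_subsingleton _⟩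
  rw [if_pos hinj, Set.indicator_of_mem (by simpa [hD] using hij)] at h1
  exact one_ne_zero h1

/-- A measure, replaced by zero if it is infinite. -/
def truncMeasure (ρ : Measure X) : Measure X := open Classical in if ρ Set.univ < ∞ then ρ else 0

instance isFiniteMeasure_truncMeasure (ρ : Measure X) : IsFiniteMeasure (truncMeasure ρ) := by
  unfold truncMeasure
  split_ifs with h
  · exact ⟨h⟩
  · infer_instance

lemma truncMeasure_eq {ρ : Measure X} (h : ρ Set.univ < ∞) : truncMeasure ρ = ρ := if_pos h

lemma measurable_truncMeasure : Measurable (truncMeasure (X := X)) :=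
  Measurable.ite (measurableSet_lt (Measure.measurable_coe MeasurableSet.univ) measurable_const)
    measurable_id measurable_const

/-- Truncation makes the product measures finite, so that their measurable dependence on `ρ` can be
checked on rectangles. -/
lemma measurable_lintegral_factorialMeasure [MeasurableEq X] {m : ℕ} {F : (Fin m → X) → ℝ≥0∞}
    (hF : Measurable F) :
    Measurable fun ρ : Measure X => ∫⁻ z, F z ∂(factorialMeasure m (truncMeasure ρ)) := by
  have hpi : Measurable fun ρ : Measure X => Measure.pi fun _ : Fin m => truncMeasure ρ := by
    refine Measurable.measure_of_isPiSystem generateFrom_pi.symm isPiSystem_pi ?_ ?_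
    · rintro _ ⟨s, hs, rfl⟩
      simp_rw [Measure.pi_pi]
      exact Finset.measurable_prod _ fun i _ =>
        (Measure.measurable_coe (hs i (Set.mem_univ i))).comp measurable_truncMeasure
    · simp_rw [Measure.pi_univ]
      exact Finset.measurable_prod _ fun i _ =>
        (Measure.measurable_coe MeasurableSet.univ).comp measurable_truncMeasure
  simp_rw [factorialMeasure, ← lintegral_indicator (measurableSet_injective m)]
  exact (Measure.measurable_lintegral (hF.indicator (measurableSet_injective m))).comp hpi

/-- A measurable version of `ρ ↦ ∫ f dρ^{(m)}`. -/
def facFunctional (m : ℕ) (f : (Fin m → X) → ℝ) (ρ : Measure X) : ℝ :=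
  (∫⁻ z, ENNReal.ofReal (f z) ∂(factorialMeasure m (truncMeasure ρ))).toReal -
    (∫⁻ z, ENNReal.ofReal (-f z) ∂(factorialMeasure m (truncMeasure ρ))).toReal

lemma measurable_facFunctional [MeasurableEq X] {m : ℕ} {f : (Fin m → X) → ℝ}
    (hf : Measurable f) : Measurable (facFunctional m f) :=
  (measurable_lintegral_factorialMeasure hf.ennreal_ofReal).ennreal_toReal.sub
    (measurable_lintegral_factorialMeasure hf.neg.ennreal_ofReal).ennreal_toReal

lemma facFunctional_confMeasure [MeasurableEq X] {m : ℕ} {f : (Fin m → X) → ℝ}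
    (hf : Measurable f) {c : Conf X} (hc : Function.Injective c.2) :
    facFunctional m f (confMeasure c) = uStat m f c := by
  rw [facFunctional, truncMeasure_eq (measure_lt_top _ _), uStat_eq_toReal_sub,
    lintegral_factorialMeasure_confMeasure hf.ennreal_ofReal hc,
    lintegral_factorialMeasure_confMeasure (F := fun z => ENNReal.ofReal (-f z))
      hf.neg.ennreal_ofReal hc]

/-- Integrals of kernels supported in a set `A` of finite intensity, with respect to the factorial
measure of a Poisson process, have the joint law of the corresponding `U`-statistics of a Poisson
configuration in `A`. -/
lemma IsPoissonProcess.identDistrib_factorial [MeasurableEq X] {Ω : Type*} [MeasurableSpace Ω]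
    {P : Measure Ω} [IsProbabilityMeasure P] {η : Ω → Measure X} {μ : Measure X}
    [NullSingletonClass μ]
    (h : IsPoissonProcess P η μ) {A : Set X} (hA : MeasurableSet A) (hμ : μ A ≠ ∞) {ι : Type*}
    [Countable ι] {m : ℕ} {f : ι → (Fin m → X) → ℝ} (hf : ∀ i, Measurable (f i))
    (hs : ∀ i z, (∃ j, z j ∉ A) → f i z = 0) :
    (∀ i, ∀ᵐ ω ∂P, Integrable (f i) (factorialMeasure m (η ω))) ∧
    IdentDistrib (fun ω i => ∫ z, f i z ∂(factorialMeasure m (η ω))) (fun c i => uStat m (f i) c)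
      P (poissonConf (μ.restrict A)) := by
  obtain ⟨hm, hmap⟩ := h.map_restrict hA hμ
  have hfin : IsFiniteMeasure (μ.restrict A) := ⟨by simpa using hμ.lt_top⟩
  have hid : IdentDistrib (fun ω => (η ω).restrict A) confMeasure P
      (poissonConf (μ.restrict A)) :=
    ⟨hm.aemeasurable, measurable_confMeasure.aemeasurable, hmap⟩
  have hinj := ae_injective_poissonConf (μ.restrict A)
  have hfinη : ∀ᵐ ω ∂P, (η ω).restrict A Set.univ < ∞ := by
    have hset : MeasurableSet {ρ : Measure X | ρ Set.univ < ∞} :=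
      measurableSet_lt (Measure.measurable_coe MeasurableSet.univ) measurable_const
    exact hid.symm.ae_snd hset (Eventually.of_forall fun c => measure_lt_top _ _)
  have hres : ∀ ω, factorialMeasure m ((η ω).restrict A) =
      (factorialMeasure m (η ω)).restrict (Set.univ.pi fun _ => A) := by
    intro ω
    have := h.sigmaFinite ω
    rw [factorialMeasure, factorialMeasure, ← Measure.restrict_pi_pi, Measure.restrict_restrict
      (measurableSet_injective m), Measure.restrict_restrict (MeasurableSet.univ_pi fun _ => hA),
      Set.inter_comm]
  have hoff : ∀ i z, z ∉ Set.univ.pi (fun _ : Fin m => A) → f i z = 0 := by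
    intro i z hz
    refine hs i z ?_
    by_contra hcon
    push Not at hcon
    exact hz fun j _ => hcon j
  have hint : ∀ i, ∀ᵐ ω ∂P, Integrable (f i) (factorialMeasure m ((η ω).restrict A)) := by
    intro i
    have hset : MeasurableSet {ρ : Measure X |
        ∫⁻ z, ‖f i z‖ₑ ∂(factorialMeasure m (truncMeasure ρ)) < ∞} :=
      measurableSet_lt (measurable_lintegral_factorialMeasure (hf i).enorm) measurable_const
    have h1 : ∀ᵐ c ∂(poissonConf (μ.restrict A)), confMeasure c ∈ {ρ : Measure X |
        ∫⁻ z, ‖f i z‖ₑ ∂(factorialMeasure m (truncMeasure ρ)) < ∞} := by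
      filter_upwards [hinj] with c hc
      rw [truncMeasure_eq (measure_lt_top _ _),
        lintegral_factorialMeasure_confMeasure (hf i).enorm hc, uStat_eq_sum]
      refine ENNReal.sum_lt_top.2 fun σ _ => ?_
      split_ifs <;> simp
    filter_upwards [hid.symm.ae_snd hset h1, hfinη] with ω h2 h3
    rw [truncMeasure_eq h3] at h2
    exact ⟨(hf i).aestronglyMeasurable, h2⟩
  refine ⟨fun i => ?_, ?_⟩
  · filter_upwards [hint i] with ω hω
    rw [hres] at hω
    exact (integrableOn_iff_integrable_of_support_subset
      (Function.support_subset_iff'.2 fun z hz => hoff i z hz)).1 hω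
  · -- almost surely both sides are values of one measurable functional of the restricted process
    have hU : Measurable fun (ρ : Measure X) i => facFunctional m (f i) ρ :=
      measurable_pi_lambda _ fun i => measurable_facFunctional (hf i)
    have hc := hid.comp hU
    have e1 : (fun (ω : Ω) i => ∫ z, f i z ∂(factorialMeasure m (η ω))) =ᵐ[P]
        (fun (ρ : Measure X) i => facFunctional m (f i) ρ) ∘ fun ω => (η ω).restrict A := by
      filter_upwards [ae_all_iff.2 hint, hfinη] with ω h1 h2
      funext i
      have h3 : ∫ z, f i z ∂(factorialMeasure m (η ω)) =
          ∫ z, f i z ∂(factorialMeasure m ((η ω).restrict A)) := by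
        rw [hres]
        exact (setIntegral_eq_integral_of_forall_compl_eq_zero fun z hz => hoff i z hz).symm
      rw [h3, integral_eq_lintegral_pos_part_sub_lintegral_neg_part (h1 i)]
      simp only [Function.comp, facFunctional, truncMeasure_eq h2]
    have e2 : (fun (c : Conf X) i => uStat m (f i) c) =ᵐ[poissonConf (μ.restrict A)]
        (fun (ρ : Measure X) i => facFunctional m (f i) ρ) ∘ confMeasure := by
      filter_upwards [hinj] with c hc
      funext i
      exact (facFunctional_confMeasure (hf i) hc).symm
    exact ⟨hc.aemeasurable_fst.congr e1.symm, hc.aemeasurable_snd.congr e2.symm,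
      (Measure.map_congr e1).trans (hc.map_eq.trans (Measure.map_congr e2).symm)⟩

end FactorialMeasure

/-! ### Third-order Taylor expansion of the test functions -/

section Taylor

/-- The operator norm of a multilinear form on `ℝ^ℓ`, with the maximum norm, is bounded by the sum
of the absolute values of its coefficients. -/
lemma norm_multilinear_le {ℓ n : ℕ}
    (f : ContinuousMultilinearMap ℝ (fun _ : Fin n => Fin ℓ → ℝ) ℝ)
    (hf : ∀ r : Fin n → Fin ℓ, |f fun k => Pi.single (r k) 1| ≤ 1) : ‖f‖ ≤ (ℓ : ℝ) ^ n := by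
  refine ContinuousMultilinearMap.opNorm_le_bound (by positivity) fun v => ?_
  have hv : v = fun k => ∑ i, v k i • (Pi.single i 1 : Fin ℓ → ℝ) := by
    funext k
    exact pi_eq_sum_univ' (v k)
  have h1 : f v = ∑ r : Fin n → Fin ℓ, (∏ k, v k (r k)) * f fun k => Pi.single (r k) 1 := by
    conv_lhs => rw [hv]
    have h2 := f.toMultilinearMap.map_sum
      (g := fun (k : Fin n) (i : Fin ℓ) => v k i • (Pi.single i 1 : Fin ℓ → ℝ))
    refine h2.trans (Finset.sum_congr rfl fun r _ => ?_)
    exact f.toMultilinearMap.map_smul_univ _ _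
  rw [h1]
  refine (norm_sum_le _ _).trans ?_
  refine (Finset.sum_le_card_nsmul _ _ (∏ k, ‖v k‖) fun r _ => ?_).trans_eq ?_
  · rw [norm_mul, norm_prod]
    refine (mul_le_mul (Finset.prod_le_prod (fun _ _ => norm_nonneg _) fun k _ =>
      norm_le_pi_norm (v k) (r k)) (hf r) (abs_nonneg _)
      (Finset.prod_nonneg fun _ _ => norm_nonneg _)).trans_eq (mul_one _)
  · rw [Finset.card_univ, Fintype.card_fun, Fintype.card_fin, Fintype.card_fin, nsmul_eq_mul]
    push_cast
    rfl

variable {V : Type*} [NormedAddCommGroup V] [NormedSpace ℝ V]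

lemma norm_fderiv_add_sub_le {G : Type*} [NormedAddCommGroup G] [NormedSpace ℝ G] {f : V → G}
    {K : ℝ} (hf : Differentiable ℝ f) (hK : ∀ x, ‖fderiv ℝ f x‖ ≤ K) (x y : V) :
    ‖f (x + y) - f x‖ ≤ K * ‖y‖ := by
  have := convex_univ.norm_image_sub_le_of_norm_fderiv_le (𝕜 := ℝ) (x := x) (y := x + y)
    (fun z _ => hf z) (fun z _ => hK z) (Set.mem_univ _) (Set.mem_univ _)
  simpa using this

/-- The first-order Taylor remainder, from the mean value inequality on the ball of radius `‖y‖`. -/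
lemma norm_taylor_two_le {G : Type*} [NormedAddCommGroup G] [NormedSpace ℝ G] {f : V → G} {K : ℝ}
    (hf : Differentiable ℝ f) (hf' : Differentiable ℝ (fderiv ℝ f)) (hK0 : 0 ≤ K)
    (hK : ∀ x, ‖fderiv ℝ (fderiv ℝ f) x‖ ≤ K) (x y : V) :
    ‖f (x + y) - f x - fderiv ℝ f x y‖ ≤ K * ‖y‖ ^ 2 := by
  have h := (convex_closedBall x ‖y‖).norm_image_sub_le_of_norm_hasFDerivWithin_le' (𝕜 := ℝ)
    (f := f) (f' := fderiv ℝ f) (φ := fderiv ℝ f x) (C := K * ‖y‖) (x := x) (y := x + y)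
    (fun z _ => (hf z).hasFDerivAt.hasFDerivWithinAt) (fun z hz => ?_)
    (Metric.mem_closedBall_self (norm_nonneg _)) (by simp)
  · simpa [pow_two, mul_assoc] using h
  · have := norm_fderiv_add_sub_le hf' hK x (z - x)
    rw [add_sub_cancel] at this
    refine this.trans (mul_le_mul_of_nonneg_left ?_ hK0)
    simpa [dist_eq_norm] using hz

set_option maxSynthPendingDepth 3 in
/-- The second-order Taylor remainder, from the mean value inequality for
`w ↦ f (x + w) - D²f(x)(w, w) / 2`, whose derivative is a first-order remainder of `Df`. -/
lemma norm_taylor_three_le {f : V → ℝ} {K : ℝ} (hf : ContDiff ℝ 3 f) (hK0 : 0 ≤ K)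
    (hK : ∀ x, ‖fderiv ℝ (fderiv ℝ (fderiv ℝ f)) x‖ ≤ K) (x y : V) :
    ‖f (x + y) - f x - fderiv ℝ f x y - (1 / 2 : ℝ) * fderiv ℝ (fderiv ℝ f) x y y‖ ≤
      K * ‖y‖ ^ 3 := by
  have hf1 : ContDiff ℝ 2 (fderiv ℝ f) := hf.fderiv_right (by norm_num)
  have hf2 : ContDiff ℝ 1 (fderiv ℝ (fderiv ℝ f)) := hf1.fderiv_right (by norm_num)
  have hsymm : IsSymmSndFDerivAt ℝ f x :=
    hf.contDiffAt.isSymmSndFDerivAt (by rw [minSmoothness_of_isRCLikeNormedField]; norm_num)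
  set b := fderiv ℝ (fderiv ℝ f) x with hb
  have hder : ∀ w, HasFDerivAt (fun w => f (x + w) - (1 / 2 : ℝ) * b w w)
      (fderiv ℝ f (x + w) - b w) w := by
    intro w
    have h1 : HasFDerivAt (fun w => f (x + w)) (fderiv ℝ f (x + w)) w := by
      have := (hf.differentiable (by norm_num) (x + w)).hasFDerivAt.comp w
        ((hasFDerivAt_id w).const_add x)
      exact this.congr_fderiv (ContinuousLinearMap.comp_id _)
    have h2 : HasFDerivAt (fun w => b w w) (b w + b.flip w) w := by
      have := b.hasFDerivAt_of_bilinear (hasFDerivAt_id w) (hasFDerivAt_id w)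
      refine this.congr_fderiv ?_
      ext v
      simp
    refine (h1.sub (h2.const_mul (1 / 2 : ℝ))).congr_fderiv ?_
    ext v
    have h3 : b v w = b w v := hsymm v w
    simp [h3]
    ring
  have h := (convex_closedBall (0 : V) ‖y‖).norm_image_sub_le_of_norm_hasFDerivWithin_le' (𝕜 := ℝ)
    (f' := fun w => fderiv ℝ f (x + w) - b w) (φ := fderiv ℝ f x) (C := K * ‖y‖ ^ 2) (x := 0)
    (y := y) (fun z _ => (hder z).hasFDerivWithinAt) (fun z hz => ?_)
    (Metric.mem_closedBall_self (norm_nonneg _)) (by simp)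
  · have e : f (x + y) - f x - fderiv ℝ f x y - (1 / 2 : ℝ) * b y y =
        f (x + y) - 1 / 2 * b y y - (f (x + 0) - 1 / 2 * b 0 0) - (fderiv ℝ f x) (y - 0) := by
      simp
      ring
    rw [e]
    refine h.trans_eq ?_
    rw [sub_zero]
    ring
  · have h4 := norm_taylor_two_le (hf1.differentiable (by norm_num))
      (hf2.differentiable (by norm_num)) hK0 hK x z
    have e : fderiv ℝ f (x + z) - b z - fderiv ℝ f x =
        fderiv ℝ f (x + z) - fderiv ℝ f x - b z := by abel
    rw [e]
    refine h4.trans (mul_le_mul_of_nonneg_left ?_ hK0)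
    have : ‖z‖ ≤ ‖y‖ := by simpa using hz
    gcongr

end Taylor

/-! ### Lindeberg's exchange method -/

section ThirdMoments

variable {V : Type*} [NormedAddCommGroup V] [MeasurableSpace V]

lemma integrable_norm_cube {p : Measure V} (hp : MemLp (fun y => y) 3 p) :
    Integrable (fun y : V => ‖y‖ ^ 3) p :=
  MemLp.integrable_norm_pow (p := 3) (by exact_mod_cast hp) (by norm_num)

lemma memLp_conv [BorelSpace V] [SecondCountableTopology V]
    {p q : Measure V} [IsProbabilityMeasure p] [IsProbabilityMeasure q]
    (hp : MemLp (fun y => y) 3 p) (hq : MemLp (fun y => y) 3 q) :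
    MemLp (fun y => y) 3 (p ∗ q) := by
  rw [Measure.conv, memLp_map_measure_iff (by fun_prop) (by fun_prop)]
  exact (hp.comp_measurePreserving measurePreserving_fst).add
    (hq.comp_measurePreserving measurePreserving_snd)

end ThirdMoments

section Lindeberg

variable {V : Type*} [NormedAddCommGroup V] [NormedSpace ℝ V]

/-- A continuous function with quadratic Taylor approximations everywhere, with a uniform cubic
bound on the remainder. -/
structure CubicTaylor (K : ℝ) (H : V → ℝ) : Prop where
  continuous : Continuous H
  taylor : ∀ z, ∃ (φ : V →L[ℝ] ℝ) (b : V →L[ℝ] V →L[ℝ] ℝ),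
    ∀ y, |H (z + y) - H z - φ y - b y y| ≤ K * ‖y‖ ^ 3

lemma CubicTaylor.translate {K : ℝ} {H : V → ℝ} (hH : CubicTaylor K H) (x : V) :
    CubicTaylor K fun y => H (x + y) where
  continuous := hH.continuous.comp (continuous_const_add x)
  taylor z := by simpa only [← add_assoc] using hH.taylor (x + z)

lemma CubicTaylor.smul {K : ℝ} {H : V → ℝ} (hH : CubicTaylor K H) {r : ℝ} (hr : 0 ≤ r) :
    CubicTaylor (K * r ^ 3) fun y => H (r • y) where
  continuous := hH.continuous.comp (continuous_const_smul r)
  taylor z := by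
    obtain ⟨φ, b, h⟩ := hH.taylor (r • z)
    refine ⟨r • φ, (r * r) • b, fun y => ?_⟩
    have := h (r • y)
    simp only [norm_smul, Real.norm_of_nonneg hr, map_smul, smul_apply,
      smul_eq_mul] at this ⊢
    rw [smul_add, mul_assoc r r]
    refine this.trans_eq ?_
    ring

variable [MeasurableSpace V] [BorelSpace V] [SecondCountableTopology V]

lemma integrable_bilin {p : Measure V} [IsProbabilityMeasure p] (hp : MemLp (fun y => y) 3 p)
    (b : V →L[ℝ] V →L[ℝ] ℝ) : Integrable (fun y => b y y) p := by
  have h2 : Integrable (fun y : V => ‖y‖ ^ 2) p :=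
    (hp.mono_exponent (p := ((2 : ℕ) : ℝ≥0∞)) (by norm_num)).integrable_norm_pow (by norm_num)
  refine (h2.const_mul ‖b‖).mono' (by fun_prop) (Eventually.of_forall fun y => ?_)
  refine (b.le_opNorm₂ y y).trans_eq ?_
  ring

lemma CubicTaylor.integrable {K : ℝ} {H : V → ℝ} (hH : CubicTaylor K H) {p : Measure V}
    [IsProbabilityMeasure p] (hp : MemLp (fun y => y) 3 p) : Integrable H p := by
  obtain ⟨φ, b, h⟩ := hH.taylor 0
  simp only [zero_add] at h
  have h1 : Integrable (fun y => φ y) p := φ.integrable_comp (hp.integrable (by norm_num))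
  have h2 := integrable_bilin hp b
  have h3 : Integrable (fun y => H y - H 0 - φ y - b y y) p :=
    ((integrable_norm_cube hp).const_mul K).mono'
      (by have := hH.continuous; fun_prop) (Eventually.of_forall h)
  have h4 := ((h3.add h2).add h1).add (integrable_const (H 0))
  refine h4.congr (Eventually.of_forall fun y => ?_)
  simp only [Pi.add_apply]
  ring

/-- Two probability measures have the same first and second moments. -/
structure MomentMatch (p q : Measure V) : Prop where
  first : ∀ φ : V →L[ℝ] ℝ, ∫ y, φ y ∂p = ∫ y, φ y ∂q
  second : ∀ b : V →L[ℝ] V →L[ℝ] ℝ, ∫ y, b y y ∂p = ∫ y, b y y ∂q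

/-- The quadratic Taylor polynomials have the same mean under both laws; only the cubic remainders
are left. -/
lemma CubicTaylor.abs_integral_sub_le {K : ℝ} {H : V → ℝ} (hH : CubicTaylor K H)
    {p q : Measure V} [IsProbabilityMeasure p] [IsProbabilityMeasure q]
    (hp : MemLp (fun y => y) 3 p) (hq : MemLp (fun y => y) 3 q) (hpq : MomentMatch p q) :
    |∫ y, H y ∂p - ∫ y, H y ∂q| ≤ K * (∫ y, ‖y‖ ^ 3 ∂p + ∫ y, ‖y‖ ^ 3 ∂q) := by
  obtain ⟨φ, b, h⟩ := hH.taylor 0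
  simp only [zero_add] at h
  have key : ∀ ν : Measure V, IsProbabilityMeasure ν → MemLp (fun y => y) 3 ν →
      |∫ y, H y ∂ν - H 0 - ∫ y, φ y ∂ν - ∫ y, b y y ∂ν| ≤ K * ∫ y, ‖y‖ ^ 3 ∂ν := by
    intro ν _ hν
    have h1 : Integrable (fun y => φ y) ν := φ.integrable_comp (hν.integrable (by norm_num))
    have h2 := integrable_bilin hν b
    have h3 := hH.integrable hν
    have e : ∫ y, H y ∂ν - H 0 - ∫ y, φ y ∂ν - ∫ y, b y y ∂ν =
        ∫ y, (H y - H 0 - φ y - b y y) ∂ν := by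
      have h4 : Integrable (fun y => H y - H 0) ν := h3.sub (integrable_const _)
      have h5 : Integrable (fun y => H y - H 0 - φ y) ν := h4.sub h1
      rw [integral_sub h5 h2, integral_sub h4 h1, integral_sub h3 (integrable_const _)]
      simp
    rw [e, ← integral_const_mul]
    exact norm_integral_le_of_norm_le (f := fun y => H y - H 0 - φ y - b y y)
      ((integrable_norm_cube hν).const_mul K) (Eventually.of_forall h)
  have h1 := key p inferInstance hp
  have h2 := key q inferInstance hq
  rw [hpq.first, hpq.second] at h1
  rw [mul_add]
  rw [abs_le] at h1 h2 ⊢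
  constructor <;> linarith [h1.1, h1.2, h2.1, h2.2]

/-- Exchanging the summands of a sum of independent random vectors one by one. -/
lemma CubicTaylor.abs_integral_iterate_sub_le {p q : Measure V} [IsProbabilityMeasure p]
    [IsProbabilityMeasure q] (hp : MemLp (fun y => y) 3 p) (hq : MemLp (fun y => y) 3 q)
    (hpq : MomentMatch p q) {P Q : ℕ → Measure V} (hP : ∀ n, IsProbabilityMeasure (P n))
    (hQ : ∀ n, IsProbabilityMeasure (Q n)) (hP3 : ∀ n, MemLp (fun y => y) 3 (P n))
    (hQ3 : ∀ n, MemLp (fun y => y) 3 (Q n)) (h0 : P 0 = Q 0) (hPs : ∀ n, P (n + 1) = P n ∗ p)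
    (hQs : ∀ n, Q (n + 1) = Q n ∗ q) (n : ℕ) {K : ℝ} {H : V → ℝ} (hH : CubicTaylor K H) :
    |∫ y, H y ∂(P n) - ∫ y, H y ∂(Q n)| ≤
      n * (K * (∫ y, ‖y‖ ^ 3 ∂p + ∫ y, ‖y‖ ^ 3 ∂q)) := by
  induction n generalizing H with
  | zero => simp [h0]
  | succ n ih =>
    have hint : ∀ ν : Measure V, IsProbabilityMeasure ν → MemLp (fun y => y) 3 ν →
        ∀ ρ : Measure V, IsProbabilityMeasure ρ → MemLp (fun y => y) 3 ρ →
        ∫ y, H y ∂(ν ∗ ρ) = ∫ x, ∫ y, H (x + y) ∂ρ ∂ν ∧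
          Integrable (fun x => ∫ y, H (x + y) ∂ρ) ν := by
      intro ν _ hν ρ _ hρ
      have h1 := hH.integrable (memLp_conv hν hρ)
      refine ⟨integral_conv h1, ?_⟩
      have h2 : Integrable (fun z : V × V => H (z.1 + z.2)) (ν.prod ρ) := by
        rw [Measure.conv, integrable_map_measure h1.1 (by fun_prop)] at h1
        exact h1
      exact h2.integral_prod_left
    have hPn := hP n
    have hQn := hQ n
    have hle : ∀ ν : Measure V, IsProbabilityMeasure ν → ∀ (g : V → ℝ) (c : ℝ),
        (∀ x, |g x| ≤ c) → |∫ x, g x ∂ν| ≤ c := by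
      intro ν _ g c hg
      simpa using norm_integral_le_of_norm_le_const (μ := ν) (f := g) (Eventually.of_forall hg)
    -- replace the last summand, the other ones being distributed according to `P`
    have h1 : |∫ y, H y ∂(P n ∗ p) - ∫ y, H y ∂(P n ∗ q)| ≤
        K * (∫ y, ‖y‖ ^ 3 ∂p + ∫ y, ‖y‖ ^ 3 ∂q) := by
      obtain ⟨e1, i1⟩ := hint (P n) hPn (hP3 n) p inferInstance hp
      obtain ⟨e2, i2⟩ := hint (P n) hPn (hP3 n) q inferInstance hq
      rw [e1, e2, ← integral_sub i1 i2]
      exact hle _ hPn _ _ fun x => (hH.translate x).abs_integral_sub_le hp hq hpq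
    -- replace the other summands, the last one being distributed according to `q`
    have h2 : |∫ y, H y ∂(P n ∗ q) - ∫ y, H y ∂(Q n ∗ q)| ≤
        n * (K * (∫ y, ‖y‖ ^ 3 ∂p + ∫ y, ‖y‖ ^ 3 ∂q)) := by
      rw [Measure.conv_comm (P n), Measure.conv_comm (Q n)]
      obtain ⟨e1, i1⟩ := hint q inferInstance hq (P n) hPn (hP3 n)
      obtain ⟨e2, i2⟩ := hint q inferInstance hq (Q n) hQn (hQ3 n)
      rw [e1, e2, ← integral_sub i1 i2]
      exact hle _ inferInstance _ _ fun x => ih (hH.translate x)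
    rw [hPs, hQs]
    refine (abs_sub_le _ _ _).trans ((add_le_add h1 h2).trans_eq ?_)
    push_cast
    ring

end Lindeberg

section TestFunctions

lemma norm_fderiv_fderiv_le {ℓ : ℕ} {h : (Fin ℓ → ℝ) → ℝ} (hh : h ∈ testFunctions ℓ)
    (x : Fin ℓ → ℝ) : ‖fderiv ℝ (fderiv ℝ h) x‖ ≤ (ℓ : ℝ) ^ 2 := by
  rw [← norm_iteratedFDeriv_one, norm_iteratedFDeriv_fderiv]
  refine norm_multilinear_le _ fun r => ?_
  have : (fun k => Pi.single (r k) 1 : Fin 2 → Fin ℓ → ℝ) =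
      ![Pi.single (r 0) 1, Pi.single (r 1) 1] := by
    funext k
    fin_cases k <;> rfl
  rw [this]
  exact hh.2.1 _ _ x

set_option maxSynthPendingDepth 3 in
lemma cubicTaylor_of_mem_testFunctions {ℓ : ℕ} {h : (Fin ℓ → ℝ) → ℝ} (hh : h ∈ testFunctions ℓ) :
    CubicTaylor ((ℓ : ℝ) ^ 3) h where
  continuous := hh.1.continuous
  taylor z := by
    refine ⟨fderiv ℝ h z, (1 / 2 : ℝ) • fderiv ℝ (fderiv ℝ h) z, fun y => ?_⟩
    refine norm_taylor_three_le hh.1 (by positivity) (fun x => ?_) z y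
    rw [← norm_iteratedFDeriv_one, norm_iteratedFDeriv_fderiv, norm_iteratedFDeriv_fderiv]
    refine norm_multilinear_le _ fun r => ?_
    have : (fun k => Pi.single (r k) 1 : Fin 3 → Fin ℓ → ℝ) =
        ![Pi.single (r 0) 1, Pi.single (r 1) 1, Pi.single (r 2) 1] := by
      funext k
      fin_cases k <;> rfl
    rw [this]
    exact hh.2.2 _ _ _ x

/-- A test function changes by a linear functional of a small perturbation, up to terms that are
quadratic in the perturbation and its base point. -/
lemma abs_testFunction_sub_le {ℓ : ℕ} {h : (Fin ℓ → ℝ) → ℝ} (hh : h ∈ testFunctions ℓ)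
    (x y : Fin ℓ → ℝ) :
    |h (x + y) - h x - fderiv ℝ h 0 y| ≤ (ℓ : ℝ) ^ 2 * (‖y‖ ^ 2 + ‖x‖ * ‖y‖) := by
  have hd : ContDiff ℝ 2 (fderiv ℝ h) := hh.1.fderiv_right (by norm_num)
  have h1 := norm_taylor_two_le (hh.1.differentiable (by norm_num))
    (hd.differentiable (by norm_num)) (by positivity) (norm_fderiv_fderiv_le hh) x y
  have h2 := norm_fderiv_add_sub_le (hd.differentiable (by norm_num)) (norm_fderiv_fderiv_le hh) 0 x
  have h3 : |(fderiv ℝ h x - fderiv ℝ h 0) y| ≤ (ℓ : ℝ) ^ 2 * ‖x‖ * ‖y‖ := by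
    rw [zero_add] at h2
    exact ((fderiv ℝ h x - fderiv ℝ h 0).le_opNorm y).trans
      (mul_le_mul_of_nonneg_right h2 (norm_nonneg _))
  have e : h (x + y) - h x - fderiv ℝ h 0 y =
      (h (x + y) - h x - fderiv ℝ h x y) + (fderiv ℝ h x - fderiv ℝ h 0) y := by
    simp
  rw [e]
  refine (abs_add_le _ _).trans ((add_le_add h1 h3).trans_eq ?_)
  ring

end TestFunctions

/-! ### Normal approximation of sums over the points of a Poisson process -/

section SumVal

variable {X : Type*} [MeasurableSpace X]

lemma memLp_sumVal (μ : Measure X) [IsFiniteMeasure μ] {g : X → ℝ} (hg : Measurable g)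
    (h2 : MemLp g 2 μ) : MemLp (sumVal g) 2 (poissonConf μ) := by
  rw [sumVal_eq_uStat]
  refine memLp_uStat μ (hg.comp (measurable_pi_apply 0)) ?_
  rw [← lintegral_sqNorm_slice μ (f := fun z : Fin 1 → X => g (z 0))
    (hg.comp (measurable_pi_apply 0))]
  simpa only [sqNorm, lintegral_pi_zero, slice, Fin.cons_zero] using
    sqNorm_ne_top h2

lemma integral_sumVal (μ : Measure X) [IsFiniteMeasure μ] {g : X → ℝ} (hg : Measurable g)
    (h1 : Integrable g μ) : ∫ c, sumVal g c ∂(poissonConf μ) = ∫ x, g x ∂μ := by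
  have hu : Measurable (Function.uncurry fun (y : X) (_ : Conf X) => g y) :=
    hg.comp measurable_fst
  have := integral_sumPts μ hu (h1.comp_fst _)
  refine this.trans ?_
  rw [integral_fun_fst]
  simp

lemma integral_sumVal_sub_sq (μ : Measure X) [IsFiniteMeasure μ] {g : X → ℝ} (hg : Measurable g)
    (h2 : MemLp g 2 μ) :
    ∫ c, (sumVal g c - ∫ x, g x ∂μ) ^ 2 ∂(poissonConf μ) = ∫ x, g x ^ 2 ∂μ := by
  have hu : Measurable (Function.uncurry fun (y : X) (_ : Conf X) => g y) :=
    hg.comp measurable_fst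
  have hu2 : MemLp (Function.uncurry fun (y : X) (_ : Conf X) => g y) 2
      (μ.prod (poissonConf μ)) := h2.comp_fst _
  have h := integral_sq_eq_of_hasDiff μ hu ((memLp_sumVal μ hg h2).sub (memLp_const _))
    ((measurable_sumVal hg).sub_const _) hu hu2 hu2 ((hasDiff_sumVal g).sub_const (∫ x, g x ∂μ))
    (Eventually.of_forall fun c => rfl)
  refine h.trans ?_
  simp only [← pow_two]
  rw [integral_fun_fst (f := fun x => g x ^ 2)]
  simp

lemma lintegral_sumVal_pow_three_le (μ : Measure X) [IsFiniteMeasure μ] {g : X → ℝ}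
    (hg : Measurable g) :
    ∫⁻ c, ‖sumVal g c‖ₑ ^ 3 ∂(poissonConf μ) ≤
      (μ Set.univ + 3) ^ 2 * ∫⁻ x, ‖g x‖ₑ ^ 3 ∂μ := by
  have hm : Measurable fun z : Fin 1 → X => ‖g (z 0)‖ₑ ^ 3 :=
    (hg.comp (measurable_pi_apply 0)).enorm.pow_const 3
  have h := lintegral_uStat_pow_le μ (hg.comp (measurable_pi_apply (0 : Fin 1))) 2
  rw [sumVal_eq_uStat]
  refine h.trans_eq ?_
  have e : ∫⁻ z : Fin 1 → X, ‖g (z 0)‖ₑ ^ 3 ∂(Measure.pi fun _ : Fin 1 => μ) =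
      ∫⁻ x, ‖g x‖ₑ ^ 3 ∂μ := by
    rw [← lintegral_slice μ hm]
    simp only [lintegral_pi_zero, slice, Fin.cons_zero]
  refine congrArg₂ _ ?_ e
  push_cast
  rw [add_assoc]
  norm_num

end SumVal

section VectorMoments

lemma memLp_three_of_lintegral {α V : Type*} [MeasurableSpace α] [NormedAddCommGroup V]
    {F : α → V} {ρ : Measure α} (hF : AEStronglyMeasurable F ρ)
    (h : ∫⁻ x, ‖F x‖ₑ ^ 3 ∂ρ ≠ ∞) : MemLp F 3 ρ := by
  refine ⟨hF, ?_⟩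
  rw [eLpNorm_lt_top_iff_lintegral_rpow_enorm_lt_top (by norm_num) (by norm_num)]
  have : ∀ x, ‖F x‖ₑ ^ (3 : ℝ≥0∞).toReal = ‖F x‖ₑ ^ 3 := fun x => by
    rw [← ENNReal.rpow_natCast]
    norm_num
  simp_rw [this]
  exact h.lt_top

lemma integral_norm_pow_three {α V : Type*} [MeasurableSpace α] [NormedAddCommGroup V]
    {F : α → V} {ρ : Measure α} (hF : AEStronglyMeasurable F ρ) :
    ∫ x, ‖F x‖ ^ 3 ∂ρ = (∫⁻ x, ‖F x‖ₑ ^ 3 ∂ρ).toReal := by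
  rw [integral_eq_lintegral_of_nonneg_ae (f := fun x => ‖F x‖ ^ 3)
    (Eventually.of_forall fun x => by positivity) (hF.norm.pow 3)]
  congr 1
  refine lintegral_congr fun x => ?_
  rw [ENNReal.ofReal_pow (norm_nonneg _), ofReal_norm]

lemma clm_pi_apply {ℓ : ℕ} (L : (Fin ℓ → ℝ) →L[ℝ] ℝ) (v : Fin ℓ → ℝ) :
    L v = ∑ i, v i * L (Pi.single i 1) := by
  conv_lhs => rw [pi_eq_sum_univ' v]
  simp only [map_sum, map_smul, smul_eq_mul]

/-- The second moments of a random vector are determined by those of its linear images. -/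
lemma momentMatch_of_sq {ℓ : ℕ} {p q : Measure (Fin ℓ → ℝ)} [IsProbabilityMeasure p]
    [IsProbabilityMeasure q] (hp : MemLp (fun y => y) 3 p) (hq : MemLp (fun y => y) 3 q)
    (h1 : ∀ φ : (Fin ℓ → ℝ) →L[ℝ] ℝ, ∫ y, φ y ∂p = ∫ y, φ y ∂q)
    (h2 : ∀ φ : (Fin ℓ → ℝ) →L[ℝ] ℝ, ∫ y, φ y ^ 2 ∂p = ∫ y, φ y ^ 2 ∂q) : MomentMatch p q := by
  refine ⟨h1, fun b => ?_⟩
  let e : Fin ℓ → (Fin ℓ → ℝ) →L[ℝ] ℝ := fun i => ContinuousLinearMap.proj i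
  have hb : ∀ y, b y y = ∑ i, ∑ j, b (Pi.single i 1) (Pi.single j 1) *
      ((1 / 4 : ℝ) * ((e i + e j) y ^ 2 - (e i - e j) y ^ 2)) := by
    intro y
    have hy : b y = ∑ i, y i • b (Pi.single i 1) := by
      conv_lhs => rw [pi_eq_sum_univ' y]
      simp only [map_sum, map_smul]
    rw [hy, sum_apply]
    refine Finset.sum_congr rfl fun i _ => ?_
    rw [smul_apply, clm_pi_apply, smul_eq_mul, Finset.mul_sum]
    refine Finset.sum_congr rfl fun j _ => ?_
    simp only [add_apply, sub_apply, e,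
      ContinuousLinearMap.proj_apply]
    ring
  have hi : ∀ ν : Measure (Fin ℓ → ℝ), IsProbabilityMeasure ν → MemLp (fun y => y) 3 ν →
      ∀ φ : (Fin ℓ → ℝ) →L[ℝ] ℝ, Integrable (fun y => φ y ^ 2) ν := by
    intro ν _ hν φ
    have h3 : MemLp (fun y => φ y) 3 ν := φ.comp_memLp' hν
    exact (h3.mono_exponent (p := 2) (by norm_num)).integrable_sq
  have key : ∀ ν : Measure (Fin ℓ → ℝ), IsProbabilityMeasure ν → MemLp (fun y => y) 3 ν →
      ∫ y, b y y ∂ν = ∑ i, ∑ j, b (Pi.single i 1) (Pi.single j 1) *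
        ((1 / 4 : ℝ) * (∫ y, (e i + e j) y ^ 2 ∂ν - ∫ y, (e i - e j) y ^ 2 ∂ν)) := by
    intro ν hν hν3
    have h4 : ∀ i j, Integrable (fun y => b (Pi.single i 1) (Pi.single j 1) *
        ((1 / 4 : ℝ) * ((e i + e j) y ^ 2 - (e i - e j) y ^ 2))) ν := fun i j =>
      (((hi ν hν hν3 _).sub (hi ν hν hν3 _)).const_mul _).const_mul _
    simp_rw [hb]
    rw [integral_finsetSum _ fun i _ => integrable_finsetSum _ fun j _ => h4 i j]
    refine Finset.sum_congr rfl fun i _ => ?_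
    rw [integral_finsetSum _ fun j _ => h4 i j]
    refine Finset.sum_congr rfl fun j _ => ?_
    rw [integral_const_mul, integral_const_mul, integral_sub (hi ν hν hν3 _) (hi ν hν hν3 _)]
  rw [key p inferInstance hp, key q inferInstance hq]
  simp_rw [h2]

end VectorMoments

section Laws

variable {X : Type*} [MeasurableSpace X] {ℓ : ℕ}

/-- The vector of centred sums of the values `g i` over the points of a configuration. -/
def sumVec (μ : Measure X) (g : Fin ℓ → X → ℝ) (c : Conf X) : Fin ℓ → ℝ :=
  fun i => sumVal (g i) c - ∫ x, g i x ∂μ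

lemma measurable_sumVec (μ : Measure X) {g : Fin ℓ → X → ℝ} (hg : ∀ i, Measurable (g i)) :
    Measurable (sumVec μ g) :=
  measurable_pi_lambda _ fun i => (measurable_sumVal (hg i)).sub_const _

lemma clm_sumVec (μ : Measure X) {g : Fin ℓ → X → ℝ} (hi : ∀ i, Integrable (g i) μ)
    (L : (Fin ℓ → ℝ) →L[ℝ] ℝ) (c : Conf X) :
    L (sumVec μ g c) = sumVal (fun x => L fun i => g i x) c - ∫ x, L (fun i => g i x) ∂μ := by
  have e : (fun x => L fun i => g i x) = fun x => ∑ i, g i x * L (Pi.single i 1) :=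
    funext fun x => clm_pi_apply L _
  rw [e, clm_pi_apply L (sumVec μ g c)]
  simp only [sumVal_apply, sumVec]
  rw [integral_finsetSum _ fun i _ => (hi i).mul_const _, Finset.sum_comm,
    ← Finset.sum_sub_distrib]
  refine Finset.sum_congr rfl fun i _ => ?_
  rw [integral_mul_const, sub_mul, Finset.sum_mul]

/-- The law of the vector of centred sums under a Poisson configuration of intensity `s • μ`. -/
def sumLaw (μ : Measure X) (g : Fin ℓ → X → ℝ) (s : ℝ≥0) : Measure (Fin ℓ → ℝ) :=
  (poissonConf (s • μ)).map (sumVec (s • μ) g)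

variable (μ : Measure X) [IsFiniteMeasure μ] {g : Fin ℓ → X → ℝ}

lemma isProbabilityMeasure_sumLaw (hg : ∀ i, Measurable (g i)) (s : ℝ≥0) :
    IsProbabilityMeasure (sumLaw μ g s) :=
  Measure.isProbabilityMeasure_map (measurable_sumVec _ hg).aemeasurable

/-- The exponent is linear in `s`: the laws `sumLaw μ g s` form a convolution semigroup. -/
lemma charFunDual_sumLaw (hg : ∀ i, Measurable (g i)) (hi : ∀ i, Integrable (g i) μ) (s : ℝ≥0)
    (L : (Fin ℓ → ℝ) →L[ℝ] ℝ) :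
    charFunDual (sumLaw μ g s) L = Complex.exp (s *
      (∫ x, (Complex.exp (((L fun i => g i x : ℝ) : ℂ) * Complex.I) - 1) ∂μ -
        ((∫ x, L (fun i => g i x) ∂μ : ℝ) : ℂ) * Complex.I)) := by
  have hφ : Measurable fun x => L fun i => g i x :=
    L.measurable.comp (measurable_pi_lambda _ hg)
  have his : ∀ i, Integrable (g i) (s • μ) := fun i => (hi i).smul_measure_nnreal
  rw [charFunDual_apply, sumLaw, integral_map (measurable_sumVec _ hg).aemeasurable (by fun_prop)]
  have h1 : ∀ c, Complex.exp ((L (sumVec (s • μ) g c) : ℂ) * Complex.I) =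
      Complex.exp ((sumVal (fun x => L fun i => g i x) c : ℂ) * Complex.I) *
        Complex.exp (-(((∫ x, L (fun i => g i x) ∂(s • μ) : ℝ) : ℂ) * Complex.I)) := by
    intro c
    rw [clm_sumVec _ his, ← Complex.exp_add]
    congr 1
    push_cast
    ring
  simp_rw [h1]
  rw [integral_mul_const, integral_cexp_sumVal _ hφ, ← Complex.exp_add,
    integral_smul_nnreal_measure, integral_smul_nnreal_measure]
  congr 1
  simp only [NNReal.smul_def, Complex.real_smul, smul_eq_mul]
  push_cast
  ring

lemma sumLaw_add (hg : ∀ i, Measurable (g i)) (hi : ∀ i, Integrable (g i) μ) (s t : ℝ≥0) :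
    sumLaw μ g (s + t) = sumLaw μ g s ∗ sumLaw μ g t := by
  have h1 := isProbabilityMeasure_sumLaw μ hg s
  have h2 := isProbabilityMeasure_sumLaw μ hg t
  have h3 := isProbabilityMeasure_sumLaw μ hg (s + t)
  refine Measure.ext_of_charFunDual (funext fun L => ?_)
  rw [charFunDual_conv, charFunDual_sumLaw μ hg hi, charFunDual_sumLaw μ hg hi,
    charFunDual_sumLaw μ hg hi, ← Complex.exp_add]
  congr 1
  push_cast
  ring

lemma sumLaw_zero (hg : ∀ i, Measurable (g i)) (hi : ∀ i, Integrable (g i) μ) :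
    sumLaw μ g 0 = Measure.dirac 0 := by
  have h1 := isProbabilityMeasure_sumLaw μ hg 0
  refine Measure.ext_of_charFunDual (funext fun L => ?_)
  rw [charFunDual_sumLaw μ hg hi, charFunDual_dirac]
  simp

/-- The third absolute moments of the centred sums are bounded for bounded intensity. -/
lemma exists_lintegral_sumLaw_le (hg : ∀ i, Measurable (g i))
    (h3 : ∀ i, ∫⁻ x, ‖g i x‖ₑ ^ 3 ∂μ ≠ ∞) (S : ℝ≥0) :
    ∃ C : ℝ≥0, ∀ s ≤ S, ∫⁻ y, ‖y‖ₑ ^ 3 ∂(sumLaw μ g s) ≤ C := by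
  set D : ℝ≥0∞ := (ℓ : ℝ≥0∞) ^ 2 * ∑ i, (2 : ℝ≥0∞) ^ 2 *
    (((S • μ) Set.univ + 3) ^ 2 * ∫⁻ x, ‖g i x‖ₑ ^ 3 ∂(S • μ) +
      (S • μ) Set.univ ^ 2 * ∫⁻ x, ‖g i x‖ₑ ^ 3 ∂(S • μ)) with hD
  have hDtop : D ≠ ∞ := by
    have h4 : ∀ i, ∫⁻ x, ‖g i x‖ₑ ^ 3 ∂(S • μ) ≠ ∞ := fun i => by
      rw [lintegral_smul_measure]
      exact ENNReal.mul_ne_top ENNReal.coe_ne_top (h3 i)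
    have h5 : (S • μ) Set.univ ≠ ∞ := measure_ne_top _ _
    refine ENNReal.mul_ne_top (by finiteness) (ENNReal.sum_ne_top.2 fun i _ => ?_)
    have := h4 i
    finiteness
  refine ⟨D.toNNReal, fun s hs => ?_⟩
  rw [ENNReal.coe_toNNReal hDtop, sumLaw, lintegral_map (by fun_prop) (measurable_sumVec _ hg)]
  have hle : s • μ ≤ S • μ := by
    refine Measure.le_iff.2 fun A _ => ?_
    rw [Measure.smul_apply, Measure.smul_apply]
    gcongr
  have hpt : ∀ c, ‖sumVec (s • μ) g c‖ₑ ^ 3 ≤ (ℓ : ℝ≥0∞) ^ 2 * ∑ i, (2 : ℝ≥0∞) ^ 2 *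
      (‖sumVal (g i) c‖ₑ ^ 3 + ‖∫ x, g i x ∂(s • μ)‖ₑ ^ 3) := by
    intro c
    have h4 : ‖sumVec (s • μ) g c‖ₑ ≤ ∑ i, ‖sumVec (s • μ) g c i‖ₑ := by
      simp_rw [← ofReal_norm]
      rw [← ENNReal.ofReal_sum_of_nonneg fun _ _ => norm_nonneg _]
      refine ENNReal.ofReal_le_ofReal
        ((pi_norm_le_iff_of_nonneg (Finset.sum_nonneg fun _ _ => norm_nonneg _)).2 fun i => ?_)
      exact Finset.single_le_sum (f := fun i => ‖sumVec (s • μ) g c i‖)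
        (fun _ _ => norm_nonneg _) (Finset.mem_univ i)
    have h5 := enorm_pow_sum_le 2 Finset.univ fun i => ‖sumVec (s • μ) g c i‖ₑ
    rw [Finset.card_univ, Fintype.card_fin] at h5
    refine (pow_le_pow_left' h4 3).trans (h5.trans ?_)
    gcongr with i
    have h6 := enorm_pow_sum_le 2 (Finset.univ : Finset (Fin 2))
      ![‖sumVal (g i) c‖ₑ, ‖∫ x, g i x ∂(s • μ)‖ₑ]
    simp only [Fin.sum_univ_two, Matrix.cons_val_zero, Matrix.cons_val_one, Finset.card_univ,
      Fintype.card_fin] at h6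
    refine (pow_le_pow_left' ?_ 3).trans h6
    exact enorm_sub_le
  refine (lintegral_mono hpt).trans ?_
  have hm : ∀ i, Measurable fun c => ‖sumVal (g i) c‖ₑ ^ 3 := fun i =>
    (measurable_sumVal (hg i)).enorm.pow_const 3
  rw [lintegral_const_mul _ (Finset.measurable_sum _ fun i _ =>
    ((hm i).add_const _).const_mul _), lintegral_finsetSum _ fun i _ =>
    ((hm i).add_const _).const_mul _]
  rw [hD]
  gcongr with i
  rw [lintegral_const_mul _ ((hm i).add_const _), lintegral_add_left (hm i), lintegral_const,
    measure_univ, mul_one]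
  gcongr
  · refine (lintegral_sumVal_pow_three_le (s • μ) (hg i)).trans ?_
    gcongr
  · refine (enorm_integral_pow_le 2 (hg i).aestronglyMeasurable).trans ?_
    gcongr

end Laws

section GaussianLaws

variable {Ω : Type*} [MeasurableSpace Ω] {ℓ : ℕ}

/-- The law of `√s • Y`. -/
def scaledLaw (P : Measure Ω) (Y : Ω → Fin ℓ → ℝ) (s : ℝ≥0) : Measure (Fin ℓ → ℝ) :=
  P.map fun ω => √(s : ℝ) • Y ω

variable {P : Measure Ω} {Y : Ω → Fin ℓ → ℝ}

lemma aemeasurable_smul_gaussian (hY : HasGaussianLaw Y P) (r : ℝ) :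
    AEMeasurable (fun ω => r • Y ω) P :=
  hY.aemeasurable.const_smul r

lemma isProbabilityMeasure_scaledLaw [IsProbabilityMeasure P] (hY : HasGaussianLaw Y P) (s : ℝ≥0) :
    IsProbabilityMeasure (scaledLaw P Y s) :=
  Measure.isProbabilityMeasure_map (aemeasurable_smul_gaussian hY _)

lemma charFunDual_scaledLaw (hY : HasGaussianLaw Y P)
    (h0 : ∀ L : (Fin ℓ → ℝ) →L[ℝ] ℝ, ∫ ω, L (Y ω) ∂P = 0) (s : ℝ≥0) (L : (Fin ℓ → ℝ) →L[ℝ] ℝ) :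
    charFunDual (scaledLaw P Y s) L =
      Complex.exp (s * (-(Var[fun ω => L (Y ω); P] : ℂ) / 2)) := by
  rw [scaledLaw, (hY.fun_smul √(s : ℝ)).charFunDual_map_eq_fun]
  simp only [map_smul, smul_eq_mul]
  rw [integral_const_mul, h0, variance_const_mul, Real.sq_sqrt s.coe_nonneg]
  congr 1
  push_cast
  ring

lemma scaledLaw_add [IsProbabilityMeasure P] (hY : HasGaussianLaw Y P)
    (h0 : ∀ L : (Fin ℓ → ℝ) →L[ℝ] ℝ, ∫ ω, L (Y ω) ∂P = 0) (s t : ℝ≥0) :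
    scaledLaw P Y (s + t) = scaledLaw P Y s ∗ scaledLaw P Y t := by
  have h1 := isProbabilityMeasure_scaledLaw hY s
  have h2 := isProbabilityMeasure_scaledLaw hY t
  have h3 := isProbabilityMeasure_scaledLaw hY (s + t)
  refine Measure.ext_of_charFunDual (funext fun L => ?_)
  rw [charFunDual_conv, charFunDual_scaledLaw hY h0, charFunDual_scaledLaw hY h0,
    charFunDual_scaledLaw hY h0, ← Complex.exp_add]
  congr 1
  push_cast
  ring

lemma scaledLaw_zero [IsProbabilityMeasure P] : scaledLaw P Y 0 = Measure.dirac 0 := by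
  simp [scaledLaw, Measure.map_const]

lemma memLp_scaledLaw (hY : HasGaussianLaw Y P) (s : ℝ≥0) :
    MemLp (fun y => y) 3 (scaledLaw P Y s) := by
  rw [scaledLaw, memLp_map_measure_iff (by fun_prop) (aemeasurable_smul_gaussian hY _)]
  exact (hY.fun_smul _).memLp (by norm_num)

lemma integral_clm_sq_eq (hY : HasGaussianLaw Y P) {X : Type*} [MeasurableSpace X]
    {μ : Measure X} {g : Fin ℓ → X → ℝ} (h0 : ∀ i, ∫ ω, Y ω i ∂P = 0)
    (hg : ∀ i, MemLp (g i) 2 μ)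
    (hcov : ∀ i j, covariance (fun ω => Y ω i) (fun ω => Y ω j) P = ∫ x, g i x * g j x ∂μ)
    (L : (Fin ℓ → ℝ) →L[ℝ] ℝ) : ∫ ω, L (Y ω) ^ 2 ∂P = ∫ x, L (fun i => g i x) ^ 2 ∂μ := by
  have hY2 : ∀ i, MemLp (fun ω => Y ω i) 2 P := fun i => memLp_pi_iff.1 hY.memLp_two i
  have e : ∀ v : Fin ℓ → ℝ, L v ^ 2 =
      ∑ i, ∑ j, (L (Pi.single i 1) * L (Pi.single j 1)) * (v i * v j) := by
    intro v
    rw [clm_pi_apply, pow_two, Finset.sum_mul_sum]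
    refine Finset.sum_congr rfl fun i _ => Finset.sum_congr rfl fun j _ => ?_
    ring
  have hYi : ∀ i j, Integrable (fun ω => (L (Pi.single i 1) * L (Pi.single j 1)) *
      (Y ω i * Y ω j)) P := fun i j => ((hY2 i).integrable_mul (hY2 j)).const_mul _
  have hgi : ∀ i j, Integrable (fun x => (L (Pi.single i 1) * L (Pi.single j 1)) *
      (g i x * g j x)) μ := fun i j => ((hg i).integrable_mul (hg j)).const_mul _
  simp_rw [e]
  rw [integral_finsetSum _ fun i _ => integrable_finsetSum _ fun j _ => hYi i j,
    integral_finsetSum _ fun i _ => integrable_finsetSum _ fun j _ => hgi i j]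
  refine Finset.sum_congr rfl fun i _ => ?_
  rw [integral_finsetSum _ fun j _ => hYi i j, integral_finsetSum _ fun j _ => hgi i j]
  refine Finset.sum_congr rfl fun j _ => ?_
  rw [integral_const_mul, integral_const_mul, ← hcov, covariance, h0, h0]
  simp

end GaussianLaws

section NormalApproximation

variable {X Ω : Type*} [MeasurableSpace X] [MeasurableSpace Ω] {ℓ : ℕ}

/-- Normal approximation of sums over the points of a Poisson process of intensity `t • μ`, at the
rate `t^{-1/2}`: the sum has the law of a sum of about `t` independent summands, which are exchanged
for Gaussian summands. -/
lemma exists_abs_sumVec_sub_le (μ : Measure X) [IsFiniteMeasure μ] {g : Fin ℓ → X → ℝ}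
    (hg : ∀ i, Measurable (g i)) (h3 : ∀ i, ∫⁻ x, ‖g i x‖ₑ ^ 3 ∂μ ≠ ∞) {P : Measure Ω}
    [IsProbabilityMeasure P] {Y : Ω → Fin ℓ → ℝ} (hY : HasGaussianLaw Y P)
    (h0 : ∀ i, ∫ ω, Y ω i ∂P = 0)
    (hcov : ∀ i j, covariance (fun ω => Y ω i) (fun ω => Y ω j) P = ∫ x, g i x * g j x ∂μ) :
    ∃ C : ℝ, ∀ t : ℝ≥0, 1 ≤ t → ∀ h ∈ testFunctions ℓ,
      |∫ c, h ((√(t : ℝ))⁻¹ • sumVec (t • μ) g c) ∂(poissonConf (t • μ)) - ∫ ω, h (Y ω) ∂P| ≤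
        C / √(t : ℝ) := by
  have hg3 : ∀ i, MemLp (g i) 3 μ := fun i =>
    memLp_three_of_lintegral (hg i).aestronglyMeasurable (h3 i)
  have hg2 : ∀ i, MemLp (g i) 2 μ := fun i => (hg3 i).mono_exponent (by norm_num)
  have hg1 : ∀ i, Integrable (g i) μ := fun i => (hg2 i).integrable (by norm_num)
  have hY1 : ∀ i, Integrable (fun ω => Y ω i) P := fun i =>
    (memLp_pi_iff.1 hY.memLp_two i).integrable (by norm_num)
  have hL0 : ∀ L : (Fin ℓ → ℝ) →L[ℝ] ℝ, ∫ ω, L (Y ω) ∂P = 0 := by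
    intro L
    rw [L.integral_comp_comm hY.integrable]
    have : ∫ ω, Y ω ∂P = 0 := by
      funext i
      rw [eval_integral hY1, h0]
      rfl
    rw [this, map_zero]
  have hp := isProbabilityMeasure_sumLaw μ hg
  have hq := fun s => isProbabilityMeasure_scaledLaw (s := s) hY
  have hp3 : ∀ s, MemLp (fun y => y) 3 (sumLaw μ g s) := by
    intro s
    obtain ⟨C, hC⟩ := exists_lintegral_sumLaw_le μ hg h3 s
    exact memLp_three_of_lintegral (by fun_prop) ((hC s le_rfl).trans_lt ENNReal.coe_lt_top).ne
  have hq3 := fun s => memLp_scaledLaw (s := s) hY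
  -- the covariance assumption says that the two laws have the same second moments
  have hmatch : ∀ s, MomentMatch (sumLaw μ g s) (scaledLaw P Y s) := by
    intro s
    have hg2s : ∀ i, MemLp (g i) 2 (s • μ) := fun i => (hg2 i).smul_measure ENNReal.coe_ne_top
    have hg1s : ∀ i, Integrable (g i) (s • μ) := fun i => (hg1 i).smul_measure_nnreal
    have hLm : ∀ L : (Fin ℓ → ℝ) →L[ℝ] ℝ, Measurable fun x => L fun i => g i x := fun L =>
      L.measurable.comp (measurable_pi_lambda _ hg)
    have hL2 : ∀ L : (Fin ℓ → ℝ) →L[ℝ] ℝ, MemLp (fun x => L fun i => g i x) 2 (s • μ) :=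
      fun L => L.comp_memLp' (memLp_pi_iff.2 hg2s)
    refine momentMatch_of_sq (hp3 s) (hq3 s) (fun L => ?_) fun L => ?_
    · rw [sumLaw, scaledLaw, integral_map (measurable_sumVec _ hg).aemeasurable (by fun_prop),
        integral_map (aemeasurable_smul_gaussian hY _) (by fun_prop)]
      simp only [clm_sumVec _ hg1s, map_smul, smul_eq_mul]
      rw [integral_const_mul, hL0, mul_zero, integral_sub
        ((memLp_sumVal _ (hLm L) (hL2 L)).integrable (by norm_num)) (integrable_const _),
        integral_sumVal _ (hLm L) ((hL2 L).integrable (by norm_num))]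
      simp
    · rw [sumLaw, scaledLaw, integral_map (measurable_sumVec _ hg).aemeasurable (by fun_prop),
        integral_map (aemeasurable_smul_gaussian hY _) (by fun_prop)]
      simp only [clm_sumVec _ hg1s, map_smul, smul_eq_mul, mul_pow]
      rw [integral_sumVal_sub_sq _ (hLm L) (hL2 L), integral_const_mul,
        integral_clm_sq_eq hY h0 hg2 hcov, integral_smul_nnreal_measure, Real.sq_sqrt s.coe_nonneg]
      rfl
  obtain ⟨C, hC⟩ := exists_lintegral_sumLaw_le μ hg h3 1
  set D : ℝ := ∫ ω, ‖Y ω‖ ^ 3 ∂P with hD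
  refine ⟨2 * ((ℓ : ℝ) ^ 3 * (C + D)), fun t ht h hh => ?_⟩
  set n : ℕ := ⌈t⌉₊ with hn
  have ht0 : (0 : ℝ) < t := by exact_mod_cast zero_lt_one.trans_le ht
  have htn : t ≤ n := Nat.le_ceil t
  have hn0 : (n : ℝ≥0) ≠ 0 := (zero_lt_one.trans_le (ht.trans htn)).ne'
  have hn2 : (n : ℝ) ≤ 2 * t := by
    have h1 : (n : ℝ≥0) < t + 1 := Nat.ceil_lt_add_one (zero_le)
    have h2 : (n : ℝ≥0) ≤ 2 * t := h1.le.trans (by rw [two_mul]; gcongr)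
    exact_mod_cast h2
  -- `t = n s` with `s ≤ 1`
  set s : ℝ≥0 := t / n with hs
  have hs1 : s ≤ 1 := div_le_one_of_le₀ htn (zero_le)
  have hns : n * s = t := mul_div_cancel₀ t hn0
  set r : ℝ := (√(t : ℝ))⁻¹ with hr
  have hr0 : 0 ≤ r := by positivity
  have hH : CubicTaylor ((ℓ : ℝ) ^ 3 * r ^ 3) fun y => h (r • y) :=
    (cubicTaylor_of_mem_testFunctions hh).smul hr0
  -- both families are convolution semigroups, so the law at `t` is an `n`-fold convolution
  have hswap := hH.abs_integral_iterate_sub_le (hp3 s) (hq3 s) (hmatch s)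
    (P := fun k => sumLaw μ g (k * s)) (Q := fun k => scaledLaw P Y (k * s))
    (fun k => hp _) (fun k => hq _) (fun k => hp3 _) (fun k => hq3 _)
    (by simp only [Nat.cast_zero, zero_mul]; rw [sumLaw_zero μ hg hg1, scaledLaw_zero])
    (fun k => by rw [Nat.cast_succ, add_mul, one_mul, sumLaw_add μ hg hg1])
    (fun k => by rw [Nat.cast_succ, add_mul, one_mul, scaledLaw_add hY hL0]) n
  have hhm : Measurable h := hh.1.continuous.measurable
  have e1 : ∫ y, h (r • y) ∂(sumLaw μ g (n * s)) =
      ∫ c, h (r • sumVec (t • μ) g c) ∂(poissonConf (t • μ)) := by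
    rw [hns, sumLaw, integral_map (measurable_sumVec _ hg).aemeasurable]
    exact (hhm.comp (measurable_const_smul r)).aestronglyMeasurable
  have e2 : ∫ y, h (r • y) ∂(scaledLaw P Y (n * s)) = ∫ ω, h (Y ω) ∂P := by
    rw [hns, scaledLaw, integral_map (f := fun y => h (r • y)) (aemeasurable_smul_gaussian hY _)
      (hhm.comp (measurable_const_smul r)).aestronglyMeasurable]
    refine integral_congr_ae (Eventually.of_forall fun ω => ?_)
    simp only
    rw [smul_smul, hr, inv_mul_cancel₀ (Real.sqrt_pos.2 ht0).ne', one_smul]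
  simp only [e1, e2] at hswap
  have b1 : ∫ y, ‖y‖ ^ 3 ∂(sumLaw μ g s) ≤ C := by
    rw [integral_norm_pow_three (F := fun y => y) (by fun_prop)]
    exact ENNReal.toReal_le_coe_of_le_coe (hC s hs1)
  have b2 : ∫ y, ‖y‖ ^ 3 ∂(scaledLaw P Y s) ≤ D := by
    rw [scaledLaw, integral_map (aemeasurable_smul_gaussian hY _) (by fun_prop), hD]
    refine integral_mono_of_nonneg (Eventually.of_forall fun ω => by positivity)
      ((hY.memLp (p := ((3 : ℕ) : ℝ≥0∞)) (by norm_num)).integrable_norm_pow (by norm_num))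
      (Eventually.of_forall fun ω => ?_)
    simp only [norm_smul, mul_pow]
    have : ‖√(s : ℝ)‖ ≤ 1 := by
      rw [Real.norm_of_nonneg (Real.sqrt_nonneg _), Real.sqrt_le_one]
      exact_mod_cast hs1
    exact mul_le_of_le_one_left (by positivity) (pow_le_one₀ (norm_nonneg _) this)
  refine hswap.trans ?_
  have hD0 : 0 ≤ D := integral_nonneg fun ω => by positivity
  calc (n : ℝ) * ((ℓ : ℝ) ^ 3 * r ^ 3 *
        (∫ y, ‖y‖ ^ 3 ∂(sumLaw μ g s) + ∫ y, ‖y‖ ^ 3 ∂(scaledLaw P Y s)))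
      ≤ (2 * t) * ((ℓ : ℝ) ^ 3 * r ^ 3 * (C + D)) := by gcongr
    _ = 2 * ((ℓ : ℝ) ^ 3 * (C + D)) * r * (t * r ^ 2) := by ring
    _ = 2 * ((ℓ : ℝ) ^ 3 * (C + D)) / √(t : ℝ) := by
        rw [hr, inv_pow, Real.sq_sqrt ht0.le, mul_inv_cancel₀ ht0.ne', mul_one, div_eq_mul_inv]

end NormalApproximation

/-! ### Normal approximation of Poisson `U`-statistics -/

lemma norm_sq_le_sum {ℓ : ℕ} (v : Fin ℓ → ℝ) : ‖v‖ ^ 2 ≤ ∑ i, v i ^ 2 := by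
  have h0 : 0 ≤ ∑ i, v i ^ 2 := Finset.sum_nonneg fun i _ => sq_nonneg _
  have : ‖v‖ ≤ √(∑ i, v i ^ 2) := by
    refine (pi_norm_le_iff_of_nonneg (Real.sqrt_nonneg _)).2 fun i => ?_
    refine Real.abs_le_sqrt ?_
    exact Finset.single_le_sum (f := fun i => v i ^ 2) (fun i _ => sq_nonneg _)
      (Finset.mem_univ i)
  calc ‖v‖ ^ 2 ≤ √(∑ i, v i ^ 2) ^ 2 := by gcongr
    _ = _ := Real.sq_sqrt h0

lemma integral_norm_sq_le {ℓ : ℕ} {Ω : Type*} [MeasurableSpace Ω] {P : Measure Ω}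
    {F : Ω → Fin ℓ → ℝ} (hF : MemLp F 2 P) :
    ∫ ω, ‖F ω‖ ^ 2 ∂P ≤ ∑ i, ∫ ω, F ω i ^ 2 ∂P := by
  have h1 : ∀ i, Integrable (fun ω => F ω i ^ 2) P := fun i =>
    (memLp_pi_iff.1 hF i).integrable_sq
  rw [← integral_finsetSum _ fun i _ => h1 i]
  exact integral_mono (MemLp.integrable_norm_pow (p := 2) (by exact_mod_cast hF) (by norm_num))
    (integrable_finsetSum _ fun i _ => h1 i) fun ω => norm_sq_le_sum _

section Perturbation

variable {Ω : Type*} [MeasurableSpace Ω] {P : Measure Ω} [IsProbabilityMeasure P] {ℓ : ℕ}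

lemma integrable_testFunction {h : (Fin ℓ → ℝ) → ℝ} (hh : h ∈ testFunctions ℓ)
    {F : Ω → Fin ℓ → ℝ} (hF : MemLp F 2 P) : Integrable (fun ω => h (F ω)) P := by
  have h1 : Integrable (fun ω => fderiv ℝ h 0 (F ω)) P :=
    (fderiv ℝ h 0).integrable_comp (hF.integrable (by norm_num))
  have h2 : Integrable (fun ω => ‖F ω‖ ^ 2) P :=
    MemLp.integrable_norm_pow (p := 2) (by exact_mod_cast hF) (by norm_num)
  have h3 : Integrable (fun ω => h (F ω) - h 0 - fderiv ℝ h 0 (F ω)) P := by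
    refine (h2.const_mul ((ℓ : ℝ) ^ 2)).mono' ?_ (Eventually.of_forall fun ω => ?_)
    · exact ((hh.1.continuous.comp_aestronglyMeasurable hF.1).sub
        aestronglyMeasurable_const).sub h1.1
    · simpa using abs_testFunction_sub_le hh 0 (F ω)
  refine ((h3.add h1).add (integrable_const (h 0))).congr (Eventually.of_forall fun ω => ?_)
  simp only [Pi.add_apply]
  ring

/-- The effect of a centred perturbation on the expectation of a test function is quadratic. -/
lemma abs_integral_testFunction_add_sub_le {h : (Fin ℓ → ℝ) → ℝ} (hh : h ∈ testFunctions ℓ)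
    {F R : Ω → Fin ℓ → ℝ} (hF : MemLp F 2 P) (hR : MemLp R 2 P) (hR0 : ∀ i, ∫ ω, R ω i ∂P = 0) :
    |∫ ω, h (F ω + R ω) ∂P - ∫ ω, h (F ω) ∂P| ≤
      (ℓ : ℝ) ^ 2 * (∫ ω, ‖R ω‖ ^ 2 ∂P + ∫ ω, ‖F ω‖ * ‖R ω‖ ∂P) := by
  have hRi : Integrable R P := hR.integrable (by norm_num)
  have h1 : Integrable (fun ω => fderiv ℝ h 0 (R ω)) P := (fderiv ℝ h 0).integrable_comp hRi
  have h10 : ∫ ω, fderiv ℝ h 0 (R ω) ∂P = 0 := by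
    have : ∫ ω, R ω ∂P = 0 := by
      funext i
      rw [eval_integral fun i => (memLp_pi_iff.1 hR i).integrable (by norm_num), hR0]
      rfl
    rw [(fderiv ℝ h 0).integral_comp_comm hRi, this, map_zero]
  have h2 : Integrable (fun ω => ‖R ω‖ ^ 2) P :=
    MemLp.integrable_norm_pow (p := 2) (by exact_mod_cast hR) (by norm_num)
  have h3 : Integrable (fun ω => ‖F ω‖ * ‖R ω‖) P := hF.norm.integrable_mul hR.norm
  have h4 := integrable_testFunction hh (hF.add hR)
  have h5 := integrable_testFunction hh hF
  have h6 : Integrable (fun ω => h (F ω + R ω) - h (F ω)) P := h4.sub h5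
  have e : ∫ ω, h (F ω + R ω) ∂P - ∫ ω, h (F ω) ∂P =
      ∫ ω, (h (F ω + R ω) - h (F ω) - fderiv ℝ h 0 (R ω)) ∂P := by
    rw [integral_sub h6 h1, h10, sub_zero]
    exact (integral_sub h4 h5).symm
  rw [e, ← integral_add h2 h3, ← integral_const_mul]
  exact norm_integral_le_of_norm_le
    (f := fun ω => h (F ω + R ω) - h (F ω) - fderiv ℝ h 0 (R ω)) ((h2.add h3).const_mul _)
    (Eventually.of_forall fun ω => abs_testFunction_sub_le hh (F ω) (R ω))

end Perturbation

lemma sumVal_const_mul {X : Type*} (r : ℝ) (g : X → ℝ) (c : Conf X) :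
    sumVal (fun x => r * g x) c = r * sumVal g c := by
  simp only [sumVal_apply, Finset.mul_sum]

section Scaling

variable {X : Type*} [MeasurableSpace X]

lemma margin_const_mul (μ : Measure X) {m : ℕ} (r : ℝ) (f : (Fin (m + 1) → X) → ℝ) :
    margin μ (fun z => r * f z) = fun z => r * margin μ f z :=
  funext fun _ => integral_const_mul _ _

lemma iterMean_const_mul (μ : Measure X) {m : ℕ} (r : ℝ) (f : (Fin m → X) → ℝ) :
    iterMean μ m (fun z => r * f z) = r * iterMean μ m f := by
  induction m with
  | zero => rfl
  | succ m ih => rw [iterMean, margin_const_mul, ih, iterMean]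

lemma margin_smul_measure (μ : Measure X) {m : ℕ} (t : ℝ≥0) (f : (Fin (m + 1) → X) → ℝ) :
    margin (t • μ) f = fun z => (t : ℝ) * margin μ f z :=
  funext fun _ => integral_smul_nnreal_measure _ _

lemma iterMean_smul_measure (μ : Measure X) {m : ℕ} (t : ℝ≥0) (f : (Fin m → X) → ℝ) :
    iterMean (t • μ) m f = (t : ℝ) ^ m * iterMean μ m f := by
  induction m with
  | zero => simp [iterMean]
  | succ m ih =>
    rw [iterMean, ih, margin_smul_measure, iterMean_const_mul, iterMean]
    ring

lemma proj_smul_measure (μ : Measure X) {m : ℕ} (t : ℝ≥0) (f : (Fin (m + 1) → X) → ℝ) (y : X) :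
    proj (t • μ) f y = (t : ℝ) ^ m * proj μ f y :=
  iterMean_smul_measure μ t _

lemma pi_smul_measure (μ : Measure X) [SigmaFinite μ] (m : ℕ) (t : ℝ≥0) :
    Measure.pi (fun _ : Fin m => t • μ) = t ^ m • Measure.pi fun _ : Fin m => μ := by
  refine (Measure.pi_eq fun s _ => ?_)
  simp only [Measure.smul_apply, Measure.pi_pi, ENNReal.smul_def, smul_eq_mul]
  rw [Finset.prod_mul_distrib]
  simp

lemma integral_uStat (μ : Measure X) [IsFiniteMeasure μ] {m : ℕ} {f : (Fin m → X) → ℝ}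
    (hf : Measurable f) (hi : Integrable f (Measure.pi fun _ : Fin m => μ)) :
    ∫ c, uStat m f c ∂(poissonConf μ) = ∫ z, f z ∂(Measure.pi fun _ : Fin m => μ) := by
  have key : ∀ F : (Fin m → X) → ℝ, Measurable F →
      Integrable F (Measure.pi fun _ : Fin m => μ) →
      ∫⁻ c, uStat m (fun z => ENNReal.ofReal (F z)) c ∂(poissonConf μ) =
        ∫⁻ z, ENNReal.ofReal (F z) ∂(Measure.pi fun _ : Fin m => μ) ∧
      ∫⁻ z, ENNReal.ofReal (F z) ∂(Measure.pi fun _ : Fin m => μ) ≠ ∞ := by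
    intro F hF hFi
    have := lintegral_card_mul_uStat μ (f := fun z => ENNReal.ofReal (F z)) hF.ennreal_ofReal
      fun _ => 1
    simp only [one_mul, lintegral_one, measure_univ, mul_one] at this
    exact ⟨this, (hFi.lintegral_lt_top).ne⟩
  obtain ⟨p1, p2⟩ := key f hf hi
  obtain ⟨n1, n2⟩ := key (fun z => -f z) hf.neg hi.neg
  have hm : ∀ F : (Fin m → X) → ℝ, Measurable F →
      Measurable (uStat m fun z => ENNReal.ofReal (F z)) := fun F hF =>
    measurable_uStat' hF.ennreal_ofReal
  simp_rw [uStat_eq_toReal_sub f]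
  rw [integral_sub (integrable_toReal_of_lintegral_ne_top (hm f hf).aemeasurable (p1 ▸ p2))
    (integrable_toReal_of_lintegral_ne_top (hm (fun z => -f z) hf.neg).aemeasurable (n1 ▸ n2)),
    integral_toReal (hm f hf).aemeasurable (ae_lt_top (hm f hf) (p1 ▸ p2)),
    integral_toReal (hm (fun z => -f z) hf.neg).aemeasurable
      (ae_lt_top (hm (fun z => -f z) hf.neg) (n1 ▸ n2)),
    p1, n1, integral_eq_lintegral_pos_part_sub_lintegral_neg_part hi]

lemma sqNorm_ne_top_of_cube {α : Type*} [MeasurableSpace α] {ρ : Measure α} [IsFiniteMeasure ρ]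
    {F : α → ℝ} (hF : AEStronglyMeasurable F ρ) (h : ∫⁻ x, ‖F x‖ₑ ^ 3 ∂ρ ≠ ∞) :
    sqNorm F ρ ≠ ∞ :=
  sqNorm_ne_top ((memLp_three_of_lintegral hF h).mono_exponent (by norm_num))

lemma lintegral_proj_pow_three_ne_top (μ : Measure X) [IsFiniteMeasure μ] {m : ℕ}
    {f : (Fin (m + 1) → X) → ℝ} (hf : Measurable f)
    (h3 : ∫⁻ z, ‖f z‖ₑ ^ 3 ∂(Measure.pi fun _ : Fin (m + 1) => μ) ≠ ∞) :
    ∫⁻ x, ‖proj μ f x‖ₑ ^ 3 ∂μ ≠ ∞ := by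
  have hi : Integrable f (Measure.pi fun _ : Fin (m + 1) => μ) :=
    (memLp_three_of_lintegral hf.aestronglyMeasurable h3).integrable (by norm_num)
  have h1 : ∫⁻ x, ‖proj μ f x‖ₑ ^ 3 ∂μ ≤
      ∫⁻ x, (Measure.pi fun _ : Fin m => μ) Set.univ ^ 2 *
        ∫⁻ z, slice (fun z => ‖f z‖ₑ ^ 3) x z ∂(Measure.pi fun _ : Fin m => μ) ∂μ := by
    refine lintegral_mono_ae ((ae_proj_eq_integral μ hi).mono fun x hx => ?_)
    rw [hx]
    exact enorm_integral_pow_le 2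
      ((measurable_slice' hf).comp measurable_prodMk_left).aestronglyMeasurable
  have hm : Measurable fun z => ‖f z‖ₑ ^ 3 := hf.enorm.pow_const 3
  have hm' : Measurable fun x => ∫⁻ z, slice (fun z => ‖f z‖ₑ ^ 3) x z
      ∂(Measure.pi fun _ : Fin m => μ) := (measurable_slice' hm).lintegral_prod_right'
  rw [lintegral_const_mul _ hm',
    lintegral_slice μ hm] at h1
  refine (h1.trans_lt (ENNReal.mul_lt_top ?_ h3.lt_top)).ne
  finiteness

end Scaling

section NormalApproximation

variable {X Ω : Type*} [MeasurableSpace X] [MeasurableSpace Ω] {ℓ m : ℕ}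

lemma memLp_remU (μ : Measure X) [IsFiniteMeasure μ] {f : (Fin (m + 1) → X) → ℝ}
    (hf : Measurable f) (h2 : sqNorm f (Measure.pi fun _ : Fin (m + 1) => μ) ≠ ∞) :
    MemLp (remU μ f) 2 (poissonConf μ) ∧ ∫ c, remU μ f c ∂(poissonConf μ) = 0 := by
  have hi := integrable_of_sqNorm μ hf h2
  have hp2 : MemLp (proj μ f) 2 μ := by
    refine memLp_two_of_sqNorm (measurable_proj μ hf).aestronglyMeasurable ?_
    refine ((sqNorm_proj_le μ hf).trans_lt (ENNReal.mul_lt_top ?_ h2.lt_top)).ne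
    finiteness
  have h3 := memLp_uStat μ hf h2
  have h4 := memLp_sumVal μ (measurable_proj μ hf) hp2
  have hc : MemLp (centU μ f) 2 (poissonConf μ) := h3.sub (memLp_const _)
  have hs : MemLp (fun c => (m + 1 : ℝ) * (sumVal (proj μ f) c - iterMean μ (m + 1) f)) 2
      (poissonConf μ) := (h4.sub (memLp_const _)).const_mul _
  refine ⟨hc.sub hs, ?_⟩
  change ∫ c, (centU μ f c - _) ∂(poissonConf μ) = 0
  rw [integral_sub (hc.integrable (by norm_num)) (hs.integrable (by norm_num)),
    integral_const_mul, integral_sub (h4.integrable (by norm_num)) (integrable_const _),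
    integral_sumVal μ (measurable_proj μ hf) (hp2.integrable (by norm_num)), integral_proj μ hi]
  change ∫ c, (uStat (m + 1) f c - _) ∂(poissonConf μ) - _ = 0
  rw [integral_sub (h3.integrable (by norm_num)) (integrable_const _), integral_uStat μ hf hi,
    iterMean_eq_integral μ hi]
  simp

/-- The second moment of the remainder in the first-order expansion of a `U`-statistic is of lower
order, as the intensity grows. -/
lemma exists_integral_remU_sq_le (μ : Measure X) [IsFiniteMeasure μ] {f : (Fin (m + 1) → X) → ℝ}
    (hf : Measurable f) (hs : SymmKernel f)
    (h2 : sqNorm f (Measure.pi fun _ : Fin (m + 1) => μ) ≠ ∞) :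
    ∃ C : ℝ, 0 ≤ C ∧ ∀ t : ℝ≥0, 1 ≤ t →
      ∫ c, remU (t • μ) f c ^ 2 ∂(poissonConf (t • μ)) ≤ C * (t : ℝ) ^ (2 * m) := by
  obtain ⟨K, hK⟩ := exists_sqNorm_remU_le (X := X) m
  set S := sqNorm f (Measure.pi fun _ : Fin (m + 1) => μ) with hS
  set b₀ : ℝ≥0∞ := 1 + μ Set.univ with hb₀
  have hb₀t : b₀ ≠ ∞ := by finiteness
  set D : ℝ≥0∞ := (K + 1) * b₀ ^ (m + 1) * S with hD
  have hDt : D ≠ ∞ := by finiteness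
  refine ⟨D.toReal, ENNReal.toReal_nonneg, fun t ht => ?_⟩
  have ht0 : (t : ℝ≥0∞) ≠ 0 := by
    exact_mod_cast (zero_lt_one.trans_le ht).ne'
  have h1t : (1 : ℝ≥0∞) ≤ t := by exact_mod_cast ht
  have hSt : sqNorm f (Measure.pi fun _ : Fin (m + 1) => t • μ) = (t : ℝ≥0∞) ^ (m + 1) * S := by
    rw [sqNorm, pi_smul_measure, lintegral_smul_measure, ENNReal.smul_def, smul_eq_mul]
    push_cast
    rfl
  have h := hK (t • μ) f (t * b₀) hf hs (one_le_mul h1t le_self_add) (by finiteness) (by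
    rw [Measure.smul_apply, ENNReal.smul_def, smul_eq_mul]
    gcongr
    exact le_add_self)
  rw [hSt] at h
  have h5 : (t : ℝ≥0∞) ^ 2 * sqNorm (remU (t • μ) f) (poissonConf (t • μ)) ≤
      (t : ℝ≥0∞) ^ 2 * (D * (t : ℝ≥0∞) ^ (2 * m)) := by
    calc (t : ℝ≥0∞) ^ 2 * sqNorm (remU (t • μ) f) (poissonConf (t • μ))
        ≤ (t * b₀) ^ 2 * sqNorm (remU (t • μ) f) (poissonConf (t • μ)) := by
          gcongr
          exact le_mul_of_one_le_right zero_le le_self_add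
      _ ≤ _ := h
      _ = _ := by
          rw [hD, mul_pow]
          ring
  rw [ENNReal.mul_le_mul_iff_right (pow_ne_zero 2 ht0) (by finiteness)] at h5
  have h2t : sqNorm f (Measure.pi fun _ : Fin (m + 1) => t • μ) ≠ ∞ := by
    rw [hSt]
    finiteness
  rw [sqNorm_eq_ofReal (memLp_remU (t • μ) hf h2t).1] at h5
  have h6 := ENNReal.toReal_mono (by finiteness) h5
  rw [ENNReal.toReal_ofReal (integral_nonneg fun c => sq_nonneg _), ENNReal.toReal_mul,
    ENNReal.toReal_pow] at h6
  simpa using h6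

/-- Normal approximation of a vector of `U`-statistics of a Poisson process of intensity `t • μ`,
at the rate `t^{-1/2}`. The normalized vector is `F + R`, where `F` is the linear part, to which
`exists_abs_sumVec_sub_le` applies, and `R` is centred with `𝔼‖R‖² = O(1/t)`. -/
lemma exists_abs_uStat_sub_le (μ : Measure X) [IsFiniteMeasure μ]
    {f : Fin ℓ → (Fin (m + 1) → X) → ℝ} (hf : ∀ i, Measurable (f i)) (hs : ∀ i, SymmKernel (f i))
    (h3 : ∀ i, ∫⁻ z, ‖f i z‖ₑ ^ 3 ∂(Measure.pi fun _ : Fin (m + 1) => μ) ≠ ∞) {P : Measure Ω}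
    [IsProbabilityMeasure P] {Y : Ω → Fin ℓ → ℝ} (hY : HasGaussianLaw Y P)
    (h0 : ∀ i, ∫ ω, Y ω i ∂P = 0)
    (hcov : ∀ i j, covariance (fun ω => Y ω i) (fun ω => Y ω j) P =
      1 / (m.factorial : ℝ) ^ 2 * ∫ x, proj μ (f i) x * proj μ (f j) x ∂μ) :
    ∃ C : ℝ, ∀ t : ℝ≥0, 1 ≤ t → ∀ h ∈ testFunctions ℓ,
      |∫ c, h (fun i => ((t : ℝ) ^ m * √(t : ℝ))⁻¹ * (1 / ((m + 1).factorial : ℝ)) *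
          centU (t • μ) (f i) c) ∂(poissonConf (t • μ)) - ∫ ω, h (Y ω) ∂P| ≤ C / √(t : ℝ) := by
  have hi : ∀ i, Integrable (f i) (Measure.pi fun _ : Fin (m + 1) => μ) := fun i =>
    (memLp_three_of_lintegral (hf i).aestronglyMeasurable (h3 i)).integrable (by norm_num)
  have h2 : ∀ i, sqNorm (f i) (Measure.pi fun _ : Fin (m + 1) => μ) ≠ ∞ := fun i =>
    sqNorm_ne_top_of_cube (hf i).aestronglyMeasurable (h3 i)
  set a : ℝ := 1 / (m.factorial : ℝ) with ha
  set g : Fin ℓ → X → ℝ := fun i x => a * proj μ (f i) x with hgdef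
  have hg : ∀ i, Measurable (g i) := fun i => (measurable_proj μ (hf i)).const_mul a
  have hg3 : ∀ i, ∫⁻ x, ‖g i x‖ₑ ^ 3 ∂μ ≠ ∞ := by
    intro i
    simp only [hgdef, enorm_mul, mul_pow]
    rw [lintegral_const_mul _ ((measurable_proj μ (hf i)).enorm.pow_const 3)]
    have := lintegral_proj_pow_three_ne_top μ (hf i) (h3 i)
    finiteness
  have hg2 : ∀ i, MemLp (g i) 2 μ := fun i =>
    (memLp_three_of_lintegral (hg i).aestronglyMeasurable (hg3 i)).mono_exponent (by norm_num)
  obtain ⟨C₁, hC₁⟩ := exists_abs_sumVec_sub_le μ hg hg3 hY h0 fun i j => by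
    rw [hcov, ← integral_const_mul]
    refine integral_congr_ae (Eventually.of_forall fun x => ?_)
    simp only [hgdef, ha]
    ring
  choose C₂ hC₂0 hC₂ using fun i => exists_integral_remU_sq_le μ (hf i) (hs i) (h2 i)
  set V : ℝ := ∑ i, ∫ x, g i x ^ 2 ∂μ with hV
  set W : ℝ := ∑ i, C₂ i with hW
  refine ⟨(ℓ : ℝ) ^ 2 * (W + (V + W) / 2) + C₁, fun t ht h hh => ?_⟩
  have ht1 : (1 : ℝ) ≤ t := by exact_mod_cast ht
  have ht0 : (0 : ℝ) < t := zero_lt_one.trans_le ht1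
  set r : ℝ := √(t : ℝ) with hr
  have hr1 : 1 ≤ r := Real.one_le_sqrt.2 ht1
  have hr0 : 0 < r := zero_lt_one.trans_le hr1
  have hrr : r ^ 2 = t := Real.sq_sqrt ht0.le
  set κ : ℝ := ((t : ℝ) ^ m * r)⁻¹ * (1 / ((m + 1).factorial : ℝ)) with hκ
  have hκ0 : 0 ≤ κ := by positivity
  have hκ2 : κ ^ 2 * (t : ℝ) ^ (2 * m) ≤ 1 / t := by
    have h1 : (1 / ((m + 1).factorial : ℝ)) ^ 2 ≤ 1 := by
      refine pow_le_one₀ (by positivity) ?_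
      rw [div_le_one (by positivity)]
      exact_mod_cast Nat.one_le_iff_ne_zero.2 (Nat.factorial_ne_zero _)
    calc κ ^ 2 * (t : ℝ) ^ (2 * m) = (1 / t) * (1 / ((m + 1).factorial : ℝ)) ^ 2 := by
          rw [hκ, mul_pow, inv_pow, mul_pow, hrr, ← pow_mul, mul_comm m 2]
          field_simp
      _ ≤ _ := mul_le_of_le_one_right (by positivity) h1
  have hgs2 : ∀ i, MemLp (g i) 2 (t • μ) := fun i => (hg2 i).smul_measure ENNReal.coe_ne_top
  have h2t : ∀ i, sqNorm (f i) (Measure.pi fun _ : Fin (m + 1) => t • μ) ≠ ∞ := fun i => by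
    rw [sqNorm, pi_smul_measure, lintegral_smul_measure, ENNReal.smul_def, smul_eq_mul]
    exact ENNReal.mul_ne_top ENNReal.coe_ne_top (h2 i)
  set F : Conf X → Fin ℓ → ℝ := fun c => r⁻¹ • sumVec (t • μ) g c with hF
  set R : Conf X → Fin ℓ → ℝ := fun c i => κ * remU (t • μ) (f i) c with hR
  -- the projections carry the leading term
  have hdec : ∀ c, (fun i => κ * centU (t • μ) (f i) c) = F c + R c := by
    intro c
    funext i
    have hint : ∫ x, g i x ∂(t • μ) = t * (a * iterMean μ (m + 1) (f i)) := by
      rw [integral_smul_nnreal_measure, ← integral_proj μ (hi i), ← integral_const_mul]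
      rfl
    have hfac : (((m + 1).factorial : ℕ) : ℝ) = (m + 1) * m.factorial := by
      rw [Nat.factorial_succ]
      push_cast
      ring
    have hcent : centU (t • μ) (f i) c = remU (t • μ) (f i) c + (m + 1 : ℝ) *
        ((t : ℝ) ^ m * sumVal (proj μ (f i)) c - (t : ℝ) ^ (m + 1) * iterMean μ (m + 1) (f i)) := by
      have e : proj (t • μ) (f i) = fun x => (t : ℝ) ^ m * proj μ (f i) x :=
        funext fun x => proj_smul_measure μ t (f i) x
      rw [remU, e, sumVal_const_mul, iterMean_smul_measure]
      ring
    simp only [Pi.add_apply, hF, hR, Pi.smul_apply, smul_eq_mul, sumVec, hint, hcent]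
    have e2 : sumVal (g i) c = a * sumVal (proj μ (f i)) c := sumVal_const_mul _ _ _
    have e3 : κ * ((m + 1 : ℝ) * (t : ℝ) ^ m) = r⁻¹ * a := by
      rw [hκ, ha, hfac]
      field_simp
    rw [e2, mul_add, add_comm]
    congr 1
    calc κ * ((m + 1 : ℝ) * ((t : ℝ) ^ m * sumVal (proj μ (f i)) c -
          (t : ℝ) ^ (m + 1) * iterMean μ (m + 1) (f i)))
        = κ * ((m + 1 : ℝ) * (t : ℝ) ^ m) *
          (sumVal (proj μ (f i)) c - t * iterMean μ (m + 1) (f i)) := by ring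
      _ = _ := by
          rw [e3]
          ring
  have hF2 : MemLp F 2 (poissonConf (t • μ)) := by
    refine memLp_pi_iff.2 fun i => ?_
    exact ((memLp_sumVal (t • μ) (hg i) (hgs2 i)).sub (memLp_const _)).const_mul r⁻¹
  have hR2 : MemLp R 2 (poissonConf (t • μ)) := by
    refine memLp_pi_iff.2 fun i => ?_
    exact (memLp_remU (t • μ) (hf i) (h2t i)).1.const_mul κ
  have hR0 : ∀ i, ∫ c, R c i ∂(poissonConf (t • μ)) = 0 := fun i => by
    simp only [hR]
    rw [integral_const_mul, (memLp_remU (t • μ) (hf i) (h2t i)).2, mul_zero]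
  have hFn : ∫ c, ‖F c‖ ^ 2 ∂(poissonConf (t • μ)) ≤ V := by
    refine (integral_norm_sq_le hF2).trans_eq (Finset.sum_congr rfl fun i _ => ?_)
    simp only [hF, Pi.smul_apply, smul_eq_mul, mul_pow, sumVec]
    rw [integral_const_mul, integral_sumVal_sub_sq _ (hg i) (hgs2 i),
      integral_smul_nnreal_measure, inv_pow, hrr, NNReal.smul_def, smul_eq_mul, ← mul_assoc,
      inv_mul_cancel₀ ht0.ne', one_mul]
  have hRn : ∫ c, ‖R c‖ ^ 2 ∂(poissonConf (t • μ)) ≤ W / t := by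
    refine (integral_norm_sq_le hR2).trans ?_
    rw [hW, Finset.sum_div]
    refine Finset.sum_le_sum fun i _ => ?_
    simp only [hR, mul_pow]
    rw [integral_const_mul]
    calc κ ^ 2 * ∫ c, remU (t • μ) (f i) c ^ 2 ∂(poissonConf (t • μ))
        ≤ κ ^ 2 * (C₂ i * (t : ℝ) ^ (2 * m)) := by
          gcongr
          exact hC₂ i t ht
      _ = C₂ i * (κ ^ 2 * (t : ℝ) ^ (2 * m)) := by ring
      _ ≤ C₂ i * (1 / t) := mul_le_mul_of_nonneg_left hκ2 (hC₂0 i)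
      _ = _ := by ring
  have hFi : Integrable (fun c => ‖F c‖ ^ 2) (poissonConf (t • μ)) :=
    MemLp.integrable_norm_pow (p := 2) (by exact_mod_cast hF2) (by norm_num)
  have hRi : Integrable (fun c => ‖R c‖ ^ 2) (poissonConf (t • μ)) :=
    MemLp.integrable_norm_pow (p := 2) (by exact_mod_cast hR2) (by norm_num)
  have hFR : ∫ c, ‖F c‖ * ‖R c‖ ∂(poissonConf (t • μ)) ≤ (V + W) / 2 / r := by
    -- `‖F‖ ‖R‖ ≤ (‖F‖² / r + r ‖R‖²) / 2` balances `𝔼‖F‖² = O(1)` and `𝔼‖R‖² = O(1/r²)`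
    have hmono : ∫ c, ‖F c‖ * ‖R c‖ ∂(poissonConf (t • μ)) ≤
        ∫ c, (r⁻¹ / 2 * ‖F c‖ ^ 2 + r / 2 * ‖R c‖ ^ 2) ∂(poissonConf (t • μ)) := by
      refine integral_mono (hF2.norm.integrable_mul hR2.norm)
        ((hFi.const_mul _).add (hRi.const_mul _)) fun c => ?_
      have h1 : 0 ≤ r⁻¹ / 2 * (‖F c‖ - r * ‖R c‖) ^ 2 := by positivity
      have h2 : r⁻¹ / 2 * (‖F c‖ - r * ‖R c‖) ^ 2 =
          r⁻¹ / 2 * ‖F c‖ ^ 2 + r / 2 * ‖R c‖ ^ 2 - ‖F c‖ * ‖R c‖ := by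
        field_simp
        ring
      simp only
      linarith
    refine hmono.trans ?_
    rw [integral_add (hFi.const_mul _) (hRi.const_mul _), integral_const_mul, integral_const_mul]
    calc r⁻¹ / 2 * ∫ c, ‖F c‖ ^ 2 ∂(poissonConf (t • μ)) +
          r / 2 * ∫ c, ‖R c‖ ^ 2 ∂(poissonConf (t • μ))
        ≤ r⁻¹ / 2 * V + r / 2 * (W / t) := by gcongr
      _ = (V + W) / 2 / r := by
          rw [← hrr]
          field_simp
  have hW0 : 0 ≤ W := Finset.sum_nonneg fun i _ => hC₂0 i
  have hWt : W / t ≤ W / r := by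
    rw [← hrr]
    gcongr
    nlinarith
  have hmain := abs_integral_testFunction_add_sub_le hh hF2 hR2 hR0
  simp_rw [hdec]
  refine (abs_sub_le _ (∫ c, h (F c) ∂(poissonConf (t • μ))) _).trans ?_
  refine (add_le_add hmain (hC₁ t ht h hh)).trans ?_
  calc (ℓ : ℝ) ^ 2 * (∫ c, ‖R c‖ ^ 2 ∂(poissonConf (t • μ)) +
        ∫ c, ‖F c‖ * ‖R c‖ ∂(poissonConf (t • μ))) + C₁ / √(t : ℝ)
      ≤ (ℓ : ℝ) ^ 2 * (W / r + (V + W) / 2 / r) + C₁ / r := by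
        gcongr
        exact hRn.trans hWt
    _ = _ := by ring

end NormalApproximation

/-! ### The Fell topology and its Borel sets -/

section Fell

variable {V Z : Type*} [MetricSpace V]

/-- The Borel `σ`-field of the topology induced by the Fell topology. -/
abbrev fellBorel (F : Z → Set V) : MeasurableSpace Z :=
  @borel Z (TopologicalSpace.induced F (fellTopology V))

lemma measurableSet_hit (F : Z → Set V) {G : Set V} (hG : IsOpen G) :
    @MeasurableSet Z (fellBorel F) {z | (F z ∩ G).Nonempty} := by
  let _ : TopologicalSpace Z := TopologicalSpace.induced F (fellTopology V)
  let _ : MeasurableSpace Z := borel Z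
  have : BorelSpace Z := ⟨rfl⟩
  refine IsOpen.measurableSet ?_
  exact ⟨_, isOpen_generateFrom_of_mem (Or.inr ⟨G, hG, rfl⟩), rfl⟩

lemma measurableSet_miss (F : Z → Set V) {K : Set V} (hK : IsCompact K) :
    @MeasurableSet Z (fellBorel F) {z | F z ∩ K = ∅} := by
  let _ : TopologicalSpace Z := TopologicalSpace.induced F (fellTopology V)
  let _ : MeasurableSpace Z := borel Z
  have : BorelSpace Z := ⟨rfl⟩
  refine IsOpen.measurableSet ?_
  exact ⟨_, isOpen_generateFrom_of_mem (Or.inl ⟨K, hK, rfl⟩), rfl⟩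

variable [SecondCountableTopology V]

/-- A countable subbasis of the topology induced by the Fell topology on a family of closed sets:
missing closed balls, and hitting open balls, with radii and centres from countable dense sets. -/
def fellSubbasis (V : Type*) [MetricSpace V] [SecondCountableTopology V] (F : Z → Set V) :
    Set (Set Z) :=
  ⋃ q ∈ (exists_countable_dense V).choose, ⋃ r : ℚ,
    {{z | F z ∩ Metric.closedBall q r = ∅}, {z | (F z ∩ Metric.ball q r).Nonempty}}

lemma countable_fellSubbasis (F : Z → Set V) : (fellSubbasis V F).Countable := by
  refine Set.Countable.biUnion (exists_countable_dense V).choose_spec.1 fun q _ => ?_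
  exact Set.countable_iUnion fun r => (Set.finite_singleton _).insert _ |>.countable

lemma miss_mem_fellSubbasis (F : Z → Set V) {q : V}
    (hq : q ∈ (exists_countable_dense V).choose) (r : ℚ) :
    {z | F z ∩ Metric.closedBall q r = ∅} ∈ fellSubbasis V F :=
  Set.mem_biUnion hq (Set.mem_iUnion.2 ⟨r, Set.mem_insert _ _⟩)

lemma hit_mem_fellSubbasis (F : Z → Set V) {q : V}
    (hq : q ∈ (exists_countable_dense V).choose) (r : ℚ) :
    {z | (F z ∩ Metric.ball q r).Nonempty} ∈ fellSubbasis V F :=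
  Set.mem_biUnion hq (Set.mem_iUnion.2 ⟨r, Set.mem_insert_of_mem _ rfl⟩)

/-- Balls from the countable family are arbitrarily small neighbourhoods. -/
lemma exists_ball_mem_subset {x : V} {U : Set V} (hU : U ∈ 𝓝 x) :
    ∃ q ∈ (exists_countable_dense V).choose, ∃ r : ℚ, x ∈ Metric.ball q r ∧
      Metric.closedBall q r ⊆ U := by
  obtain ⟨ε, hε, hεU⟩ := Metric.mem_nhds_iff.1 hU
  obtain ⟨r, hr0, hr⟩ := exists_rat_btwn (half_pos hε)
  obtain ⟨q, hq, hqx⟩ := (exists_countable_dense V).choose_spec.2.exists_dist_lt x hr0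
  refine ⟨q, hq, r, hqx, fun y hy => hεU ?_⟩
  rw [Metric.mem_closedBall] at hy
  rw [Metric.mem_ball]
  have := dist_triangle_right y x q
  linarith

/-- A compact set meets the intersection of finitely many closed sets if these closed sets
have common approximate points in it at all scales. -/
lemma inter_iInter_nonempty_iff {m : ℕ} {K : Set V} (hK : IsCompact K) {E : Fin m → Set V}
    (hE : ∀ i, IsClosed (E i)) :
    (K ∩ ⋂ i, E i).Nonempty ↔ ∀ n : ℕ, ∃ q ∈ (exists_countable_dense V).choose,
      (K ∩ Metric.ball q (1 / (n + 1))).Nonempty ∧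
        ∀ i, (E i ∩ Metric.ball q (1 / (n + 1))).Nonempty := by
  constructor
  · rintro ⟨x, hxK, hxE⟩ n
    obtain ⟨q, hq, hqx⟩ := (exists_countable_dense V).choose_spec.2.exists_dist_lt x
      (ε := 1 / ((n : ℝ) + 1)) (by positivity)
    exact ⟨q, hq, ⟨x, hxK, hqx⟩, fun i => ⟨x, Set.mem_iInter.1 hxE i, hqx⟩⟩
  · intro h
    choose q hq hx hy using h
    choose x hxK hxq using hx
    choose y hyE hyq using hy
    obtain ⟨a, haK, φ, hφ, ha⟩ := hK.tendsto_subseq hxK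
    refine ⟨a, haK, Set.mem_iInter.2 fun i => ?_⟩
    have h0 : Tendsto (fun n : ℕ => 2 * (1 / ((n : ℝ) + 1))) atTop (𝓝 0) := by
      simpa using tendsto_one_div_add_atTop_nhds_zero_nat.const_mul (2 : ℝ)
    have hd : Tendsto (fun n => dist (x (φ n)) (y (φ n) i)) atTop (𝓝 0) := by
      refine squeeze_zero (fun _ => dist_nonneg) (fun n => ?_) (h0.comp hφ.tendsto_atTop)
      have h1 := Metric.mem_ball.1 (hxq (φ n))
      have h2 := Metric.mem_ball.1 (hyq (φ n) i)
      have h3 := dist_triangle_right (x (φ n)) (y (φ n) i) (q (φ n))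
      simp only [Function.comp]
      linarith
    have ht : Tendsto (fun n => y (φ n) i) atTop (𝓝 a) :=
      (tendsto_iff_of_dist hd).1 ha
    exact (hE i).mem_of_tendsto ht (Eventually.of_forall fun n => hyE (φ n) i)

variable [ProperSpace V]

/-- In a proper space the Fell topology on closed sets has a countable subbasis: a compact set
missed by a closed set is covered by finitely many closed balls of the countable family that are
missed as well. -/
lemma induced_fellTopology_eq {F : Z → Set V} (hF : ∀ z, IsClosed (F z)) :
    TopologicalSpace.induced F (fellTopology V) = generateFrom (fellSubbasis V F) := by
  rw [fellTopology, induced_generateFrom_eq]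
  refine le_antisymm (le_generateFrom ?_) (le_generateFrom ?_)
  · intro s hs
    simp only [fellSubbasis, Set.mem_iUnion] at hs
    obtain ⟨q, hq, r, rfl | rfl⟩ := hs
    · exact isOpen_generateFrom_of_mem
        ⟨_, Or.inl ⟨_, isCompact_closedBall q r, rfl⟩, rfl⟩
    · exact isOpen_generateFrom_of_mem ⟨_, Or.inr ⟨_, Metric.isOpen_ball, rfl⟩, rfl⟩
  · let _ : TopologicalSpace Z := generateFrom (fellSubbasis V F)
    rintro _ ⟨_, ⟨K, hK, rfl⟩ | ⟨G, hG, rfl⟩, rfl⟩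
    · change IsOpen {z | F z ∩ K = ∅}
      refine isOpen_iff_forall_mem_open.2 fun z (hz : F z ∩ K = ∅) => ?_
      suffices h : ∃ U, (∀ w ∈ U, F w ∩ K = ∅) ∧ IsOpen U ∧ z ∈ U from h
      refine hK.induction_on (p := fun K => ∃ U : Set Z, (∀ w ∈ U, F w ∩ K = ∅) ∧ IsOpen U ∧ z ∈ U)
        ?_ ?_ ?_ ?_
      · exact ⟨Set.univ, fun w _ => Set.inter_empty _, isOpen_univ, Set.mem_univ z⟩
      · rintro s t hst ⟨U, h1, h2, h3⟩
        exact ⟨U, fun w hw => Set.subset_empty_iff.1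
          ((Set.inter_subset_inter_right _ hst).trans (h1 w hw).subset), h2, h3⟩
      · rintro s t ⟨U, h1, h2, h3⟩ ⟨U', h1', h2', h3'⟩
        refine ⟨U ∩ U', fun w hw => ?_, h2.inter h2', h3, h3'⟩
        rw [Set.inter_union_distrib_left, h1 w hw.1, h1' w hw.2, Set.union_empty]
      · intro x hx
        have hxz : (F z)ᶜ ∈ 𝓝 x := (hF z).isOpen_compl.mem_nhds fun h => by
          have : x ∈ F z ∩ K := ⟨h, hx⟩
          rw [hz] at this
          exact this
        obtain ⟨q, hq, r, hxr, hsub⟩ := exists_ball_mem_subset hxz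
        refine ⟨Metric.closedBall q r, mem_nhdsWithin_of_mem_nhds
          (mem_of_superset (Metric.isOpen_ball.mem_nhds hxr) Metric.ball_subset_closedBall),
          {w | F w ∩ Metric.closedBall q r = ∅}, fun w hw => hw,
          isOpen_generateFrom_of_mem (miss_mem_fellSubbasis F hq r), ?_⟩
        change F z ∩ Metric.closedBall q r = ∅
        rw [← Set.disjoint_iff_inter_eq_empty, Set.disjoint_right]
        exact fun y hy => hsub hy
    · change IsOpen {z | (F z ∩ G).Nonempty}
      refine isOpen_iff_forall_mem_open.2 fun z hz => ?_
      obtain ⟨x, hxz, hxG⟩ := hz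
      obtain ⟨q, hq, r, hxr, hsub⟩ := exists_ball_mem_subset (hG.mem_nhds hxG)
      exact ⟨_, fun w hw => hw.mono (Set.inter_subset_inter_right _
        (Metric.ball_subset_closedBall.trans hsub)),
        isOpen_generateFrom_of_mem (hit_mem_fellSubbasis F hq r), x, hxz, hxr⟩

/-- A map into a family of closed sets is measurable if the sets of points whose image misses a
given compact set are measurable. -/
lemma measurable_of_miss {F : Z → Set V} (hF : ∀ z, IsClosed (F z)) {Y : Type*}
    [MeasurableSpace Y] {f : Y → Z}
    (hf : ∀ K : Set V, IsCompact K → MeasurableSet {y | F (f y) ∩ K = ∅}) :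
    @Measurable Y Z _ (fellBorel F) f := by
  let _ : TopologicalSpace Z := TopologicalSpace.induced F (fellTopology V)
  have hgen := induced_fellTopology_eq hF
  have : SecondCountableTopology Z := ⟨⟨_, countable_fellSubbasis F, hgen⟩⟩
  have hb : fellBorel F = MeasurableSpace.generateFrom (fellSubbasis V F) :=
    borel_eq_generateFrom_of_subbasis hgen
  rw [hb]
  refine measurable_generateFrom fun s hs => ?_
  simp only [fellSubbasis, Set.mem_iUnion] at hs
  obtain ⟨q, hq, r, rfl | rfl⟩ := hs
  · exact hf _ (isCompact_closedBall q r)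
  · -- an open ball is a countable union of closed balls
    have : f ⁻¹' {z | (F z ∩ Metric.ball q r).Nonempty} =
        ⋃ n : ℕ, {y | F (f y) ∩ Metric.closedBall q (r - 1 / (n + 1)) = ∅}ᶜ := by
      ext y
      simp only [Set.mem_preimage, Set.mem_iUnion, Set.mem_compl_iff, Set.mem_ofPred_eq,
        ← Set.not_nonempty_iff_eq_empty, not_not]
      constructor
      · rintro ⟨x, hx, hxq⟩
        obtain ⟨n, hn⟩ := exists_nat_one_div_lt (sub_pos.2 (Metric.mem_ball.1 hxq))
        exact ⟨n, x, hx, Metric.mem_closedBall.2 (by linarith)⟩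
      · rintro ⟨n, x, hx, hxq⟩
        refine ⟨x, hx, Metric.mem_ball.2 ?_⟩
        have h1 : (0 : ℝ) < 1 / ((n : ℝ) + 1) := by positivity
        have h2 := Metric.mem_closedBall.1 hxq
        linarith
    rw [this]
    exact MeasurableSet.iUnion fun n => (hf _ (isCompact_closedBall _ _)).compl

end Fell

/-! ### Measurability of intersections with flats -/

section Flats

variable {d k m : ℕ}

lemma isClosed_flat (E : Flat d k) : IsClosed (E.1 : Set (EuclideanSpace ℝ (Fin d))) :=
  AffineSubspace.closed_of_finiteDimensional _

lemma measurableSet_flat_hit {G : Set (EuclideanSpace ℝ (Fin d))} (hG : IsOpen G) :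
    MeasurableSet {E : Flat d k | ((E.1 : Set (EuclideanSpace ℝ (Fin d))) ∩ G).Nonempty} :=
  measurableSet_hit (fun E : Flat d k => (E.1 : Set (EuclideanSpace ℝ (Fin d)))) hG

lemma measurableSet_flat_miss {K : Set (EuclideanSpace ℝ (Fin d))} (hK : IsCompact K) :
    MeasurableSet {E : Flat d k | (E.1 : Set (EuclideanSpace ℝ (Fin d))) ∩ K = ∅} :=
  measurableSet_miss (fun E : Flat d k => (E.1 : Set (EuclideanSpace ℝ (Fin d)))) hK

/-- The diagonal is measurable because a flat is determined by the balls of a countable family that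
it hits. -/
instance measurableEq_flat : MeasurableEq (Flat d k) where
  measurableSet_diagonal := by
    have hit : ∀ q (r : ℚ), MeasurableSet {E : Flat d k |
        ((E.1 : Set (EuclideanSpace ℝ (Fin d))) ∩ Metric.ball q r).Nonempty} :=
      fun q r => measurableSet_flat_hit Metric.isOpen_ball
    have hle : ∀ E E' : Flat d k, (∀ q ∈ (exists_countable_dense (EuclideanSpace ℝ (Fin d))).choose,
        ∀ r : ℚ, ((E.1 : Set (EuclideanSpace ℝ (Fin d))) ∩ Metric.ball q r).Nonempty →
          ((E'.1 : Set (EuclideanSpace ℝ (Fin d))) ∩ Metric.ball q r).Nonempty) →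
        (E.1 : Set (EuclideanSpace ℝ (Fin d))) ⊆ E'.1 := by
      intro E E' h x hx
      by_contra hx'
      obtain ⟨q, hq, r, hxr, hsub⟩ :=
        exists_ball_mem_subset ((isClosed_flat E').isOpen_compl.mem_nhds hx')
      obtain ⟨y, hy, hyr⟩ := h q hq r ⟨x, hx, hxr⟩
      exact hsub (Metric.ball_subset_closedBall hyr) hy
    have : Set.diagonal (Flat d k) =
        ⋂ q ∈ (exists_countable_dense (EuclideanSpace ℝ (Fin d))).choose, ⋂ r : ℚ,
          {p : Flat d k × Flat d k |
            ((p.1.1 : Set (EuclideanSpace ℝ (Fin d))) ∩ Metric.ball q r).Nonempty ↔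
            ((p.2.1 : Set (EuclideanSpace ℝ (Fin d))) ∩ Metric.ball q r).Nonempty} := by
      ext ⟨E, E'⟩
      simp only [Set.mem_diagonal_iff, Set.mem_iInter, Set.mem_ofPred_eq]
      constructor
      · rintro rfl q _ r
        rfl
      · intro h
        refine Subtype.ext (SetLike.coe_injective (Set.Subset.antisymm ?_ ?_))
        · exact hle E E' fun q hq r => (h q hq r).1
        · exact hle E' E fun q hq r => (h q hq r).2
    rw [this]
    refine MeasurableSet.biInter (exists_countable_dense _).choose_spec.1 fun q _ =>
      MeasurableSet.iInter fun r => ?_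
    exact MeasurableSet.iff (measurable_fst (hit q r)) (measurable_snd (hit q r))

lemma coe_interFlats (B : Compacts (EuclideanSpace ℝ (Fin d))) (E : Fin m → Flat d k) :
    (interFlats B E : Set (EuclideanSpace ℝ (Fin d))) =
      (B : Set (EuclideanSpace ℝ (Fin d))) ∩ ⋂ i, ((E i).1 : Set (EuclideanSpace ℝ (Fin d))) := by
  change (B : Set (EuclideanSpace ℝ (Fin d))) ∩ ((⨅ i, (E i).1 : AffineSubspace ℝ _) : Set _) = _
  rw [AffineSubspace.coe_iInf]

/-- Whether `B ∩ E₁ ∩ ⋯ ∩ Eₘ` misses `K` is decided by countably many conditions on balls hit by the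
flats, by `inter_iInter_nonempty_iff`. -/
lemma measurable_interFlats (B : Compacts (EuclideanSpace ℝ (Fin d))) :
    Measurable fun E : Fin m → Flat d k => interFlats B E := by
  refine measurable_of_miss (F := fun C : Compacts (EuclideanSpace ℝ (Fin d)) =>
    (C : Set (EuclideanSpace ℝ (Fin d)))) (fun C => C.isCompact.isClosed) fun K hK => ?_
  have hBK : IsCompact ((B : Set (EuclideanSpace ℝ (Fin d))) ∩ K) := B.isCompact.inter hK
  have : {E : Fin m → Flat d k | (interFlats B E : Set (EuclideanSpace ℝ (Fin d))) ∩ K = ∅} =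
      (⋂ n : ℕ, ⋃ q ∈ {q ∈ (exists_countable_dense (EuclideanSpace ℝ (Fin d))).choose |
        (((B : Set (EuclideanSpace ℝ (Fin d))) ∩ K) ∩
          Metric.ball q (1 / ((n : ℝ) + 1))).Nonempty},
        ⋂ i, {E : Fin m → Flat d k | (((E i).1 : Set (EuclideanSpace ℝ (Fin d))) ∩
          Metric.ball q (1 / ((n : ℝ) + 1))).Nonempty})ᶜ := by
    ext E
    have h := inter_iInter_nonempty_iff hBK fun i => isClosed_flat (E i)
    rw [Set.mem_ofPred_eq, coe_interFlats, Set.inter_right_comm, ← Set.not_nonempty_iff_eq_empty, h,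
      Set.mem_compl_iff]
    simp only [Set.mem_iInter, Set.mem_iUnion, Set.mem_ofPred_eq, exists_prop, and_assoc]
  rw [this]
  refine (MeasurableSet.iInter fun n => MeasurableSet.biUnion
    ((exists_countable_dense _).choose_spec.1.mono (Set.sep_subset _ _)) fun q _ =>
    MeasurableSet.iInter fun i => ?_).compl
  have h := measurableSet_flat_hit (k := k) (Metric.isOpen_ball (x := q) (ε := 1 / ((n : ℝ) + 1)))
  exact h.preimage (measurable_pi_apply i)

lemma interFlats_cons (B : Compacts (EuclideanSpace ℝ (Fin d))) (y : Flat d k)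
    (E : Fin m → Flat d k) :
    interFlats B (Fin.cons y E : Fin (m + 1) → Flat d k) = interFlats (interAffine B y.1) E := by
  refine SetLike.coe_injective ?_
  rw [coe_interFlats, coe_interFlats]
  change _ = ((B : Set (EuclideanSpace ℝ (Fin d))) ∩ y.1) ∩ _
  rw [Set.inter_assoc]
  congr 1
  ext x
  simp [Fin.forall_fin_succ]

lemma interAffine_right_comm (B : Compacts (EuclideanSpace ℝ (Fin d)))
    (E E' : AffineSubspace ℝ (EuclideanSpace ℝ (Fin d))) :
    interAffine (interAffine B E) E' = interAffine (interAffine B E') E := by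
  refine SetLike.coe_injective ?_
  change ((B : Set (EuclideanSpace ℝ (Fin d))) ∩ E) ∩ E' =
    ((B : Set (EuclideanSpace ℝ (Fin d))) ∩ E') ∩ E
  exact Set.inter_right_comm _ _ _

lemma slice_interFlats (ψ : Compacts (EuclideanSpace ℝ (Fin d)) → ℝ)
    (B : Compacts (EuclideanSpace ℝ (Fin d))) (y : Flat d k) :
    slice (fun E : Fin (m + 1) → Flat d k => ψ (interFlats B E)) y =
      fun E => ψ (interFlats (interAffine B y.1) E) :=
  funext fun E => congrArg ψ (interFlats_cons B y E)

lemma symmKernel_interFlats (ψ : Compacts (EuclideanSpace ℝ (Fin d)) → ℝ)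
    (B : Compacts (EuclideanSpace ℝ (Fin d))) :
    SymmKernel fun E : Fin m → Flat d k => ψ (interFlats B E) := by
  induction m using Nat.twoStepInduction generalizing B with
  | zero => trivial
  | one => trivial
  | more m _ ih =>
    refine ⟨fun x y => ?_, fun x => ?_⟩
    · simp only [slice_interFlats, interAffine_right_comm B x.1]
    · rw [slice_interFlats]
      exact ih _

/-- The flats hitting the set `B`. -/
def hitting (k : ℕ) (B : Set (EuclideanSpace ℝ (Fin d))) : Set (Flat d k) :=
  {E | ((E.1 : Set (EuclideanSpace ℝ (Fin d))) ∩ B).Nonempty}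

lemma measurableSet_hitting {B : Set (EuclideanSpace ℝ (Fin d))} (hB : IsCompact B) :
    MeasurableSet (hitting k B) := by
  have : hitting k B =
      {E : Flat d k | (E.1 : Set (EuclideanSpace ℝ (Fin d))) ∩ B = ∅}ᶜ := by
    ext E
    simp [hitting, Set.nonempty_iff_ne_empty]
  rw [this]
  exact (measurableSet_flat_miss hB).compl

lemma interFlats_eq_bot {B : Compacts (EuclideanSpace ℝ (Fin d))} {E : Fin m → Flat d k}
    {C : Set (EuclideanSpace ℝ (Fin d))} (hBC : (B : Set (EuclideanSpace ℝ (Fin d))) ⊆ C)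
    {j : Fin m} (hj : E j ∉ hitting k C) : interFlats B E = ⊥ := by
  refine SetLike.coe_injective (Set.eq_empty_of_forall_notMem fun x hx => hj ?_)
  have hx' : x ∈ (interFlats B E : Set (EuclideanSpace ℝ (Fin d))) := hx
  rw [coe_interFlats] at hx'
  exact ⟨x, Set.mem_iInter.1 hx'.2 j, hBC hx'.1⟩

end Flats

/-! ### The intensity measure of the flat process -/

section FlatMeasure

variable {d k : ℕ}

lemma map_apply_le {α β : Type*} [MeasurableSpace α] [MeasurableSpace β] (μ : Measure α)
    (f : α → β) {s : Set β} (hs : MeasurableSet s) : μ.map f s ≤ μ (f ⁻¹' s) := by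
  by_cases hf : AEMeasurable f μ
  · exact (Measure.map_apply_of_aemeasurable hf hs).le
  · rw [Measure.map_of_not_aemeasurable hf]
    exact zero_le

lemma mem_translate {L : LinearFlat d k} {x y : EuclideanSpace ℝ (Fin d)} :
    y ∈ (L.translate x).1 ↔ y - x ∈ L.1 :=
  AffineSubspace.mem_mk'

lemma finrank_orthogonal_linearFlat (L : LinearFlat d k) :
    Module.finrank ℝ (L.1)ᗮ = d - k := by
  have h := Submodule.finrank_add_finrank_orthogonal L.1
  rw [L.2, finrank_euclideanSpace_fin] at h
  omega

/-- An upper bound that needs no measurability of `L ↦ ∫ 1{L + x ∈ S} dx`: `bind` and `map` are junk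
only in the direction of being too small. -/
lemma flatMeasure_apply_le (Q : Measure (LinearFlat d k)) {S : Set (Flat d k)}
    (hS : MeasurableSet S) {c : ℝ≥0∞}
    (h : ∀ L : LinearFlat d k, (μHE[d - k] : Measure (EuclideanSpace ℝ (Fin d)))
      (L.translate ⁻¹' S ∩ ((L.1)ᗮ : Submodule ℝ (EuclideanSpace ℝ (Fin d)))) ≤ c) :
    flatMeasure Q S ≤ c * Q Set.univ := by
  refine (Measure.bind_apply_le _ hS).trans ((lintegral_mono fun L => ?_).trans_eq
    (lintegral_const c))
  refine (map_apply_le _ _ hS).trans ?_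
  rw [Measure.restrict_apply₀']
  · exact h L
  · exact ((L.1)ᗮ.closed_of_finiteDimensional).measurableSet.nullMeasurableSet

/-- The Hausdorff measure of a centred ball of a linear subspace. -/
lemma euclideanHausdorffMeasure_inter_closedBall (W : Submodule ℝ (EuclideanSpace ℝ (Fin d)))
    {n : ℕ} (hW : Module.finrank ℝ W = n) (R : ℝ) :
    (μHE[n] : Measure (EuclideanSpace ℝ (Fin d))) (Metric.closedBall 0 R ∩ W) =
      volume (Metric.closedBall (0 : EuclideanSpace ℝ (Fin n)) R) := by
  let e : EuclideanSpace ℝ (Fin n) ≃ₗᵢ[ℝ] W :=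
    ((stdOrthonormalBasis ℝ W).reindex (finCongr hW)).repr.symm
  have hiso : Isometry fun v => (e v : EuclideanSpace ℝ (Fin d)) :=
    isometry_subtype_coe.comp e.isometry
  have : Metric.closedBall 0 R ∩ (W : Set (EuclideanSpace ℝ (Fin d))) =
      (fun v => (e v : EuclideanSpace ℝ (Fin d))) '' Metric.closedBall 0 R := by
    ext x
    constructor
    · rintro ⟨hx, hxW⟩
      refine ⟨e.symm ⟨x, hxW⟩, ?_, by simp⟩
      simpa using hx
    · rintro ⟨v, hv, rfl⟩
      refine ⟨?_, (e v).2⟩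
      rw [mem_closedBall_zero_iff] at hv ⊢
      exact (e.norm_map v).trans_le hv
  rw [this, hiso.euclideanHausdorffMeasure_image,
    EuclideanSpace.euclideanHausdorffMeasure_eq_volume]

/-- A flat `L + x` with `x ∈ L^⊥` hits the centred ball of radius `R` only if `‖x‖ ≤ R`. -/
lemma flatMeasure_hitting_lt_top (Q : Measure (LinearFlat d k)) [IsProbabilityMeasure Q] (R : ℝ) :
    flatMeasure Q (hitting k (Metric.closedBall 0 R)) < ∞ := by
  refine (flatMeasure_apply_le Q (measurableSet_hitting (isCompact_closedBall 0 R))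
    (c := volume (Metric.closedBall (0 : EuclideanSpace ℝ (Fin (d - k))) R))
    fun L => ?_).trans_lt ?_
  · rw [← euclideanHausdorffMeasure_inter_closedBall _ (finrank_orthogonal_linearFlat L)]
    refine measure_mono ?_
    rintro x ⟨⟨y, hy, hyR⟩, hx⟩
    refine ⟨?_, hx⟩
    -- the point of `L + x` closest to the origin is `x`
    have hyx : y - x ∈ L.1 := mem_translate.1 hy
    have hin : inner ℝ (y - x) x = 0 := Submodule.inner_right_of_mem_orthogonal hyx hx
    have hpy := norm_add_sq_eq_norm_sq_add_norm_sq_real hin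
    rw [sub_add_cancel] at hpy
    rw [mem_closedBall_zero_iff] at hyR ⊢
    refine le_trans ?_ hyR
    nlinarith [norm_nonneg x, norm_nonneg y, norm_nonneg (y - x)]
  · rw [measure_univ, mul_one]
    exact measure_closedBall_lt_top

instance sigmaFinite_flatMeasure (Q : Measure (LinearFlat d k)) [IsProbabilityMeasure Q] :
    SigmaFinite (flatMeasure Q) := by
  refine ⟨⟨⟨fun n : ℕ => hitting k (Metric.closedBall 0 n), fun _ => trivial,
    fun n => flatMeasure_hitting_lt_top Q n, ?_⟩⟩⟩
  refine Set.eq_univ_of_forall fun E => Set.mem_iUnion.2 ?_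
  obtain ⟨x, hx⟩ := E.2.1
  obtain ⟨n, hn⟩ := exists_nat_ge ‖x‖
  exact ⟨n, x, hx, by simpa using hn⟩

/-- The intensity measure has no atoms: distinct points of `L^⊥` define distinct translates of `L`,
and `d - k > 0`. -/
lemma nullSingletonClass_flatMeasure (hk : k < d) (Q : Measure (LinearFlat d k))
    [IsProbabilityMeasure Q] : NullSingletonClass (flatMeasure Q) where
  measure_singleton E := by
    refine nonpos_iff_eq_zero.1 ((flatMeasure_apply_le Q (measurableSet_singleton E) (c := 0)
      fun L => ?_).trans_eq (zero_mul _))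
    have hna : NullSingletonClass (μHE[d - k] : Measure (EuclideanSpace ℝ (Fin d))) := by
      have : NullSingletonClass
          (μH[((d - k : ℕ) : ℝ)] : Measure (EuclideanSpace ℝ (Fin d))) :=
        Measure.nullSingletonClass_hausdorff _ (by exact_mod_cast Nat.sub_pos_of_lt hk)
      refine ⟨fun x => ?_⟩
      rw [Measure.euclideanHausdorffMeasure_def, Measure.smul_apply, measure_singleton, smul_zero]
    refine (Set.Subsingleton.measure_zero ?_ _).le
    rintro x ⟨hx, hx'⟩ y ⟨hy, hy'⟩
    have hxy : L.translate x = L.translate y := Eq.trans hx (Eq.symm hy)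
    have hmem : x ∈ (L.translate y).1 := by
      rw [← hxy, mem_translate, sub_self]
      exact L.1.zero_mem
    have h1 : x - y ∈ L.1 := mem_translate.1 hmem
    have h2 : x - y ∈ (L.1)ᗮ := (L.1)ᗮ.sub_mem hx' hy'
    exact sub_eq_zero.1 (inner_self_eq_zero.1 (Submodule.inner_right_of_mem_orthogonal h1 h2))

end FlatMeasure

/-! ### Convergence in distribution through test functions -/

section Convergence

variable {ℓ : ℕ}

/-- Functions of a linear functional with bounded derivatives are test functions, up to a factor. -/
lemma exists_mul_mem_testFunctions {f : ℝ → ℝ} (hf : ContDiff ℝ 3 f)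
    (hb : ∀ n x, |iteratedDeriv n f x| ≤ 1) (L : (Fin ℓ → ℝ) →L[ℝ] ℝ) :
    ∃ ε : ℝ, 0 < ε ∧ (fun x => ε * f (L x)) ∈ testFunctions ℓ := by
  set ε : ℝ := ((1 + ‖L‖) ^ 3)⁻¹ with hε
  have hε0 : 0 < ε := by positivity
  have hfL : ContDiff ℝ 3 fun x => f (L x) := hf.comp L.contDiff
  have key : ∀ n : ℕ, n ≤ 3 → ∀ (x : Fin ℓ → ℝ) (v : Fin n → Fin ℓ → ℝ), (∀ i, ‖v i‖ ≤ 1) →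
      |iteratedFDeriv ℝ n (fun x => ε * f (L x)) x v| ≤ 1 := by
    intro n hn x v hv
    have hn' : (n : WithTop ℕ∞) ≤ 3 := by exact_mod_cast hn
    have e1 : iteratedFDeriv ℝ n (fun x => ε * f (L x)) x =
        ε • iteratedFDeriv ℝ n (fun x => f (L x)) x :=
      iteratedFDeriv_const_smul_apply (a := ε) (hfL.of_le hn').contDiffAt
    have e2 := L.iteratedFDeriv_comp_right hf x hn'
    have e3 : iteratedFDeriv ℝ n (fun x => f (L x)) x v =
        (∏ i, L (v i)) * iteratedDeriv n f (L x) := by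
      change iteratedFDeriv ℝ n (f ∘ L) x v = _
      rw [e2, ContinuousMultilinearMap.compContinuousLinearMap_apply,
        iteratedFDeriv_apply_eq_iteratedDeriv_mul_prod, smul_eq_mul]
    have h1 : |∏ i, L (v i)| ≤ (1 + ‖L‖) ^ 3 := by
      rw [Finset.abs_prod]
      calc ∏ i, |L (v i)| ≤ ∏ _i : Fin n, (1 + ‖L‖) := by
            refine Finset.prod_le_prod (fun _ _ => abs_nonneg _) fun i _ => ?_
            refine (L.le_opNorm (v i)).trans ?_
            have := mul_le_mul_of_nonneg_left (hv i) (norm_nonneg L)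
            linarith
        _ = (1 + ‖L‖) ^ n := by simp
        _ ≤ _ := pow_le_pow_right₀ (by linarith [norm_nonneg L]) hn
    rw [e1, smul_apply, e3, smul_eq_mul, abs_mul, abs_mul,
      abs_of_pos hε0]
    calc ε * (|∏ i, L (v i)| * |iteratedDeriv n f (L x)|)
        ≤ ε * ((1 + ‖L‖) ^ 3 * 1) := by
          gcongr
          exact hb n _
      _ = 1 := by
          rw [mul_one, hε]
          exact inv_mul_cancel₀ (by positivity)
  have hs : ∀ i : Fin ℓ, ‖(Pi.single i 1 : Fin ℓ → ℝ)‖ ≤ 1 := fun i => by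
    rw [Pi.norm_single]
    simp
  refine ⟨ε, hε0, contDiff_const.mul hfL, fun i j x => key 2 (by norm_num) x _ fun a => ?_,
    fun i j l x => key 3 le_rfl x _ fun a => ?_⟩
  · fin_cases a
    exacts [hs i, hs j]
  · fin_cases a
    exacts [hs i, hs j, hs l]

lemma integral_cexp_mul_I {Ω : Type*} [MeasurableSpace Ω] {P : Measure Ω}
    [IsProbabilityMeasure P] {Z : Ω → ℝ} (hZ : AEMeasurable Z P) :
    ∫ ω, Complex.exp ((Z ω : ℂ) * Complex.I) ∂P =
      ((∫ ω, Real.cos (Z ω) ∂P : ℝ) : ℂ) + ((∫ ω, Real.sin (Z ω) ∂P : ℝ) : ℂ) * Complex.I := by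
  have hc : Integrable (fun ω => Real.cos (Z ω)) P :=
    Integrable.of_bound (Real.measurable_cos.comp_aemeasurable hZ).aestronglyMeasurable 1
      (Eventually.of_forall fun ω => Real.abs_cos_le_one _)
  have hs : Integrable (fun ω => Real.sin (Z ω)) P :=
    Integrable.of_bound (Real.measurable_sin.comp_aemeasurable hZ).aestronglyMeasurable 1
      (Eventually.of_forall fun ω => Real.abs_sin_le_one _)
  rw [← integral_complex_ofReal, ← integral_complex_ofReal, ← integral_mul_const,
    ← integral_add hc.ofReal (hs.ofReal.mul_const _)]
  refine integral_congr_ae (Eventually.of_forall fun ω => ?_)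
  simp only [Complex.exp_mul_I, Complex.ofReal_cos, Complex.ofReal_sin]

/-- The linear functional `⟪·, u⟫` in coordinates. -/
def coordInner (u : EuclideanSpace ℝ (Fin ℓ)) : (Fin ℓ → ℝ) →L[ℝ] ℝ :=
  (innerSL ℝ u).comp (EuclideanSpace.equiv (Fin ℓ) ℝ).symm.toContinuousLinearMap

lemma charFun_map_equiv_symm {Ω : Type*} [MeasurableSpace Ω] {P : Measure Ω}
    [IsProbabilityMeasure P] {Z : Ω → Fin ℓ → ℝ} (hZ : AEMeasurable Z P)
    (u : EuclideanSpace ℝ (Fin ℓ)) :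
    charFun (P.map fun ω => (EuclideanSpace.equiv (Fin ℓ) ℝ).symm (Z ω)) u =
      ((∫ ω, Real.cos (coordInner u (Z ω)) ∂P : ℝ) : ℂ) +
        ((∫ ω, Real.sin (coordInner u (Z ω)) ∂P : ℝ) : ℂ) * Complex.I := by
  have hL : ∀ v : Fin ℓ → ℝ, inner ℝ ((EuclideanSpace.equiv (Fin ℓ) ℝ).symm v) u =
      coordInner u v := fun v => real_inner_comm _ _
  have hZe : AEMeasurable (fun ω => (EuclideanSpace.equiv (Fin ℓ) ℝ).symm (Z ω)) P :=
    (EuclideanSpace.equiv (Fin ℓ) ℝ).symm.continuous.measurable.comp_aemeasurable hZ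
  rw [charFun_apply, integral_map hZe (by fun_prop)]
  simp_rw [hL]
  exact integral_cexp_mul_I ((coordInner u).continuous.measurable.comp_aemeasurable hZ)

/-- Convergence of the expectations of all test functions implies convergence in distribution, by
Lévy's continuity theorem. -/
lemma tendstoInDistribution_of_testFunctions {ι Ω Ω' : Type*} [MeasurableSpace Ω]
    [MeasurableSpace Ω'] {P : Measure Ω} [IsProbabilityMeasure P] {P' : Measure Ω'}
    [IsProbabilityMeasure P'] {X : ι → Ω → Fin ℓ → ℝ} {Y : Ω' → Fin ℓ → ℝ} {l : Filter ι}
    [l.IsCountablyGenerated] (hX : ∀ t, AEMeasurable (X t) P) (hY : AEMeasurable Y P')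
    (h : ∀ f ∈ testFunctions ℓ, Tendsto (fun t => ∫ ω, f (X t ω) ∂P) l (𝓝 (∫ ω, f (Y ω) ∂P'))) :
    TendstoInDistribution X l Y (fun _ => P) P' := by
  let e := EuclideanSpace.equiv (Fin ℓ) ℝ
  have hXe : ∀ t, AEMeasurable (fun ω => e.symm (X t ω)) P := fun t =>
    e.symm.continuous.measurable.comp_aemeasurable (hX t)
  have hYe : AEMeasurable (fun ω => e.symm (Y ω)) P' :=
    e.symm.continuous.measurable.comp_aemeasurable hY
  have hE : TendstoInDistribution (fun t ω => e.symm (X t ω)) l (fun ω => e.symm (Y ω))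
      (fun _ => P) P' := by
    refine ⟨hXe, hYe, tendsto_of_seq_tendsto fun x hx => ?_⟩
    refine ProbabilityMeasure.tendsto_of_tendsto_charFun fun u => ?_
    let L := coordInner u
    have hlim : ∀ f : ℝ → ℝ, ContDiff ℝ 3 f → (∀ n y, |iteratedDeriv n f y| ≤ 1) →
        Tendsto (fun n => ∫ ω, f (L (X (x n) ω)) ∂P) atTop (𝓝 (∫ ω, f (L (Y ω)) ∂P')) := by
      intro f hf hb
      obtain ⟨ε, hε, hmem⟩ := exists_mul_mem_testFunctions hf hb L
      have h1 := ((h _ hmem).comp hx).const_mul ε⁻¹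
      simp only [Function.comp_def, integral_const_mul] at h1
      simpa only [inv_mul_cancel_left₀ hε.ne'] using h1
    have h2 := hlim Real.cos Real.contDiff_cos fun n y => Real.abs_iteratedDeriv_cos_le_one n y
    have h3 := hlim Real.sin Real.contDiff_sin fun n y => Real.abs_iteratedDeriv_sin_le_one n y
    have h4 := ((Complex.continuous_ofReal.tendsto _).comp h2).add
      (((Complex.continuous_ofReal.tendsto _).comp h3).mul_const Complex.I)
    change Tendsto (fun n => charFun (P.map fun ω => e.symm (X (x n) ω)) u) atTop
      (𝓝 (charFun (P'.map fun ω => e.symm (Y ω)) u))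
    simp_rw [e, charFun_map_equiv_symm (hX _)]
    rw [charFun_map_equiv_symm hY]
    exact h4
  have hc := hE.continuous_comp e.continuous
  simpa only [Function.comp_def, ContinuousLinearEquiv.apply_symm_apply] using hc

end Convergence

/-! ### Geometric functionals of the flat process -/

section Kernels

variable {d k m : ℕ} {Q : Measure (LinearFlat d k)}
  {𝒞₀ : Set (Compacts (EuclideanSpace ℝ (Fin d)))}
  {ψ : Compacts (EuclideanSpace ℝ (Fin d)) → ℝ}

/-- The kernel `(E₁, …, Eₘ) ↦ ψ(B ∩ E₁ ∩ ⋯ ∩ Eₘ)`. -/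
def flatKernel (ψ : Compacts (EuclideanSpace ℝ (Fin d)) → ℝ)
    (B : Compacts (EuclideanSpace ℝ (Fin d))) (E : Fin m → Flat d k) : ℝ :=
  ψ (interFlats B E)

/-- The flats hitting the centred ball of radius `R`. -/
abbrev hitBall (d k : ℕ) (R : ℝ) : Set (Flat d k) :=
  hitting k (Metric.closedBall (0 : EuclideanSpace ℝ (Fin d)) R)

lemma measurableSet_hitBall (R : ℝ) : MeasurableSet (hitBall d k R) :=
  measurableSet_hitting (isCompact_closedBall _ _)

/-- The intersections lie in `𝒞₀` by the closure property with `r = 1`. -/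
lemma measurable_flatKernel (hψ : IsGeometricFunctional Q m 𝒞₀ ψ) (B : 𝒞₀) :
    Measurable (flatKernel ψ B : (Fin m → Flat d k) → ℝ) := by
  have hmem : ∀ E : Fin m → Flat d k, interFlats (B : Compacts _) E ∈ 𝒞₀ := by
    intro E
    have h := hψ.smul_inter_mem B B.2 1 one_pos (⨅ i, (E i).1)
    have e : (B : Compacts (EuclideanSpace ℝ (Fin d))).map (fun x => (1 : ℝ) • x)
        (continuous_const_smul 1) = B := by
      refine SetLike.coe_injective ?_
      simp
    rw [e] at h
    exact h
  exact hψ.measurable.comp ((measurable_interFlats (B : Compacts _)).subtype_mk (h := hmem))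

lemma flatKernel_eq_zero (hψ : IsGeometricFunctional Q m 𝒞₀ ψ)
    {B : Compacts (EuclideanSpace ℝ (Fin d))} {R : ℝ}
    (hB : (B : Set (EuclideanSpace ℝ (Fin d))) ⊆ Metric.closedBall 0 R) {n : ℕ}
    {E : Fin n → Flat d k} {j : Fin n} (hj : E j ∉ hitBall d k R) : flatKernel ψ B E = 0 := by
  rw [flatKernel, interFlats_eq_bot hB hj, hψ.map_empty]

lemma innerIntegral_eq (Q : Measure (LinearFlat d k)) (B : Compacts (EuclideanSpace ℝ (Fin d)))
    (y : Flat d k) : innerIntegral Q (m + 1) ψ B y =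
      ∫ z, slice (flatKernel ψ B : (Fin (m + 1) → Flat d k) → ℝ) y z
        ∂(Measure.pi fun _ : Fin m => flatMeasure Q) := by
  change ∫ E : Fin m → Flat d k, ψ (interFlats (interAffine B y.1) E)
    ∂(Measure.pi fun _ => flatMeasure Q) = _
  have e : slice (flatKernel ψ B : (Fin (m + 1) → Flat d k) → ℝ) y =
      fun E => ψ (interFlats (interAffine B y.1) E) := slice_interFlats ψ B y
  rw [e]

/-- A flat missing the ball makes all intersections empty, and `ψ ∅ = 0`. -/
lemma innerIntegral_eq_zero (hψ : IsGeometricFunctional Q (m + 1) 𝒞₀ ψ)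
    {B : Compacts (EuclideanSpace ℝ (Fin d))} {R : ℝ}
    (hB : (B : Set (EuclideanSpace ℝ (Fin d))) ⊆ Metric.closedBall 0 R) {y : Flat d k}
    (hy : y ∉ hitBall d k R) : innerIntegral Q (m + 1) ψ B y = 0 := by
  rw [innerIntegral_eq]
  refine (integral_congr_ae (Eventually.of_forall fun z => ?_)).trans (integral_zero _ _)
  exact flatKernel_eq_zero hψ (j := 0) hB (by simpa using hy)

variable [IsProbabilityMeasure Q]

instance isFiniteMeasure_restrict_hitBall (R : ℝ) :
    IsFiniteMeasure ((flatMeasure Q).restrict (hitBall d k R)) :=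
  ⟨by simpa using flatMeasure_hitting_lt_top Q R⟩

lemma pi_restrict_hitBall (m : ℕ) (R : ℝ) :
    Measure.pi (fun _ : Fin m => (flatMeasure Q).restrict (hitBall d k R)) =
      (Measure.pi fun _ : Fin m => flatMeasure Q).restrict (Set.univ.pi fun _ => hitBall d k R) :=
  (Measure.restrict_pi_pi _ _).symm

lemma lintegral_flatKernel_ne_top (hψ : IsGeometricFunctional Q m 𝒞₀ ψ) (B : 𝒞₀) (R : ℝ) :
    ∫⁻ E : Fin m → Flat d k, ‖flatKernel ψ B E‖ₑ ^ 3
      ∂(Measure.pi fun _ => (flatMeasure Q).restrict (hitBall d k R)) ≠ ∞ := by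
  obtain ⟨c, hc⟩ := hψ.thirdMoment B B.2
  rw [pi_restrict_hitBall]
  exact ((lintegral_mono' Measure.restrict_le_self le_rfl).trans_lt
    (hc.trans_lt ENNReal.coe_lt_top)).ne

lemma exists_subset_closedBall {ℓ : ℕ} (B : Fin ℓ → 𝒞₀) :
    ∃ R : ℝ, ∀ i, ((B i : Compacts (EuclideanSpace ℝ (Fin d))) :
      Set (EuclideanSpace ℝ (Fin d))) ⊆ Metric.closedBall 0 R := by
  have h : ∀ i, ∃ R : ℝ, ((B i : Compacts (EuclideanSpace ℝ (Fin d))) :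
      Set (EuclideanSpace ℝ (Fin d))) ⊆ Metric.closedBall 0 R := fun i =>
    (B i : Compacts (EuclideanSpace ℝ (Fin d))).isCompact.isBounded.subset_closedBall 0
  choose R hR using h
  refine ⟨∑ i, |R i|, fun i => (hR i).trans (Metric.closedBall_subset_closedBall ?_)⟩
  exact (le_abs_self _).trans (Finset.single_le_sum (f := fun i => |R i|)
    (fun _ _ => abs_nonneg _) (Finset.mem_univ i))

/-- The third moment bound implies integrability because the kernel vanishes off a set of finite
measure. -/
lemma integrable_flatKernel (hψ : IsGeometricFunctional Q m 𝒞₀ ψ) (B : 𝒞₀) :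
    Integrable (flatKernel ψ B : (Fin m → Flat d k) → ℝ)
      (Measure.pi fun _ => flatMeasure Q) := by
  obtain ⟨R, hR⟩ := exists_subset_closedBall fun _ : Fin 1 => B
  have h1 := (memLp_three_of_lintegral (measurable_flatKernel hψ B).aestronglyMeasurable
    (lintegral_flatKernel_ne_top hψ B R)).integrable (by norm_num)
  rw [pi_restrict_hitBall] at h1
  refine (integrableOn_iff_integrable_of_support_subset
    (Function.support_subset_iff'.2 fun z hz => ?_)).1 h1
  simp only [Set.mem_univ_pi, not_forall] at hz
  obtain ⟨j, hj⟩ := hz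
  exact flatKernel_eq_zero hψ (hR 0) hj

/-- Only flats hitting a ball that contains `B` matter, so that the iterated integrals with respect
to the restricted intensity measure are those with respect to the full one. -/
lemma ae_proj_eq_innerIntegral (hψ : IsGeometricFunctional Q (m + 1) 𝒞₀ ψ) (B : 𝒞₀) {R : ℝ}
    (hB : ((B : Compacts (EuclideanSpace ℝ (Fin d))) : Set (EuclideanSpace ℝ (Fin d))) ⊆
      Metric.closedBall 0 R) :
    ∀ᵐ y ∂((flatMeasure Q).restrict (hitBall d k R)),
      proj ((flatMeasure Q).restrict (hitBall d k R))
        (flatKernel ψ B : (Fin (m + 1) → Flat d k) → ℝ) y = innerIntegral Q (m + 1) ψ B y := by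
  have h1 := (memLp_three_of_lintegral (measurable_flatKernel hψ B).aestronglyMeasurable
    (lintegral_flatKernel_ne_top hψ B R)).integrable (by norm_num)
  filter_upwards [ae_proj_eq_integral _ h1] with y hy
  rw [hy, innerIntegral_eq, pi_restrict_hitBall]
  refine setIntegral_eq_integral_of_forall_compl_eq_zero fun z hz => ?_
  simp only [Set.mem_univ_pi, not_forall] at hz
  obtain ⟨j, hj⟩ := hz
  exact flatKernel_eq_zero hψ (j := j.succ) hB (by simpa using hj)

/-- The integral defining the covariance function, reduced to the flats hitting a ball. -/
lemma integral_innerIntegral_mul (hψ : IsGeometricFunctional Q (m + 1) 𝒞₀ ψ) (A B : 𝒞₀) {R : ℝ}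
    (hA : ((A : Compacts (EuclideanSpace ℝ (Fin d))) : Set (EuclideanSpace ℝ (Fin d))) ⊆
      Metric.closedBall 0 R)
    (hB : ((B : Compacts (EuclideanSpace ℝ (Fin d))) : Set (EuclideanSpace ℝ (Fin d))) ⊆
      Metric.closedBall 0 R) :
    Integrable (fun y => innerIntegral Q (m + 1) ψ A y * innerIntegral Q (m + 1) ψ B y)
      (flatMeasure Q) ∧
    ∫ y, innerIntegral Q (m + 1) ψ A y * innerIntegral Q (m + 1) ψ B y ∂(flatMeasure Q) =
      ∫ y, proj ((flatMeasure Q).restrict (hitBall d k R))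
          (flatKernel ψ A : (Fin (m + 1) → Flat d k) → ℝ) y *
        proj ((flatMeasure Q).restrict (hitBall d k R))
          (flatKernel ψ B : (Fin (m + 1) → Flat d k) → ℝ) y
        ∂((flatMeasure Q).restrict (hitBall d k R)) := by
  set μ := (flatMeasure Q).restrict (hitBall d k R) with hμ
  have hp : ∀ D : 𝒞₀, MemLp (proj μ (flatKernel ψ D : (Fin (m + 1) → Flat d k) → ℝ)) 2 μ :=
    fun D => (memLp_three_of_lintegral
      (measurable_proj μ (measurable_flatKernel hψ D)).aestronglyMeasurable
      (lintegral_proj_pow_three_ne_top μ (measurable_flatKernel hψ D)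
        (lintegral_flatKernel_ne_top hψ D R))).mono_exponent (by norm_num)
  have hae : (fun y => proj μ (flatKernel ψ A : (Fin (m + 1) → Flat d k) → ℝ) y *
      proj μ (flatKernel ψ B : (Fin (m + 1) → Flat d k) → ℝ) y) =ᵐ[μ]
      fun y => innerIntegral Q (m + 1) ψ A y * innerIntegral Q (m + 1) ψ B y := by
    filter_upwards [ae_proj_eq_innerIntegral hψ A hA, ae_proj_eq_innerIntegral hψ B hB]
      with y h1 h2
    rw [h1, h2]
  have hoff : ∀ y, y ∉ hitBall d k R →
      innerIntegral Q (m + 1) ψ A y * innerIntegral Q (m + 1) ψ B y = 0 := fun y hy => by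
    rw [innerIntegral_eq_zero hψ hA hy, zero_mul]
  refine ⟨?_, ?_⟩
  · exact (integrableOn_iff_integrable_of_support_subset
      (Function.support_subset_iff'.2 hoff)).1 (((hp A).integrable_mul (hp B)).congr hae)
  · rw [integral_congr_ae hae]
    exact (setIntegral_eq_integral_of_forall_compl_eq_zero hoff).symm

end Kernels

section Functionals

variable {d k m : ℕ} {Q : Measure (LinearFlat d k)} [IsProbabilityMeasure Q]
  {𝒞₀ : Set (Compacts (EuclideanSpace ℝ (Fin d)))}
  {ψ : Compacts (EuclideanSpace ℝ (Fin d)) → ℝ}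
  {Ω : Type*} [MeasurableSpace Ω] {P : Measure Ω} [IsProbabilityMeasure P]

/-- The joint law of the functionals `ζ(B₁), …, ζ(B_ℓ)` is that of `U`-statistics of a Poisson
configuration of flats hitting a large ball. -/
lemma identDistrib_flatKernel (hk : k < d) (hψ : IsGeometricFunctional Q m 𝒞₀ ψ) {t : ℝ≥0}
    {η : Ω → Measure (Flat d k)} (hη : IsPoissonProcess P η ((t : ℝ≥0∞) • flatMeasure Q)) {ℓ : ℕ}
    {B : Fin ℓ → 𝒞₀} {R : ℝ}
    (hB : ∀ i, ((B i : Compacts (EuclideanSpace ℝ (Fin d))) : Set (EuclideanSpace ℝ (Fin d))) ⊆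
      Metric.closedBall 0 R) :
    (∀ i, ∀ᵐ ω ∂P, Integrable (flatKernel ψ (B i)) (factorialMeasure m (η ω))) ∧
    IdentDistrib (fun ω i => ∫ E, flatKernel ψ (B i) E ∂(factorialMeasure m (η ω)))
      (fun c i => uStat m (flatKernel ψ (B i)) c) P
      (poissonConf (t • (flatMeasure Q).restrict (hitBall d k R))) := by
  have hna : NullSingletonClass ((t : ℝ≥0∞) • flatMeasure Q) := by
    have := nullSingletonClass_flatMeasure hk Q
    exact ⟨fun E => by rw [Measure.smul_apply, measure_singleton, smul_zero]⟩
  have h := hη.identDistrib_factorial (m := m) (measurableSet_hitBall R) (by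
    rw [Measure.smul_apply, smul_eq_mul]
    exact ENNReal.mul_ne_top ENNReal.coe_ne_top (flatMeasure_hitting_lt_top Q R).ne)
    (fun i => measurable_flatKernel hψ (B i)) fun i z hz => by
      obtain ⟨j, hj⟩ := hz
      exact flatKernel_eq_zero hψ (hB i) hj
  rw [Measure.restrict_smul] at h
  exact h

/-- Square integrability and the mean of `ζ(B)`. -/
lemma integral_zeta (hk : k < d) (hψ : IsGeometricFunctional Q m 𝒞₀ ψ) {t : ℝ≥0}
    {η : Ω → Measure (Flat d k)} (hη : IsPoissonProcess P η ((t : ℝ≥0∞) • flatMeasure Q)) {B : 𝒞₀}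
    {R : ℝ} (hB : ((B : Compacts (EuclideanSpace ℝ (Fin d))) : Set (EuclideanSpace ℝ (Fin d))) ⊆
      Metric.closedBall 0 R) :
    MemLp (zeta m ψ η B) 2 P ∧ ∫ ω, zeta m ψ η B ω ∂P = (1 / (m.factorial : ℝ)) *
      iterMean (t • (flatMeasure Q).restrict (hitBall d k R)) m
        (flatKernel ψ B : (Fin m → Flat d k) → ℝ) := by
  obtain ⟨-, hid⟩ := identDistrib_flatKernel hk hψ hη (B := fun _ : Fin 1 => B) fun _ => hB
  have hid0 := hid.comp (measurable_pi_apply (0 : Fin 1))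
  have hf := measurable_flatKernel hψ B
  have h2 : sqNorm (flatKernel ψ B : (Fin m → Flat d k) → ℝ)
      (Measure.pi fun _ : Fin m => t • (flatMeasure Q).restrict (hitBall d k R)) ≠ ∞ := by
    refine sqNorm_ne_top_of_cube hf.aestronglyMeasurable ?_
    rw [pi_smul_measure, lintegral_smul_measure, ENNReal.smul_def, smul_eq_mul]
    exact ENNReal.mul_ne_top ENNReal.coe_ne_top (lintegral_flatKernel_ne_top hψ B R)
  have hL : MemLp (fun ω => ∫ E, flatKernel ψ B E ∂(factorialMeasure m (η ω))) 2 P :=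
    hid0.symm.memLp_snd (memLp_uStat _ hf h2)
  refine ⟨hL.const_mul _, ?_⟩
  change ∫ ω, (1 / (m.factorial : ℝ)) * ∫ E, flatKernel ψ B E ∂(factorialMeasure m (η ω)) ∂P = _
  have hi := integrable_of_sqNorm _ hf h2
  rw [integral_const_mul, iterMean_eq_integral _ hi, ← integral_uStat _ hf hi]
  exact congrArg _ hid0.integral_eq

/-- The law of the normalized functionals, in terms of a Poisson configuration. -/
lemma identDistrib_zetaHat (hk : k < d) (hψ : IsGeometricFunctional Q (m + 1) 𝒞₀ ψ) {t : ℝ≥0}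
    (ht : 0 < t) {η : ℝ → Ω → Measure (Flat d k)}
    (hη : IsPoissonProcess P (η t) ((t : ℝ≥0∞) • flatMeasure Q)) {ℓ : ℕ} {B : Fin ℓ → 𝒞₀} {R : ℝ}
    (hB : ∀ i, ((B i : Compacts (EuclideanSpace ℝ (Fin d))) : Set (EuclideanSpace ℝ (Fin d))) ⊆
      Metric.closedBall 0 R) :
    IdentDistrib (fun ω i => zetaHat P (m + 1) ψ η t (B i) ω)
      (fun c i => ((t : ℝ) ^ m * √(t : ℝ))⁻¹ * (1 / ((m + 1).factorial : ℝ)) *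
        centU (m := m + 1) (t • (flatMeasure Q).restrict (hitBall d k R)) (flatKernel ψ (B i)) c) P
      (poissonConf (t • (flatMeasure Q).restrict (hitBall d k R))) := by
  set μ := t • (flatMeasure Q).restrict (hitBall d k R) with hμ
  have hid := (identDistrib_flatKernel hk hψ hη hB).2
  have hpow : (t : ℝ) ^ (-(((m + 1 : ℕ) : ℝ) - 1 / 2)) = ((t : ℝ) ^ m * √(t : ℝ))⁻¹ := by
    have ht' : (0 : ℝ) < t := ht
    have e : ((m + 1 : ℕ) : ℝ) - 1 / 2 = m + 1 / 2 := by
      push_cast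
      ring
    rw [e, Real.rpow_neg ht'.le, Real.rpow_add ht', Real.rpow_natCast, Real.sqrt_eq_rpow]
  have hΦ : Measurable fun (v : Fin ℓ → ℝ) i => ((t : ℝ) ^ m * √(t : ℝ))⁻¹ *
      (1 / ((m + 1).factorial : ℝ)) * (v i - iterMean μ (m + 1) (flatKernel ψ (B i))) :=
    measurable_pi_lambda _ fun i => ((measurable_pi_apply i).sub_const _).const_mul _
  have h := hid.comp hΦ
  have e : (fun ω i => zetaHat P (m + 1) ψ η t (B i) ω) =
      (fun (v : Fin ℓ → ℝ) i => ((t : ℝ) ^ m * √(t : ℝ))⁻¹ *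
        (1 / ((m + 1).factorial : ℝ)) * (v i - iterMean μ (m + 1) (flatKernel ψ (B i)))) ∘
      fun ω i => ∫ E, flatKernel ψ (B i) E ∂(factorialMeasure (m + 1) (η t ω)) := by
    funext ω i
    simp only [zetaHat, Function.comp]
    rw [(integral_zeta hk hψ hη (hB i)).2, hpow, zeta]
    simp only [flatKernel]
    ring
  rw [e]
  exact h

variable {Ω' : Type*} [MeasurableSpace Ω'] {P' : Measure Ω'}

lemma hasGaussianLaw_vector {T : Type*} {ξ : T → Ω' → ℝ} (hξ : IsGaussianProcess ξ P') {ℓ : ℕ}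
    (B : Fin ℓ → T) : HasGaussianLaw (fun ω i => ξ (B i) ω) P' := by
  let L : (↥(Finset.univ : Finset (Fin ℓ)) → ℝ) →L[ℝ] (Fin ℓ → ℝ) :=
    ContinuousLinearMap.pi fun i => ContinuousLinearMap.proj ⟨i, Finset.mem_univ i⟩
  exact ((hξ.comp_right B).hasGaussianLaw Finset.univ).map L

/-- The bound on the distance of the normalized functionals to their Gaussian limits. -/
lemma exists_abs_zetaHat_sub_le [IsProbabilityMeasure P'] (hk : k < d)
    (hψ : IsGeometricFunctional Q (m + 1) 𝒞₀ ψ) {η : ℝ → Ω → Measure (Flat d k)}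
    (hη : ∀ t : ℝ, 0 < t → IsPoissonProcess P (η t) (ENNReal.ofReal t • flatMeasure Q))
    {ξ : 𝒞₀ → Ω' → ℝ}
    (hξ : IsCenteredGaussianField P' ξ fun A B => asympCov Q (m + 1) ψ A B) {ℓ : ℕ}
    (B : Fin ℓ → 𝒞₀) :
    ∃ C : ℝ, ∀ t : ℝ, 1 ≤ t → ∀ h ∈ testFunctions ℓ,
      |∫ ω, h (fun i => zetaHat P (m + 1) ψ η t (B i) ω) ∂P -
        ∫ ω, h (fun i => ξ (B i) ω) ∂P'| ≤ C / √t := by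
  obtain ⟨R, hR⟩ := exists_subset_closedBall B
  obtain ⟨C, hC⟩ := exists_abs_uStat_sub_le ((flatMeasure Q).restrict (hitBall d k R))
    (f := fun i => (flatKernel ψ (B i) : (Fin (m + 1) → Flat d k) → ℝ))
    (fun i => measurable_flatKernel hψ (B i)) (fun i => symmKernel_interFlats ψ (B i))
    (fun i => lintegral_flatKernel_ne_top hψ (B i) R) (hasGaussianLaw_vector hξ.gaussian B)
    (fun i => hξ.centered (B i)) fun i j => by
      refine (hξ.covariance (B i) (B j)).trans ?_
      rw [asympCov, (integral_innerIntegral_mul hψ (B i) (B j) (hR i) (hR j)).2]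
      rfl
  refine ⟨C, fun t ht h hh => ?_⟩
  have ht0 : 0 < t := zero_lt_one.trans_le ht
  lift t to ℝ≥0 using ht0.le
  have hηt := hη t ht0
  rw [ENNReal.ofReal_coe_nnreal] at hηt
  have hid := (identDistrib_zetaHat hk hψ (by exact_mod_cast ht0) hηt hR).comp
    hh.1.continuous.measurable
  have he := hid.integral_eq
  simp only [Function.comp] at he
  rw [he]
  exact hC t (by exact_mod_cast ht) h hh

lemma aemeasurable_zetaHat (hk : k < d) (hψ : IsGeometricFunctional Q (m + 1) 𝒞₀ ψ)
    {η : ℝ → Ω → Measure (Flat d k)}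
    (hη : ∀ t : ℝ, 0 < t → IsPoissonProcess P (η t) (ENNReal.ofReal t • flatMeasure Q)) {ℓ : ℕ}
    (B : Fin ℓ → 𝒞₀) {t : ℝ} (ht : 0 < t) :
    AEMeasurable (fun ω i => zetaHat P (m + 1) ψ η t (B i) ω) P := by
  obtain ⟨R, hR⟩ := exists_subset_closedBall B
  lift t to ℝ≥0 using ht.le
  have hηt := hη t ht
  rw [ENNReal.ofReal_coe_nnreal] at hηt
  exact (identDistrib_zetaHat hk hψ (by exact_mod_cast ht) hηt hR).aemeasurable_fst

end Functionals

end PoissonFlats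

end

theorem mainTheorem5 {d k m : ℕ} (hk : k < d) (hm : 1 ≤ m)
    (Q : Measure (PoissonFlats.LinearFlat d k)) [IsProbabilityMeasure Q]
    (𝒞₀ : Set (Compacts (EuclideanSpace ℝ (Fin d))))
    (ψ : Compacts (EuclideanSpace ℝ (Fin d)) → ℝ)
    (hψ : PoissonFlats.IsGeometricFunctional Q m 𝒞₀ ψ)
    {Ω : Type*} [MeasurableSpace Ω] (P : Measure Ω) [IsProbabilityMeasure P]
    (η : ℝ → Ω → Measure (PoissonFlats.Flat d k))
    (hη : ∀ t : ℝ, 0 < t →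
      PoissonFlats.IsPoissonProcess P (η t) (ENNReal.ofReal t • PoissonFlats.flatMeasure Q))
    {Ω' : Type*} [MeasurableSpace Ω'] (P' : Measure Ω') [IsProbabilityMeasure P']
    (ξ : 𝒞₀ → Ω' → ℝ)
    (hξ : PoissonFlats.IsCenteredGaussianField P' ξ
      (fun A B => PoissonFlats.asympCov Q m ψ A B)) :
    -- the random variables `ζ_t(B)` are well defined and square integrable
    (∀ t : ℝ, 0 < t → ∀ B : 𝒞₀,
      (∀ᵐ ω ∂P, Integrable (fun E => ψ (PoissonFlats.interFlats B E))
        (PoissonFlats.factorialMeasure m (η t ω))) ∧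
      MemLp (PoissonFlats.zeta m ψ (η t) B) 2 P) ∧
    -- the integrals defining the covariance function `C` exist
    (∀ B : 𝒞₀, ∀ᵐ E₁ ∂(PoissonFlats.flatMeasure Q),
      Integrable (fun E : Fin (m - 1) → PoissonFlats.Flat d k =>
        ψ (PoissonFlats.interFlats (PoissonFlats.interAffine B E₁.1) E))
        (Measure.pi fun _ => PoissonFlats.flatMeasure Q)) ∧
    (∀ A B : 𝒞₀, Integrable (fun E₁ =>
        PoissonFlats.innerIntegral Q m ψ A E₁ * PoissonFlats.innerIntegral Q m ψ B E₁)
      (PoissonFlats.flatMeasure Q)) ∧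
    -- the bound on the `d₃`-distance
    (∀ (ℓ : ℕ), 1 ≤ ℓ → ∀ B : Fin ℓ → 𝒞₀, ∃ c : ℝ, ∀ t : ℝ, 1 ≤ t →
      PoissonFlats.d3 P (fun ω i => PoissonFlats.zetaHat P m ψ η t (B i) ω)
        P' (fun ω i => ξ (B i) ω) ≤ ENNReal.ofReal (c * t ^ (-(1 / 2) : ℝ))) ∧
    -- convergence of the finite-dimensional distributions as `t → ∞`
    (∀ (ℓ : ℕ), 1 ≤ ℓ → ∀ B : Fin ℓ → 𝒞₀,
      TendstoInDistribution
        (fun (t : Set.Ioi (0 : ℝ)) ω i => PoissonFlats.zetaHat P m ψ η t (B i) ω) atTop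
        (fun ω i => ξ (B i) ω) (fun _ => P) P') := by
  obtain ⟨m, rfl⟩ : ∃ n, m = n + 1 := ⟨m - 1, by omega⟩
  have hbound : ∀ (ℓ : ℕ) (B : Fin ℓ → 𝒞₀), ∃ C : ℝ, ∀ t : ℝ, 1 ≤ t →
      ∀ h ∈ PoissonFlats.testFunctions ℓ,
        |∫ ω, h (fun i => PoissonFlats.zetaHat P (m + 1) ψ η t (B i) ω) ∂P -
          ∫ ω, h (fun i => ξ (B i) ω) ∂P'| ≤ C / √t := fun ℓ B =>
    PoissonFlats.exists_abs_zetaHat_sub_le hk hψ hη hξ B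
  refine ⟨fun t ht B => ?_, fun B => ?_, fun A B => ?_, fun ℓ _ B => ?_, fun ℓ _ B => ?_⟩
  · obtain ⟨R, hR⟩ := PoissonFlats.exists_subset_closedBall fun _ : Fin 1 => B
    lift t to ℝ≥0 using ht.le
    have hηt := hη t ht
    rw [ENNReal.ofReal_coe_nnreal] at hηt
    exact ⟨(PoissonFlats.identDistrib_flatKernel hk hψ hηt hR).1 0,
      (PoissonFlats.integral_zeta hk hψ hηt (hR 0)).1⟩
  · filter_upwards [(PoissonFlats.integrable_slice _
      (PoissonFlats.integrable_flatKernel hψ B)).prod_right_ae] with y hy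
    have e : PoissonFlats.slice
        (PoissonFlats.flatKernel ψ B : (Fin (m + 1) → PoissonFlats.Flat d k) → ℝ) y =
        fun E => ψ (PoissonFlats.interFlats (PoissonFlats.interAffine B y.1) E) :=
      PoissonFlats.slice_interFlats ψ B y
    have hy' : Integrable (PoissonFlats.slice
        (PoissonFlats.flatKernel ψ B : (Fin (m + 1) → PoissonFlats.Flat d k) → ℝ) y)
        (Measure.pi fun _ : Fin m => PoissonFlats.flatMeasure Q) := hy
    rw [e] at hy'
    exact hy'
  · obtain ⟨R, hR⟩ := PoissonFlats.exists_subset_closedBall ![A, B]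
    exact (PoissonFlats.integral_innerIntegral_mul hψ A B (hR 0) (hR 1)).1
  · obtain ⟨C, hC⟩ := hbound ℓ B
    refine ⟨C, fun t ht => iSup₂_le fun h hh => ENNReal.ofReal_le_ofReal ?_⟩
    refine (hC t ht h hh).trans_eq ?_
    rw [Real.rpow_neg (zero_le_one.trans ht), ← Real.sqrt_eq_rpow, div_eq_mul_inv]
  · obtain ⟨C, hC⟩ := hbound ℓ B
    have hgen : (atTop : Filter (Set.Ioi (0 : ℝ))).IsCountablyGenerated := by
      rw [atTop_Ioi_eq]
      infer_instance
    refine PoissonFlats.tendstoInDistribution_of_testFunctions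
      (fun t => PoissonFlats.aemeasurable_zetaHat hk hψ hη B t.2)
      (PoissonFlats.hasGaussianLaw_vector hξ.gaussian B).aemeasurable fun h hh => ?_
    have hlim : Tendsto (fun t : ℝ => C / √t) atTop (𝓝 0) :=
      Real.tendsto_sqrt_atTop.const_div_atTop C
    refine tendsto_iff_norm_sub_tendsto_zero.2 (squeeze_zero' (Eventually.of_forall fun _ =>
      norm_nonneg _) ?_ (tendsto_comp_val_Ioi_atTop.2 hlim))
    filter_upwards [eventually_ge_atTop (⟨1, Set.mem_Ioi.2 one_pos⟩ : Set.Ioi (0 : ℝ))] with t ht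
    exact hC t ht h hh
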